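/- Let $M$ be a compact smooth Riemannian manifold (without boundary) of dimension $n\ge 1$, and let $x:M\to\mathbb R^N$ be an isometric embedding with second fundamental form $\mathrm{II}$, mean curvature vector $\mathbf H=\operatorname{tr}\mathrm{II}$ and mean curvature function $H=\frac1n|\mathbf H|$. Let $S$ be a (real or complex) Dirac bundle over $M$: a smooth bundle of left modules over the Clifford bundle $Cl(M)$ (with $v\cdot v=-|v|^2$ for tangent vectors $v$), with a smooth Riemannian (resp. Hermitian) fibre metric $\langle\cdot,\cdot\rangle$ and a smooth metric connection $\nabla$ such that $$\langle v\cdot\sigma_1,\sigma_2\rangle+\langle\sigma_1,v\cdot\sigma_2\rangle=0\quad\text{for tangent vectors } v,\qquad \nabla(\varphi\cdot\sigma)=(\nabla\varphi)\cdot\sigma+\varphi\cdot\nabla\sigma\quad\text{for }\varphi\in\Gamma(Cl(M)),\ \sigma\in\Gamma(S),$$ where $Cl(M)$ carries the connection induced by the Levi-Civita connection; in the complex case Clifford multiplication and $\nabla$ are complex linear. Let $D=\sum_i e_i\cdot\nabla_{e_i}$ be its Dirac operator and $$\mathfrak R=\sum_{i<j}e_i\cdot e_j\cdot\big([\nabla_{e_i},\nabla_{e_j}]-\nabla_{[e_i,e_j]}\big)$$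 the curvature term of the Bochner identity $D^2=\nabla^*\nabla+\mathfrak R$, where $(e_i)$ is a local orthonormal frame of $TM$. Let $\{\lambda_j;\varphi_j\}_{j\ge1}$ be a spectral resolution of $D^2$: $(\varphi_j)$ is an orthonormal basis of $L^2(S)$ consisting of smooth sections with $D^2\varphi_j=\lambda_j\varphi_j$ and $\lambda_1\le\lambda_2\le\cdots$. Write $(\sigma,\tau)=\operatorname{Re}\int_M\langle\sigma,\tau\rangle$, the integral being taken with respect to the Riemannian volume. Then, for every $k\ge1$, $$\sum_{i=1}^k(\lambda_{k+1}-\lambda_i)^2\le\frac4n\sum_{i=1}^k(\lambda_{k+1}-\lambda_i)\Big(\lambda_i+\tfrac14\big(n^2(H^2\varphi_i,\varphi_i)-4(\mathfrak R\varphi_i,\varphi_i)\big)\Big).$$ Moreover, if $k\ge1$ and $R\in\mathbb R$ are such that $(\mathfrak R\varphi_i,\varphi_i)\ge R$ for $i=1,\dots,k$, then the numbers $\eta_i=\lambda_i+\frac14n^2\sup_MH^2-R$ satisfy $$\sum_{i=1}^k(\eta_{k+1}-\eta_i)\Big(\eta_{k+1}-\big(1+\tfrac4n\big)\eta_i\Big)\le0.$$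 -/

import Mathlib

open Bundle MeasureTheory
open scoped Manifold ContDiff

noncomputable section

namespace DiracYang

section Tangent

variable {n : ℕ} {M : Type*} [TopologicalSpace M]
  [ChartedSpace (EuclideanSpace ℝ (Fin n)) M]

instance finiteDimensional_tangentSpace (x : M) : FiniteDimensional ℝ (TangentSpace (𝓡 n) x) :=
  inferInstanceAs (FiniteDimensional ℝ (EuclideanSpace ℝ (Fin n)))

variable [RiemannianBundle (fun x : M ↦ TangentSpace (𝓡 n) x)]

/-- The coordinate vector field `∂ᵢ` of the preferred chart at `p`, at the point with
coordinates `y`. -/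
def coordVec (p : M) (y : EuclideanSpace ℝ (Fin n)) (i : Fin n) :
    TangentSpace (𝓡 n) ((chartAt (EuclideanSpace ℝ (Fin n)) p).symm y) :=
  mfderiv (𝓡 n) (𝓡 n) (chartAt (EuclideanSpace ℝ (Fin n)) p).symm y
    ((NormedSpace.fromTangentSpace (𝕜 := ℝ) y).symm (EuclideanSpace.single i 1))

/-- The matrix `g_{ij} = ⟨∂ᵢ, ∂ⱼ⟩` of the metric in the preferred chart at `p`. -/
def gram (p : M) (y : EuclideanSpace ℝ (Fin n)) : Matrix (Fin n) (Fin n) ℝ :=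
  Matrix.of fun i j ↦ inner ℝ (coordVec p y i) (coordVec p y j)

/-- The measure `√(det g_{ij}) dy¹ ⋯ dyⁿ` of the preferred chart at `p`, as a measure on `M`
carried by the domain of that chart. -/
def chartVolume [MeasurableSpace M] (p : M) : Measure M :=
  ((volume.restrict (chartAt (EuclideanSpace ℝ (Fin n)) p).target).withDensity
    fun y ↦ ENNReal.ofReal (Real.sqrt (gram p y).det)).map
      (chartAt (EuclideanSpace ℝ (Fin n)) p).symm

variable (n M) in
/-- The Riemannian volume measure. The measures `chartVolume p` agree on the overlaps of the
chart domains, so that their supremum is the measure which restricts to `chartVolume p` on the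
domain of the chart at `p`, for every `p`. -/
def riemannianVolume [MeasurableSpace M] : Measure M :=
  ⨆ p : M, chartVolume (n := n) p

/-- The quadratic form `v ↦ -⟨v, v⟩` on a tangent space; its Clifford algebra, in which
`v * v = -⟨v, v⟩`, is the fibre of the Clifford bundle `Cl(M)`. -/
def cliffordForm (x : M) : QuadraticForm ℝ (TangentSpace (𝓡 n) x) :=
  -(LinearMap.BilinMap.toQuadraticMap (innerₗ (TangentSpace (𝓡 n) x)))

set_option synthInstance.maxHeartbeats 200000 in
/-- A connection on the tangent bundle is the Levi-Civita connection if it is torsion-free and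
compatible with the metric. -/
def IsLeviCivita [IsManifold (𝓡 n) ∞ M]
    [IsContMDiffRiemannianBundle (𝓡 n) ∞ (EuclideanSpace ℝ (Fin n))
      (fun x : M ↦ TangentSpace (𝓡 n) x)]
    (nabla : CovariantDerivative (𝓡 n) (EuclideanSpace ℝ (Fin n))
      (fun x : M ↦ TangentSpace (𝓡 n) x)) : Prop :=
  nabla.torsion = 0 ∧ nabla.IsMetricCompatible

/-- `f : M → ℝᴺ` is an isometric embedding: a smooth embedding which pulls back the Euclidean
metric to the metric of `M`. -/
structure IsIsometricEmbedding {N : ℕ} (f : M → EuclideanSpace ℝ (Fin N)) : Prop where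
  isSmoothEmbedding : Manifold.IsSmoothEmbedding (𝓡 n) (𝓡 N) ∞ f
  inner_eq : ∀ (p : M) (v w : TangentSpace (𝓡 n) p),
    inner ℝ (mvfderiv (𝓡 n) f p v) (mvfderiv (𝓡 n) f p w) = inner ℝ v w

variable [IsManifold (𝓡 n) ∞ M]

/-- The second fundamental form of `f : M → ℝᴺ` at `p`: the component normal to `df(T_pM)` of the
derivative, in the direction `v`, of the vector-valued function `q ↦ df_q(W_q)`, where `W` is a
vector field, smooth near `p`, that extends `w`. -/
def secondFundamentalForm {N : ℕ} (f : M → EuclideanSpace ℝ (Fin N)) (p : M)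
    (v w : TangentSpace (𝓡 n) p) : EuclideanSpace ℝ (Fin N) :=
  (LinearMap.range (mvfderiv (𝓡 n) f p).toLinearMap)ᗮ.starProjection
    (mvfderiv (𝓡 n)
      (fun q ↦ mvfderiv (𝓡 n) f q (FiberBundle.extend (EuclideanSpace ℝ (Fin n)) w q)) p v)

/-- The mean curvature vector: the trace of the second fundamental form. -/
def meanCurvatureVector {N : ℕ} (f : M → EuclideanSpace ℝ (Fin N)) (p : M) :
    EuclideanSpace ℝ (Fin N) :=
  ∑ i : Fin (Module.finrank ℝ (TangentSpace (𝓡 n) p)),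
    secondFundamentalForm (n := n) f p (stdOrthonormalBasis ℝ (TangentSpace (𝓡 n) p) i)
    (stdOrthonormalBasis ℝ (TangentSpace (𝓡 n) p) i)

/-- The mean curvature function `H = |𝐇| / n`. -/
def meanCurvature {N : ℕ} (f : M → EuclideanSpace ℝ (Fin N)) (p : M) : ℝ :=
  ‖meanCurvatureVector (n := n) f p‖ / n

end Tangent

section Dirac

variable (𝕜 : Type*) [RCLike 𝕜]
  (n : ℕ) {M : Type*} [TopologicalSpace M] [ChartedSpace (EuclideanSpace ℝ (Fin n)) M]
  [IsManifold (𝓡 n) ∞ M]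
  [RiemannianBundle (fun x : M ↦ TangentSpace (𝓡 n) x)]
  [IsContMDiffRiemannianBundle (𝓡 n) ∞ (EuclideanSpace ℝ (Fin n))
    (fun x : M ↦ TangentSpace (𝓡 n) x)]
  (F : Type*) [NormedAddCommGroup F] [NormedSpace ℝ F] [FiniteDimensional ℝ F]
  (V : M → Type*) [TopologicalSpace (TotalSpace F V)]
  [∀ x, NormedAddCommGroup (V x)] [∀ x, InnerProductSpace ℝ (V x)]
  [∀ x, InnerProductSpace 𝕜 (V x)]
  [FiberBundle F V] [VectorBundle ℝ F V] [ContMDiffVectorBundle ∞ F V (𝓡 n)]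
  [IsContMDiffRiemannianBundle (𝓡 n) ∞ F V]

/-- The structure of a Dirac bundle on a smooth real (`𝕜 = ℝ`) or complex (`𝕜 = ℂ`) vector bundle
`V` with a smooth fibre metric. A complex bundle is a smooth real bundle whose fibres carry a
complex structure that depends smoothly on the point, and a Hermitian metric. The instances
`InnerProductSpace ℝ (V x)` and `InnerProductSpace 𝕜 (V x)` have the norm in common; so, by
polarization, the real inner product is the real part of the `𝕜`-valued one, and the action of `ℝ`
is the restriction of the action of `𝕜`. -/
structure DiracBundle where
  /-- Scalar multiplication by `𝕜` is smooth. -/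
  contMDiff_smul : ∀ (a : 𝕜) (σ : Cₛ^∞⟮𝓡 n; F, V⟯),
    ContMDiff (𝓡 n) ((𝓡 n).prod 𝓘(ℝ, F)) ∞ (fun x ↦ TotalSpace.mk' F x (a • σ x))
  /-- The left module structure over the Clifford bundle. -/
  cliffordModule : ∀ x : M, CliffordAlgebra (cliffordForm (n := n) x) →ₐ[ℝ] Module.End ℝ (V x)
  /-- The module structure is smooth: `X · σ` is smooth if `X` and `σ` are. -/
  contMDiff_clifford : ∀
    (X : Cₛ^∞⟮𝓡 n; EuclideanSpace ℝ (Fin n), (fun x : M ↦ TangentSpace (𝓡 n) x)⟯)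
    (σ : Cₛ^∞⟮𝓡 n; F, V⟯),
    ContMDiff (𝓡 n) ((𝓡 n).prod 𝓘(ℝ, F)) ∞
      (fun x ↦ TotalSpace.mk' F x
        (cliffordModule x (CliffordAlgebra.ι (cliffordForm (n := n) x) (X x)) (σ x)))
  /-- The connection on `V`; `conn σ x v` is `∇_v σ` at `x`. -/
  conn : CovariantDerivative (𝓡 n) F V
  contMDiff_conn : CovariantDerivative.ContMDiffCovariantDerivative conn ∞
  /-- Clifford multiplication is `𝕜`-linear. -/
  clifford_smul : ∀ (x : M) (v : TangentSpace (𝓡 n) x) (a : 𝕜) (s : V x),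
    cliffordModule x (CliffordAlgebra.ι (cliffordForm (n := n) x) v) (a • s) =
      a • cliffordModule x (CliffordAlgebra.ι (cliffordForm (n := n) x) v) s
  /-- The connection is `𝕜`-linear. -/
  conn_smul : ∀ (a : 𝕜) (σ : Cₛ^∞⟮𝓡 n; F, V⟯) (x : M) (v : TangentSpace (𝓡 n) x),
    conn (fun y ↦ a • σ y) x v = a • conn (fun y ↦ σ y) x v
  /-- The connection is a metric connection. -/
  conn_metric : conn.IsMetricCompatible
  /-- Clifford multiplication by tangent vectors is skew-adjoint. -/
  clifford_skew : ∀ (x : M) (v : TangentSpace (𝓡 n) x) (s t : V x),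
    inner 𝕜 (cliffordModule x (CliffordAlgebra.ι (cliffordForm (n := n) x) v) s) t +
      inner 𝕜 s (cliffordModule x (CliffordAlgebra.ι (cliffordForm (n := n) x) v) t) = 0
  /-- The connection is a derivation of the module structure: `∇(X · σ) = (∇X) · σ + X · ∇σ`,
  where `∇X` is the Levi-Civita derivative. As `TM` generates `Cl(M)`, and the connection of
  `Cl(M)` is the extension of the Levi-Civita connection as a derivation of the product, the same
  rule follows for all sections of `Cl(M)`. -/
  conn_clifford : ∃ nabla : CovariantDerivative (𝓡 n) (EuclideanSpace ℝ (Fin n))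
      (fun x : M ↦ TangentSpace (𝓡 n) x), IsLeviCivita nabla ∧
    ∀ (X : Cₛ^∞⟮𝓡 n; EuclideanSpace ℝ (Fin n), (fun x : M ↦ TangentSpace (𝓡 n) x)⟯)
      (σ : Cₛ^∞⟮𝓡 n; F, V⟯) (x : M) (v : TangentSpace (𝓡 n) x),
      conn (fun y ↦ cliffordModule y (CliffordAlgebra.ι (cliffordForm (n := n) y) (X y)) (σ y)) x v =
        cliffordModule x (CliffordAlgebra.ι (cliffordForm (n := n) x) (nabla (fun y ↦ X y) x v)) (σ x) +
        cliffordModule x (CliffordAlgebra.ι (cliffordForm (n := n) x) (X x)) (conn (fun y ↦ σ y) x v)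

variable {𝕜 n F V}

namespace DiracBundle

variable (S : DiracBundle 𝕜 n F V)

/-- Clifford multiplication `v · s` of `s ∈ V_x` by the tangent vector `v ∈ T_xM`. -/
def cmul (x : M) (v : TangentSpace (𝓡 n) x) (s : V x) : V x :=
  S.cliffordModule x (CliffordAlgebra.ι (cliffordForm (n := n) x) v) s

/-- The Dirac operator `Dσ = ∑ᵢ eᵢ · ∇_{eᵢ} σ`, with `(eᵢ)` an orthonormal basis of `T_xM`. -/
def dirac (σ : Π x : M, V x) (x : M) : V x :=
  ∑ i : Fin (Module.finrank ℝ (TangentSpace (𝓡 n) x)), S.cmul x (stdOrthonormalBasis ℝ (TangentSpace (𝓡 n) x) i)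
    (S.conn σ x (stdOrthonormalBasis ℝ (TangentSpace (𝓡 n) x) i))

/-- The curvature `R(X, Y)σ = ∇_X ∇_Y σ - ∇_Y ∇_X σ - ∇_{[X, Y]} σ`. -/
def curvature (X Y : Π x : M, TangentSpace (𝓡 n) x) (σ : Π x : M, V x) (x : M) : V x :=
  S.conn (fun y ↦ S.conn σ y (Y y)) x (X x) - S.conn (fun y ↦ S.conn σ y (X y)) x (Y x) -
    S.conn σ x (VectorField.mlieBracket (𝓡 n) X Y x)

/-- The curvature morphism `𝔑σ = ∑_{i<j} eᵢ · eⱼ · R(eᵢ, eⱼ)σ` of the Bochner identity, with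
`(eᵢ)` an orthonormal basis of `T_xM`, extended to vector fields that are smooth near `x`. -/
def bochnerCurvature (σ : Π x : M, V x) (x : M) : V x :=
  ∑ i : Fin (Module.finrank ℝ (TangentSpace (𝓡 n) x)), ∑ j ∈ Finset.Ioi i,
    S.cmul x (stdOrthonormalBasis ℝ (TangentSpace (𝓡 n) x) i)
      (S.cmul x (stdOrthonormalBasis ℝ (TangentSpace (𝓡 n) x) j)
        (S.curvature
          (FiberBundle.extend (EuclideanSpace ℝ (Fin n))
            (stdOrthonormalBasis ℝ (TangentSpace (𝓡 n) x) i))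
          (FiberBundle.extend (EuclideanSpace ℝ (Fin n))
            (stdOrthonormalBasis ℝ (TangentSpace (𝓡 n) x) j)) σ x))

end DiracBundle

variable [MeasurableSpace M]

variable (𝕜 n) in
/-- The `L²` inner product `∫_M ⟨σ, τ⟩` of sections. -/
def l2Inner (σ τ : Π x : M, V x) : 𝕜 :=
  ∫ x, inner 𝕜 (σ x) (τ x) ∂(riemannianVolume n M)

variable (𝕜 n) in
/-- The real pairing `(σ, τ) = Re ∫_M ⟨σ, τ⟩`. -/
def pairing (σ τ : Π x : M, V x) : ℝ :=
  RCLike.re (l2Inner 𝕜 n σ τ)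

/-- A spectral resolution of `D²`: an orthonormal basis `(φ_j)` of `L²(V)` of smooth sections with
`D² φ_j = lam_j φ_j`, numbered so that the eigenvalues increase. As `L²(V)` is the completion of
the space of smooth sections, an orthonormal family is a basis of it if and only if its linear
span is dense in the space of smooth sections for the `L²` norm. Indices start at `0`. -/
structure IsSpectralResolution (S : DiracBundle 𝕜 n F V) (lam : ℕ → ℝ)
    (φ : ℕ → Cₛ^∞⟮𝓡 n; F, V⟯) : Prop where
  monotone : Monotone lam
  eigen : ∀ (j : ℕ) (x : M), S.dirac (S.dirac (φ j)) x = lam j • φ j x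
  orthonormal : ∀ i j : ℕ, l2Inner 𝕜 n (φ i) (φ j) = if i = j then 1 else 0
  complete : ∀ (σ : Cₛ^∞⟮𝓡 n; F, V⟯) (ε : ℝ), 0 < ε → ∃ (s : Finset ℕ) (a : ℕ → 𝕜),
    ∫ x, ‖σ x - ∑ j ∈ s, a j • φ j x‖ ^ 2 ∂(riemannianVolume n M) < ε

end Dirac

end DiracYang

end

/-!
The proof applies Yang's commutator argument to the coordinate functions `fₐ` of the immersion. For
symmetric operators `A`, `B` and a complete orthonormal system of eigenvectors `φᵢ` of `A`, with
eigenvalues `λᵢ ≤ Λ` for `i < k` and `Λ ≤ λᵢ` for `k ≤ i`, one has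
`∑_{i<k} (Λ - λᵢ)² ⟨[A, B]φᵢ, Bφᵢ⟩ ≤ ∑_{i<k} (Λ - λᵢ) ‖[A, B]φᵢ‖²`. Take `A = D²` and `B = fₐ`, so
that `[D², fₐ]σ = -2∇_{grad fₐ}σ - (Δfₐ)σ`, and sum over `a`. Since `f` is isometric, the gradients
form a Parseval frame of each tangent space. Hence the left side becomes `n ∑ (Λ - λᵢ)²`, because
`∑ₐ |grad fₐ|² = n`. On the right the mean curvature vector `(Δfₐ)ₐ` is normal to `M`, so that the
cross terms cancel and `∑ₐ ‖[D², fₐ]σ‖² = 4|∇σ|² + n²H²|σ|²`; the Bochner identity then trades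
`|∇σ|²` for `D²` and the curvature term.
-/

noncomputable section

namespace DiracYang

section Yang

/-- The terms with both indices in `s` cancel by antisymmetry; those with `j ∉ s` have a sign. -/
theorem sum_sq_mul_le_of_hasSum {ι : Type*} {lam : ι → ℝ} {Λ : ℝ} {s : Finset ι}
    (hs : ∀ i ∈ s, lam i ≤ Λ) (hs' : ∀ j ∉ s, Λ ≤ lam j) {w : ι → ι → ℝ}
    (hw : ∀ i j, 0 ≤ w i j) (hsymm : ∀ i j, w i j = w j i) {a b : ι → ℝ}
    (ha : ∀ i, HasSum (fun j ↦ (lam j - lam i) * w i j) (a i))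
    (hb : ∀ i, HasSum (fun j ↦ (lam j - lam i) ^ 2 * w i j) (b i)) :
    ∑ i ∈ s, (Λ - lam i) ^ 2 * a i ≤ ∑ i ∈ s, (Λ - lam i) * b i := by
  let t (i j : ι) : ℝ := (Λ - lam i) * (lam j - lam i) * (Λ - lam j) * w i j
  have hasSum_t : HasSum (fun j ↦ ∑ i ∈ s, t i j)
      (∑ i ∈ s, ((Λ - lam i) ^ 2 * a i - (Λ - lam i) * b i)) := by
    refine hasSum_sum fun i _ ↦ (((ha i).mul_left _).sub ((hb i).mul_left _)).congr_fun fun j ↦ ?_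
    ring
  have sum_eq_zero : ∑ j ∈ s, ∑ i ∈ s, t i j = 0 := by
    have antisymm (i j : ι) : t i j = -t j i := by
      simp only [t, hsymm i j]
      ring
    have := calc
      ∑ j ∈ s, ∑ i ∈ s, t i j = ∑ i ∈ s, ∑ j ∈ s, -t j i := by
        rw [Finset.sum_comm]
        exact Finset.sum_congr rfl fun i _ ↦ Finset.sum_congr rfl fun j _ ↦ antisymm i j
      _ = -∑ j ∈ s, ∑ i ∈ s, t i j := by simp only [Finset.sum_neg_distrib]
    linarith
  have nonpos (j : ι) (hj : j ∉ s) : ∑ i ∈ s, t i j ≤ 0 := by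
    refine Finset.sum_nonpos fun i hi ↦ mul_nonpos_of_nonpos_of_nonneg ?_ (hw i j)
    exact mul_nonpos_of_nonneg_of_nonpos
      (mul_nonneg (sub_nonneg.2 (hs i hi)) (sub_nonneg.2 ((hs i hi).trans (hs' j hj))))
      (sub_nonpos.2 (hs' j hj))
  have := sum_le_hasSum s (fun j hj ↦ neg_nonneg.2 (nonpos j hj)) hasSum_t.neg
  simp only [Finset.sum_neg_distrib, sum_eq_zero, Finset.sum_sub_distrib] at this
  linarith

variable {𝕜 : Type*} [RCLike 𝕜] {ι E : Type*} [SeminormedAddCommGroup E] [InnerProductSpace 𝕜 E]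
  {φ : ι → E}

open UniformSpace in
theorem hasSum_inner_mul_inner_of_dense (hφ : Orthonormal 𝕜 φ)
    (hd : Dense (Submodule.span 𝕜 (Set.range φ) : Set E)) (x y : E) :
    HasSum (fun j ↦ inner 𝕜 x (φ j) * inner 𝕜 (φ j) y) (inner 𝕜 x y) := by
  let e : E →ₗᵢ[𝕜] Completion E := Completion.toComplₗᵢ
  have dense_span : Dense (Submodule.span 𝕜 (Set.range (e ∘ φ)) : Set (Completion E)) := by
    rw [Set.range_comp, ← LinearIsometry.coe_toLinearMap, ← Submodule.map_span,
      Submodule.map_coe]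
    exact (Completion.denseRange_coe (α := E)).dense_image e.continuous hd
  have := (HilbertBasis.mk (hφ.comp_linearIsometry e)
    (Submodule.dense_iff_topologicalClosure_eq_top.1 dense_span).ge).hasSum_inner_mul_inner
      (e x) (e y)
  simpa only [HilbertBasis.coe_mk, Function.comp_apply, LinearIsometry.inner_map_map] using this

/-- The abstract form of **Yang's inequality**. -/
theorem sum_sq_mul_re_inner_lie_le {A G : E →ₗ[𝕜] E} (hA : A.IsSymmetric) (hG : G.IsSymmetric)
    (hφ : Orthonormal 𝕜 φ) (hd : Dense (Submodule.span 𝕜 (Set.range φ) : Set E)) {lam : ι → ℝ}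
    (hlam : ∀ i, A (φ i) = (lam i : 𝕜) • φ i) {Λ : ℝ} {s : Finset ι}
    (hs : ∀ i ∈ s, lam i ≤ Λ) (hs' : ∀ j ∉ s, Λ ≤ lam j) :
    ∑ i ∈ s, (Λ - lam i) ^ 2 * RCLike.re (inner 𝕜 (⁅A, G⁆ (φ i)) (G (φ i))) ≤
      ∑ i ∈ s, (Λ - lam i) * ‖⁅A, G⁆ (φ i)‖ ^ 2 := by
  have inner_lie (i j : ι) : inner 𝕜 (⁅A, G⁆ (φ i)) (φ j) =
      ((lam j - lam i : ℝ) : 𝕜) * inner 𝕜 (G (φ i)) (φ j) := by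
    rw [Ring.lie_def, LinearMap.sub_apply, Module.End.mul_apply, Module.End.mul_apply,
      inner_sub_left, hA, hlam, hlam, map_smul, inner_smul_left, inner_smul_right,
      RCLike.conj_ofReal, RCLike.ofReal_sub, sub_mul]
  refine sum_sq_mul_le_of_hasSum hs hs' (w := fun i j ↦ ‖(inner 𝕜 (G (φ i)) (φ j) : 𝕜)‖ ^ 2)
    (fun i j ↦ by positivity) (fun i j ↦ by rw [hG, norm_inner_symm]) (fun i ↦ ?_) (fun i ↦ ?_)
  · refine (RCLike.hasSum_re 𝕜 (hasSum_inner_mul_inner_of_dense hφ hd (⁅A, G⁆ (φ i))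
      (G (φ i)))).congr_fun fun j ↦ ?_
    rw [inner_lie, mul_assoc, ← inner_conj_symm (φ j), RCLike.mul_conj, RCLike.re_ofReal_mul]
    norm_cast
  · rw [← inner_self_eq_norm_sq (𝕜 := 𝕜)]
    refine (RCLike.hasSum_re 𝕜 (hasSum_inner_mul_inner_of_dense hφ hd (⁅A, G⁆ (φ i))
      (⁅A, G⁆ (φ i)))).congr_fun fun j ↦ ?_
    rw [← inner_conj_symm (φ j), RCLike.mul_conj, inner_lie, norm_mul, ← RCLike.ofReal_pow,
      RCLike.ofReal_re, RCLike.norm_ofReal, mul_pow, sq_abs]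

end Yang

section Determinant

variable {ι : Type*} [Fintype ι] [DecidableEq ι]

theorem hasFDerivWithinAt_det {E : Type*} [NormedAddCommGroup E] [NormedSpace ℝ E]
    {A : E → Matrix ι ι ℝ} {A' : ι → ι → E →L[ℝ] ℝ} {s : Set E} {x : E}
    (h : ∀ i j, HasFDerivWithinAt (fun y ↦ A y i j) (A' i j) s x) :
    HasFDerivWithinAt (fun y ↦ (A y).det) (∑ i, ∑ j, (A x).adjugate i j • A' j i) s x := by
  have leibniz : HasFDerivWithinAt (fun y ↦ (A y).det)
      (∑ σ : Equiv.Perm ι, (Equiv.Perm.sign σ : ℤ) •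
        ∑ i, (∏ j ∈ Finset.univ.erase i, A x (σ j) j) • A' (σ i) i) s x := by
    simp only [Matrix.det_apply]
    exact HasFDerivWithinAt.fun_sum fun σ _ ↦
      (HasFDerivWithinAt.finsetProd fun i _ ↦ h (σ i) i).const_smul (Equiv.Perm.sign σ : ℤ)
  convert leibniz using 1
  ext v
  have cramer (i : ι) : ∑ j, (A x).adjugate i j * A' j i v =
      ((A x).updateCol i fun j ↦ A' j i v).det := by
    rw [← Matrix.cramer_apply, Matrix.cramer_eq_adjugate_mulVec]
    rfl
  simp only [sum_apply, smul_apply, smul_eq_mul, cramer, Matrix.det_apply, Finset.smul_sum]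
  rw [Finset.sum_comm]
  refine Finset.sum_congr rfl fun σ _ ↦ Finset.sum_congr rfl fun i _ ↦ ?_
  rw [← Finset.mul_prod_erase _ _ (Finset.mem_univ i), Matrix.updateCol_self, mul_comm,
    Finset.prod_congr rfl fun j hj ↦ Matrix.updateCol_ne (Finset.ne_of_mem_erase hj)]
  rfl

variable {E : Type*} [NormedAddCommGroup E] [NormedSpace ℝ E] {H : Type*} [TopologicalSpace H]
  {I : ModelWithCorners ℝ E H} {M : Type*} [TopologicalSpace M] [ChartedSpace H M] {k : WithTop ℕ∞}
  {A : M → Matrix ι ι ℝ} {x : M}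

theorem mvfderiv_det (h : ∀ i j, MDifferentiableAt I 𝓘(ℝ) (fun y ↦ A y i j) x)
    (v : TangentSpace I x) :
    mvfderiv I (fun y ↦ (A y).det) x v =
      ∑ i, ∑ j, (A x).adjugate i j * mvfderiv I (fun y ↦ A y j i) x v := by
  have continuousAt_det : ContinuousAt (fun y ↦ (A y).det) x :=
    (Continuous.matrix_det continuous_id).continuousAt.comp
      (continuousAt_pi.2 fun i ↦ continuousAt_pi.2 fun j ↦ (h i j).continuousAt)
  let D : TangentSpace I x →L[ℝ] ℝ :=
    ∑ i, ∑ j, (A x).adjugate i j • mvfderiv I (fun y ↦ A y j i) x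
  have hasMFDerivAt_det : HasMFDerivAt I 𝓘(ℝ) (fun y ↦ (A y).det) x D :=
    ⟨continuousAt_det, by
      simpa using! hasFDerivWithinAt_det (A := fun z ↦ A ((extChartAt I x).symm z))
        fun i j ↦ (h i j).hasMFDerivAt.2⟩
  have mvfderiv_eq : mvfderiv I (fun y ↦ (A y).det) x = D := hasMFDerivAt_det.mfderiv
  rw [mvfderiv_eq]
  simp only [D, sum_apply, smul_apply, smul_eq_mul]

theorem contMDiffAt_det (h : ∀ i j, ContMDiffAt I 𝓘(ℝ) k (fun y ↦ A y i j) x) :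
    ContMDiffAt I 𝓘(ℝ) k (fun y ↦ (A y).det) x := by
  simp only [Matrix.det_apply']
  exact ContMDiffAt.sum fun σ _ ↦ contMDiffAt_const.mul
    (contMDiffAt_finsetProd fun i _ ↦ h (σ i) i)

theorem contMDiffAt_inv_apply (h : ∀ i j, ContMDiffAt I 𝓘(ℝ) k (fun y ↦ A y i j) x)
    (hA : (A x).det ≠ 0) (i j : ι) :
    ContMDiffAt I 𝓘(ℝ) k (fun y ↦ (A y)⁻¹ i j) x := by
  simp only [Matrix.inv_def, Ring.inverse_eq_inv', Matrix.smul_apply, smul_eq_mul,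
    Matrix.adjugate_apply]
  refine ((contMDiffAt_det h).inv₀ hA).mul (contMDiffAt_det fun a b ↦ ?_)
  by_cases hab : a = j
  · subst hab
    simpa only [Matrix.updateRow_self] using contMDiffAt_const
  · simpa only [Matrix.updateRow_ne hab] using h a b

end Determinant

section GramMatrix

variable {ι V : Type*} [Fintype ι] [DecidableEq ι] [NormedAddCommGroup V] [InnerProductSpace ℝ V]
  (b : Module.Basis ι ℝ V)

theorem repr_eq_sum_inv_gram_mul_inner (z : V) (i : ι) :
    b.repr z i = ∑ j, (Matrix.gram ℝ b)⁻¹ i j * inner ℝ (b j) z := by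
  have inner_eq : (fun j ↦ inner ℝ (b j) z) = (Matrix.gram ℝ b).mulVec (b.repr z) := by
    ext j
    conv_lhs => rw [← b.sum_repr z, inner_sum]
    simp only [real_inner_smul_right, Matrix.mulVec, dotProduct, Matrix.gram_apply, mul_comm]
  calc
    b.repr z i = ((Matrix.gram ℝ b)⁻¹.mulVec ((Matrix.gram ℝ b).mulVec (b.repr z))) i := by
      rw [Matrix.mulVec_mulVec, Matrix.nonsing_inv_mul _
        (Matrix.posDef_gram_of_linearIndependent b.linearIndependent).det_pos.ne'.isUnit,
        Matrix.one_mulVec]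
    _ = ∑ j, (Matrix.gram ℝ b)⁻¹ i j * inner ℝ (b j) z := by rw [← inner_eq]; rfl

theorem trace_eq_sum_inv_gram_mul_inner (L : V →ₗ[ℝ] V) :
    LinearMap.trace ℝ V L = ∑ i, ∑ j, (Matrix.gram ℝ b)⁻¹ i j * inner ℝ (b j) (L (b i)) := by
  simp only [LinearMap.trace_eq_matrix_trace ℝ b, Matrix.trace, Matrix.diag_apply,
    LinearMap.toMatrix_apply, repr_eq_sum_inv_gram_mul_inner]

theorem det_gram_eq_sq_det_mul_det_gram (v : ι → V) :
    (Matrix.gram ℝ v).det = b.det v ^ 2 * (Matrix.gram ℝ b).det := by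
  have gram_eq : Matrix.gram ℝ v =
      (b.toMatrix v).transpose * Matrix.gram ℝ b * b.toMatrix v := by
    ext i j
    rw [Matrix.gram_apply]
    conv_lhs => rw [← b.sum_toMatrix_smul_self v i, ← b.sum_toMatrix_smul_self v j]
    simp only [sum_inner, inner_sum, real_inner_smul_left, real_inner_smul_right,
      Matrix.mul_apply, Matrix.transpose_apply, Matrix.gram_apply, Finset.sum_mul]
    exact Finset.sum_congr rfl fun _ _ ↦ Finset.sum_congr rfl fun _ _ ↦ by ring
  rw [gram_eq, Matrix.det_mul, Matrix.det_mul, Matrix.det_transpose, Module.Basis.det_apply]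
  ring

end GramMatrix

section CoordinateFrame

variable {n : ℕ} {M : Type*} [TopologicalSpace M] [ChartedSpace (EuclideanSpace ℝ (Fin n)) M]

local notation "𝔼" => EuclideanSpace ℝ (Fin n)

/-- The coordinate vector field `∂ᵢ` of the preferred chart at `p`, as a vector field on `M`; only
its values on the domain of that chart are meaningful. -/
def coordFrame (p : M) (i : Fin n) : Π x : M, TangentSpace (𝓡 n) x :=
  VectorField.mpullback (𝓡 n) (𝓡 n) (chartAt 𝔼 p)
    fun y ↦ (NormedSpace.fromTangentSpace (𝕜 := ℝ) y).symm (EuclideanSpace.single i 1)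

variable [IsManifold (𝓡 n) ∞ M] {p q x : M}

theorem isInvertible_mfderiv_chartAt (hx : x ∈ (chartAt 𝔼 p).source) :
    (mfderiv (𝓡 n) (𝓡 n) (chartAt 𝔼 p) x).IsInvertible :=
  ⟨(mdifferentiable_chart (I := 𝓡 n) p).mfderiv hx, rfl⟩

theorem coordFrame_chart_symm {y : 𝔼} (hy : y ∈ (chartAt 𝔼 p).target) (i : Fin n) :
    coordFrame p i ((chartAt 𝔼 p).symm y) = coordVec p y i := by
  have hc := mdifferentiable_chart (I := 𝓡 n) p
  have hinv := ContinuousLinearMap.inverse_eq (hc.comp_symm_deriv hy) (by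
    have := hc.symm_comp_deriv ((chartAt 𝔼 p).map_target hy)
    rwa [(chartAt 𝔼 p).right_inv hy] at this)
  exact congrArg (fun L ↦ L (EuclideanSpace.single i (1 : ℝ))) hinv

theorem contMDiffAt_coordFrame (hx : x ∈ (chartAt 𝔼 p).source) (i : Fin n) :
    ContMDiffAt (𝓡 n) ((𝓡 n).prod 𝓘(ℝ, 𝔼)) ∞ (T% (coordFrame p i)) x :=
  ContMDiffAt.mpullback_vectorField_preimage
    (contMDiffAt_vectorSpace_iff_contDiffAt.2 contDiffAt_const)
    (contMDiffAt_of_mem_maximalAtlas (IsManifold.chart_mem_maximalAtlas p) hx)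
    (isInvertible_mfderiv_chartAt hx) (le_refl ∞)

theorem mlieBracket_coordFrame (hx : x ∈ (chartAt 𝔼 p).source) (i j : Fin n) :
    VectorField.mlieBracket (𝓡 n) (coordFrame p i) (coordFrame p j) x = 0 := by
  have mdifferentiableAt_const (v : 𝔼) (y : 𝔼) : MDifferentiableAt (𝓡 n) ((𝓡 n).prod 𝓘(ℝ, 𝔼))
      (T% (fun y : 𝔼 ↦ (NormedSpace.fromTangentSpace (𝕜 := ℝ) y).symm v)) y :=
    (contMDiffAt_vectorSpace_iff_contDiffAt (n := 1).2 contDiffAt_const).mdifferentiableAt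
      one_ne_zero
  have two_le : minSmoothness ℝ 2 ≤ ∞ := by
    rw [minSmoothness_of_isRCLikeNormedField]
    simpa using ENat.LEInfty.out
  have : IsManifold (𝓡 n) (minSmoothness ℝ 2) M := .of_le (n := ∞) two_le
  have bracket_const (v w y : 𝔼) : VectorField.mlieBracket (𝓡 n)
      (fun y : 𝔼 ↦ (NormedSpace.fromTangentSpace (𝕜 := ℝ) y).symm v)
      (fun y : 𝔼 ↦ (NormedSpace.fromTangentSpace (𝕜 := ℝ) y).symm w) y = 0 := by
    rw [← VectorField.mlieBracketWithin_univ, VectorField.mlieBracketWithin_eq_lieBracketWithin]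
    change VectorField.lieBracketWithin ℝ (fun _ : 𝔼 ↦ v) (fun _ ↦ w) Set.univ y = 0
    simp [VectorField.lieBracketWithin]
  unfold coordFrame
  rw [← VectorField.mpullback_mlieBracket (n := ∞) (mdifferentiableAt_const _ _)
    (mdifferentiableAt_const _ _)
    (contMDiffAt_of_mem_maximalAtlas (IsManifold.chart_mem_maximalAtlas p) hx) two_le,
    VectorField.mpullback_apply, bracket_const, map_zero]

/-- The basis of `T_xM` given by the coordinate vector fields of the preferred chart at `p`. -/
def coordBasis (hx : x ∈ (chartAt 𝔼 p).source) :
    Module.Basis (Fin n) ℝ (TangentSpace (𝓡 n) x) :=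
  (EuclideanSpace.basisFun (Fin n) ℝ).toBasis.map
    ((NormedSpace.fromTangentSpace (𝕜 := ℝ) (chartAt 𝔼 p x)).symm.trans
      ((mdifferentiable_chart (I := 𝓡 n) p).mfderiv hx).symm).toLinearEquiv

theorem coe_coordBasis (hx : x ∈ (chartAt 𝔼 p).source) :
    ⇑(coordBasis hx) = fun i ↦ coordFrame p i x := by
  ext1 i
  rw [coordBasis, Module.Basis.map_apply, OrthonormalBasis.coe_toBasis,
    EuclideanSpace.basisFun_apply]
  exact congrArg (fun L ↦ L (EuclideanSpace.single i (1 : ℝ)))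
    (ContinuousLinearMap.inverse_equiv ((mdifferentiable_chart (I := 𝓡 n) p).mfderiv hx)).symm

theorem coordBasis_repr (hx : x ∈ (chartAt 𝔼 p).source) (v : TangentSpace (𝓡 n) x) (k : Fin n) :
    (coordBasis hx).repr v k = mvfderiv (𝓡 n) (chartAt 𝔼 p) x v k := by
  rw [coordBasis, Module.Basis.map_repr, LinearEquiv.trans_apply]
  exact (EuclideanSpace.basisFun (Fin n) ℝ).coe_toBasis_repr_apply _ _

/-- The coordinate change from the preferred chart at `p` to the preferred chart at `q`. -/
def coordChange (p q : M) : 𝔼 → 𝔼 := chartAt 𝔼 q ∘ (chartAt 𝔼 p).symm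

theorem differentiableAt_coordChange {y : 𝔼} (hy : y ∈ (chartAt 𝔼 p).target)
    (hq : (chartAt 𝔼 p).symm y ∈ (chartAt 𝔼 q).source) :
    DifferentiableAt ℝ (coordChange p q) y := by
  rw [← mdifferentiableAt_iff_differentiableAt]
  exact MDifferentiableAt.comp (I' := 𝓡 n) y
    ((mdifferentiable_chart (I := 𝓡 n) q).mdifferentiableAt hq)
    ((mdifferentiable_chart (I := 𝓡 n) p).mdifferentiableAt_symm hy)

theorem fderiv_comp_chart_symm {W : Type*} [NormedAddCommGroup W] [NormedSpace ℝ W] {u : M → W}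
    {y : 𝔼} (hy : y ∈ (chartAt 𝔼 p).target)
    (hu : MDifferentiableAt (𝓡 n) 𝓘(ℝ, W) u ((chartAt 𝔼 p).symm y)) (i : Fin n) :
    fderiv ℝ (u ∘ (chartAt 𝔼 p).symm) y (EuclideanSpace.single i 1) =
      mvfderiv (𝓡 n) u ((chartAt 𝔼 p).symm y) (coordFrame p i ((chartAt 𝔼 p).symm y)) := by
  have chain := mfderiv_comp (I := 𝓡 n) (I' := 𝓡 n) (I'' := 𝓘(ℝ, W)) y hu
    ((mdifferentiable_chart (I := 𝓡 n) p).mdifferentiableAt_symm hy)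
  rw [mfderiv_eq_fderiv] at chain
  rw [coordFrame_chart_symm hy]
  exact congrArg (fun L ↦ L (EuclideanSpace.single i (1 : ℝ))) chain

theorem det_fderiv_coordChange {y : 𝔼} (hy : y ∈ (chartAt 𝔼 p).target)
    (hq : (chartAt 𝔼 p).symm y ∈ (chartAt 𝔼 q).source) :
    (fderiv ℝ (coordChange p q) y).det =
      (coordBasis hq).det fun i ↦ coordFrame p i ((chartAt 𝔼 p).symm y) := by
  let b := (EuclideanSpace.basisFun (Fin n) ℝ).toBasis
  rw [Module.Basis.det_apply, ContinuousLinearMap.det, ← LinearMap.det_toMatrix b]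
  congr 1
  ext k i
  rw [Module.Basis.toMatrix_apply, coordBasis_repr, LinearMap.toMatrix_apply,
    ← fderiv_comp_chart_symm hy ((mdifferentiable_chart (I := 𝓡 n) q).mdifferentiableAt hq)]
  simp [b, coordChange]

end CoordinateFrame

section MetricInCoordinates

variable {n : ℕ} {M : Type*} [TopologicalSpace M] [ChartedSpace (EuclideanSpace ℝ (Fin n)) M]
  [RiemannianBundle (fun x : M ↦ TangentSpace (𝓡 n) x)]

local notation "𝔼" => EuclideanSpace ℝ (Fin n)

/-- The matrix of the metric in the preferred chart at `p`, as a function on `M`. -/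
def frameGram (p x : M) : Matrix (Fin n) (Fin n) ℝ :=
  Matrix.gram ℝ fun i ↦ coordFrame p i x

/-- The density `√(det g_{ij})` of the Riemannian volume in the preferred chart at `p`, as a
function on `M`. -/
def volumeDensity (p x : M) : ℝ := √(frameGram (n := n) p x).det

variable {p q x : M}

theorem inv_frameGram_symm (i j : Fin n) :
    (frameGram (n := n) p x)⁻¹ i j = (frameGram p x)⁻¹ j i :=
  ((Matrix.isHermitian_gram ℝ fun i ↦ coordFrame p i x).inv.apply i j).symm

variable [IsManifold (𝓡 n) ∞ M]

theorem frameGram_eq_gram_coordBasis (hx : x ∈ (chartAt 𝔼 p).source) :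
    frameGram p x = Matrix.gram ℝ (coordBasis hx) := by
  rw [coe_coordBasis, frameGram]

theorem det_frameGram_pos (hx : x ∈ (chartAt 𝔼 p).source) : 0 < (frameGram (n := n) p x).det := by
  rw [frameGram_eq_gram_coordBasis hx]
  exact (Matrix.posDef_gram_of_linearIndependent (coordBasis hx).linearIndependent).det_pos

theorem adjugate_frameGram_apply (hx : x ∈ (chartAt 𝔼 p).source) (i j : Fin n) :
    (frameGram (n := n) p x).adjugate i j =
      (frameGram (n := n) p x).det * (frameGram p x)⁻¹ i j := by
  rw [Matrix.inv_def, Matrix.smul_apply, Ring.inverse_eq_inv', smul_eq_mul,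
    mul_inv_cancel_left₀ (det_frameGram_pos hx).ne']

theorem volumeDensity_pos (hx : x ∈ (chartAt 𝔼 p).source) : 0 < volumeDensity (n := n) p x :=
  Real.sqrt_pos.2 (det_frameGram_pos hx)

theorem sqrt_det_gram {y : 𝔼} (hy : y ∈ (chartAt 𝔼 p).target) :
    √(gram p y).det = volumeDensity (n := n) p ((chartAt 𝔼 p).symm y) := by
  rw [volumeDensity, frameGram]
  simp only [coordFrame_chart_symm hy]
  rfl

theorem volumeDensity_eq (p : M) (hq : x ∈ (chartAt 𝔼 q).source) :
    volumeDensity (n := n) p x = |(coordBasis hq).det fun i ↦ coordFrame p i x| *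
      volumeDensity (n := n) q x := by
  rw [volumeDensity, frameGram, det_gram_eq_sq_det_mul_det_gram (coordBasis hq),
    ← frameGram_eq_gram_coordBasis, Real.sqrt_mul (sq_nonneg _), Real.sqrt_sq_eq_abs,
    volumeDensity]

variable [IsContMDiffRiemannianBundle (𝓡 n) ∞ (EuclideanSpace ℝ (Fin n))
  (fun x : M ↦ TangentSpace (𝓡 n) x)]

theorem contMDiffAt_frameGram (hx : x ∈ (chartAt 𝔼 p).source) (i j : Fin n) :
    ContMDiffAt (𝓡 n) 𝓘(ℝ) ∞ (fun y ↦ frameGram (n := n) p y i j) x :=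
  (contMDiffAt_coordFrame hx i).inner_bundle (contMDiffAt_coordFrame hx j)

theorem contMDiffAt_volumeDensity (hx : x ∈ (chartAt 𝔼 p).source) :
    ContMDiffAt (𝓡 n) 𝓘(ℝ) ∞ (volumeDensity (n := n) p) x :=
  ((Real.contDiffAt_sqrt (det_frameGram_pos hx).ne').contMDiffAt).comp x
    (contMDiffAt_det (contMDiffAt_frameGram hx))

theorem continuousOn_sqrt_det_gram (p : M) :
    ContinuousOn (fun y : 𝔼 ↦ √(gram p y).det) (chartAt 𝔼 p).target := by
  have hcont : ContinuousOn (volumeDensity (n := n) p) (chartAt 𝔼 p).source := fun x hx ↦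
    (contMDiffAt_volumeDensity hx).continuousAt.continuousWithinAt
  exact (hcont.comp (chartAt 𝔼 p).continuousOn_symm (chartAt 𝔼 p).mapsTo_symm).congr
    fun y hy ↦ sqrt_det_gram hy

end MetricInCoordinates

section Volume

variable {n : ℕ} {M : Type*} [TopologicalSpace M] [ChartedSpace (EuclideanSpace ℝ (Fin n)) M]
  [MeasurableSpace M] [BorelSpace M]

local notation "𝔼" => EuclideanSpace ℝ (Fin n)

theorem measurableSet_target_inter_preimage (p : M) {A : Set M} (hA : MeasurableSet A) :
    MeasurableSet ((chartAt 𝔼 p).target ∩ (chartAt 𝔼 p).symm ⁻¹' A) := by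
  have image_measurable := MeasurableSet.subtype_image (chartAt 𝔼 p).open_target.measurableSet
    ((chartAt 𝔼 p).continuousOn_symm.domRestrict.measurable hA)
  convert image_measurable using 1
  ext y
  simp only [Set.mem_inter_iff, Set.mem_preimage, Set.mem_image, Subtype.exists, exists_and_right,
    exists_eq_right, Set.domRestrict_apply, exists_prop]

theorem aemeasurable_chart_symm (p : M) (g : 𝔼 → ENNReal) :
    AEMeasurable (chartAt 𝔼 p).symm
      ((volume.restrict (chartAt 𝔼 p).target).withDensity g) :=
  ((chartAt 𝔼 p).continuousOn_symm.aemeasurable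
    (chartAt 𝔼 p).open_target.measurableSet).mono_ac (withDensity_absolutelyContinuous _ _)

variable [RiemannianBundle (fun x : M ↦ TangentSpace (𝓡 n) x)] {p q : M}

theorem chartVolume_apply (p : M) {A : Set M} (hA : MeasurableSet A) :
    chartVolume (n := n) p A = ∫⁻ y in (chartAt 𝔼 p).target ∩ (chartAt 𝔼 p).symm ⁻¹' A,
      ENNReal.ofReal √(gram p y).det := by
  rw [chartVolume, Measure.map_apply_of_aemeasurable (aemeasurable_chart_symm p _) hA,
    withDensity_apply', Measure.restrict_restrict' (chartAt 𝔼 p).open_target.measurableSet,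
    Set.inter_comm]

theorem chartVolume_compl_source (p : M) :
    chartVolume (n := n) p (chartAt 𝔼 p).sourceᶜ = 0 := by
  have preimage_eq_empty :
      (chartAt 𝔼 p).target ∩ (chartAt 𝔼 p).symm ⁻¹' (chartAt 𝔼 p).sourceᶜ = ∅ :=
    Set.eq_empty_of_forall_notMem fun _ hy ↦ hy.2 ((chartAt 𝔼 p).map_target hy.1)
  rw [chartVolume_apply p (chartAt 𝔼 p).open_source.measurableSet.compl, preimage_eq_empty,
    setLIntegral_empty]

theorem chartVolume_inter_source (p : M) (A : Set M) :
    chartVolume (n := n) p (A ∩ (chartAt 𝔼 p).source) = chartVolume (n := n) p A :=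
  measure_inter_conull (chartVolume_compl_source p)

variable [IsManifold (𝓡 n) ∞ M]

theorem chartVolume_eq_of_subset {A : Set M} (hA : MeasurableSet A)
    (hp : A ⊆ (chartAt 𝔼 p).source) (hq : A ⊆ (chartAt 𝔼 q).source) :
    chartVolume (n := n) q A = chartVolume (n := n) p A := by
  have preimage_eq_image : (chartAt 𝔼 q).target ∩ (chartAt 𝔼 q).symm ⁻¹' A =
      coordChange p q '' ((chartAt 𝔼 p).target ∩ (chartAt 𝔼 p).symm ⁻¹' A) := by
    rw [← (chartAt 𝔼 p).image_eq_target_inter_inv_preimage hp,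
      ← (chartAt 𝔼 q).image_eq_target_inter_inv_preimage hq, coordChange, Set.image_comp,
      (chartAt 𝔼 p).leftInvOn.image_image' hp]
  rw [chartVolume_apply p hA, chartVolume_apply q hA, preimage_eq_image,
    lintegral_image_eq_lintegral_abs_det_fderiv_mul volume
      (measurableSet_target_inter_preimage p hA)
      (fun y hy ↦ (differentiableAt_coordChange hy.1 (hq hy.2)).hasFDerivAt.hasFDerivWithinAt)]
  · refine setLIntegral_congr_fun (measurableSet_target_inter_preimage p hA) fun y hy ↦ ?_
    have hyq : coordChange p q y ∈ (chartAt 𝔼 q).target := (chartAt 𝔼 q).map_source (hq hy.2)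
    have symm_coordChange : (chartAt 𝔼 q).symm (coordChange p q y) = (chartAt 𝔼 p).symm y :=
      (chartAt 𝔼 q).left_inv (hq hy.2)
    rw [← ENNReal.ofReal_mul (abs_nonneg _), sqrt_det_gram hyq, sqrt_det_gram hy.1,
      symm_coordChange, det_fderiv_coordChange hy.1 (hq hy.2),
      ← volumeDensity_eq]
  · intro y hy z hz hyz
    exact (chartAt 𝔼 p).symm.injOn hy.1 hz.1 ((chartAt 𝔼 q).injOn (hq hy.2) (hq hz.2) hyz)

theorem riemannianVolume_restrict_source (p : M) :
    (riemannianVolume n M).restrict (chartAt 𝔼 p).source = chartVolume (n := n) p := by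
  have hs := (chartAt 𝔼 p).open_source.measurableSet
  have chart_le (q : M) {A : Set M} (hA : MeasurableSet A) :
      chartVolume (n := n) q (A ∩ (chartAt 𝔼 p).source) ≤ chartVolume (n := n) p A := by
    rw [← chartVolume_inter_source q, chartVolume_eq_of_subset
      ((hA.inter hs).inter (chartAt 𝔼 q).open_source.measurableSet)
      (Set.inter_subset_left.trans Set.inter_subset_right) Set.inter_subset_right]
    exact measure_mono (Set.inter_subset_left.trans Set.inter_subset_left)
  have volume_le : riemannianVolume n M ≤
      chartVolume (n := n) p + (⊤ : Measure M).restrict (chartAt 𝔼 p).sourceᶜ := by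
    refine iSup_le fun q ↦ Measure.le_iff.2 fun A hA ↦ ?_
    rw [Measure.add_apply, Measure.restrict_apply hA, ← measure_inter_add_sdiff A hs]
    exact add_le_add (chart_le q hA) (Measure.le_iff'.1 le_top _)
  ext A hA
  rw [Measure.restrict_apply hA]
  refine le_antisymm ((Measure.le_iff'.1 volume_le _).trans ?_) ?_
  · rw [Measure.add_apply, Measure.restrict_apply (hA.inter hs), Set.inter_assoc,
      Set.inter_compl_self, Set.inter_empty, measure_empty, add_zero]
    exact measure_mono Set.inter_subset_left
  · rw [← chartVolume_inter_source p]
    exact Measure.le_iff'.1 (le_iSup (fun p : M ↦ chartVolume (n := n) p) p) _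

variable [IsContMDiffRiemannianBundle (𝓡 n) ∞ (EuclideanSpace ℝ (Fin n))
  (fun x : M ↦ TangentSpace (𝓡 n) x)]

instance isLocallyFiniteMeasure_riemannianVolume :
    IsLocallyFiniteMeasure (riemannianVolume n M) := by
  refine ⟨fun x ↦ ?_⟩
  obtain ⟨K, hK, hKt, hKc⟩ :=
    local_compact_nhds ((chartAt 𝔼 x).open_target.mem_nhds (mem_chart_target 𝔼 x))
  let U := (chartAt 𝔼 x).source ∩ chartAt 𝔼 x ⁻¹' (interior K)
  have isOpen_U : IsOpen U := (chartAt 𝔼 x).isOpen_inter_preimage isOpen_interior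
  have U_mem : U ∈ nhds x :=
    isOpen_U.mem_nhds ⟨mem_chart_source _ x, mem_interior_iff_mem_nhds.2 hK⟩
  obtain ⟨C, hC⟩ := hKc.exists_bound_of_continuousOn ((continuousOn_sqrt_det_gram x).mono hKt)
  have preimage_subset : (chartAt 𝔼 x).target ∩ (chartAt 𝔼 x).symm ⁻¹' U ⊆ K := by
    rintro y ⟨hy, -, hyK⟩
    rw [Set.mem_preimage, (chartAt 𝔼 x).right_inv hy] at hyK
    exact interior_subset hyK
  refine ⟨U, U_mem, ?_⟩
  calc
    riemannianVolume n M U = chartVolume (n := n) x U := by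
      rw [← riemannianVolume_restrict_source x, Measure.restrict_apply isOpen_U.measurableSet,
        Set.inter_eq_left.2 Set.inter_subset_left]
    _ ≤ ∫⁻ y in K, ENNReal.ofReal √(gram x y).det := by
      rw [chartVolume_apply x isOpen_U.measurableSet]
      exact lintegral_mono_set preimage_subset
    _ ≤ ∫⁻ _ in K, ENNReal.ofReal C :=
      setLIntegral_mono' hKc.measurableSet fun y hy ↦
        ENNReal.ofReal_le_ofReal ((le_abs_self _).trans (hC y hy))
    _ < ⊤ := by
      rw [setLIntegral_const]
      exact ENNReal.mul_lt_top ENNReal.ofReal_lt_top hKc.measure_lt_top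

theorem integral_riemannianVolume_eq {g : M → ℝ}
    (hg : AEStronglyMeasurable g (chartVolume (n := n) p))
    (hsupp : ∀ x ∉ (chartAt 𝔼 p).source, g x = 0) :
    ∫ x, g x ∂(riemannianVolume n M) =
      ∫ y in (chartAt 𝔼 p).target,
        volumeDensity (n := n) p ((chartAt 𝔼 p).symm y) * g ((chartAt 𝔼 p).symm y) := by
  rw [← setIntegral_eq_integral_of_forall_compl_eq_zero hsupp,
    riemannianVolume_restrict_source, chartVolume, integral_map (aemeasurable_chart_symm p _) hg,
    integral_withDensity_eq_integral_toReal_smul₀]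
  · refine setIntegral_congr_fun (chartAt 𝔼 p).open_target.measurableSet fun y hy ↦ ?_
    rw [ENNReal.toReal_ofReal (Real.sqrt_nonneg _), smul_eq_mul, sqrt_det_gram hy]
  · exact ((continuousOn_sqrt_det_gram p).aemeasurable
      (chartAt 𝔼 p).open_target.measurableSet).ennreal_ofReal
  · exact Filter.Eventually.of_forall fun y ↦ ENNReal.ofReal_lt_top

end Volume

section CovariantDerivative

variable {E : Type*} [NormedAddCommGroup E] [NormedSpace ℝ E] {H : Type*} [TopologicalSpace H]
  {I : ModelWithCorners ℝ E H} {M : Type*} [TopologicalSpace M] [ChartedSpace H M]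
  {F : Type*} [NormedAddCommGroup F] [NormedSpace ℝ F] {V : M → Type*}
  [TopologicalSpace (TotalSpace F V)] [∀ x, AddCommGroup (V x)] [∀ x, Module ℝ (V x)]
  [∀ x, TopologicalSpace (V x)] [∀ x, IsTopologicalAddGroup (V x)]
  [∀ x, ContinuousSMul ℝ (V x)] [FiberBundle F V] [VectorBundle ℝ F V]

theorem conn_sum (cov : CovariantDerivative I F V) {ι : Type*} (s : Finset ι)
    {σ : ι → Π x : M, V x} {x : M}
    (hσ : ∀ i ∈ s, MDifferentiableAt I (I.prod 𝓘(ℝ, F)) (T% (σ i)) x) :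
    cov (∑ i ∈ s, σ i) x = ∑ i ∈ s, cov (σ i) x := by
  induction s using Finset.cons_induction with
  | empty => simp only [Finset.sum_empty, cov.zero, Pi.zero_apply]
  | cons a s ha ih =>
    have hs (i) (hi : i ∈ s) := hσ i (Finset.mem_cons_of_mem hi)
    have hsum : MDifferentiableAt I (I.prod 𝓘(ℝ, F)) (T% (∑ i ∈ s, σ i)) x := by
      simpa only [Finset.sum_apply] using! MDifferentiableAt.sum_section hs
    rw [Finset.sum_cons, Finset.sum_cons,
      cov.isCovariantDerivativeOnUniv.add (hσ a (Finset.mem_cons_self a s)) hsum, ih hs]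

end CovariantDerivative

theorem mvfderiv_congr {E H M W : Type*} [NormedAddCommGroup E] [NormedSpace ℝ E]
    [TopologicalSpace H] {I : ModelWithCorners ℝ E H} [TopologicalSpace M] [ChartedSpace H M]
    [NormedAddCommGroup W] [NormedSpace ℝ W] {f g : M → W} {x : M} (h : f =ᶠ[nhds x] g) :
    mvfderiv I f x = mvfderiv I g x :=
  h.mfderiv_eq

section Divergence

variable {n : ℕ} {M : Type*} [TopologicalSpace M] [ChartedSpace (EuclideanSpace ℝ (Fin n)) M]
  [IsManifold (𝓡 n) ∞ M]
  {nabla : CovariantDerivative (𝓡 n) (EuclideanSpace ℝ (Fin n))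
    (fun x : M ↦ TangentSpace (𝓡 n) x)}
  {X Y : Π x : M, TangentSpace (𝓡 n) x} {u : M → ℝ} {p x : M}

local notation "𝔼" => EuclideanSpace ℝ (Fin n)

/-- The divergence `tr(v ↦ ∇_v X)` of a vector field. -/
def divergence (nabla : CovariantDerivative (𝓡 n) (EuclideanSpace ℝ (Fin n))
    (fun x : M ↦ TangentSpace (𝓡 n) x)) (X : Π x : M, TangentSpace (𝓡 n) x) (x : M) : ℝ :=
  LinearMap.trace ℝ (TangentSpace (𝓡 n) x) (nabla X x).toLinearMap

theorem divergence_congr (hX : MDifferentiableAt (𝓡 n) ((𝓡 n).prod 𝓘(ℝ, 𝔼)) (T% X) x)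
    (hY : MDifferentiableAt (𝓡 n) ((𝓡 n).prod 𝓘(ℝ, 𝔼)) (T% Y) x) (h : ∀ᶠ y in nhds x, X y = Y y) :
    divergence nabla X x = divergence nabla Y x := by
  rw [divergence, divergence,
    nabla.isCovariantDerivativeOnUniv.congr_of_eventuallyEq hX hY Filter.univ_mem h]

theorem divergence_smul (hu : MDifferentiableAt (𝓡 n) 𝓘(ℝ) u x)
    (hX : MDifferentiableAt (𝓡 n) ((𝓡 n).prod 𝓘(ℝ, 𝔼)) (T% X) x) :
    divergence nabla (u • X) x = u x * divergence nabla X x + mvfderiv (𝓡 n) u x (X x) := by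
  rw [divergence, divergence, nabla.isCovariantDerivativeOnUniv.leibniz hX hu]
  refine (map_add (LinearMap.trace ℝ (TangentSpace (𝓡 n) x)) (u x • (nabla X x).toLinearMap)
    ((mvfderiv (𝓡 n) u x).toLinearMap.smulRight (X x))).trans ?_
  rw [map_smul, LinearMap.trace_smulRight, smul_eq_mul]
  rfl

theorem divergence_sum {ι : Type*} (s : Finset ι) {X : ι → Π x : M, TangentSpace (𝓡 n) x}
    (hX : ∀ i ∈ s, MDifferentiableAt (𝓡 n) ((𝓡 n).prod 𝓘(ℝ, 𝔼)) (T% (X i)) x) :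
    divergence nabla (∑ i ∈ s, X i) x = ∑ i ∈ s, divergence nabla (X i) x := by
  rw [divergence, conn_sum nabla s hX]
  exact (congrArg _ (ContinuousLinearMap.toLinearMap_sum _ _)).trans (map_sum _ _ _)

theorem divergence_of_notMem_tsupport (hu : MDifferentiableAt (𝓡 n) 𝓘(ℝ) u x)
    (hX : MDifferentiableAt (𝓡 n) ((𝓡 n).prod 𝓘(ℝ, 𝔼)) (T% X) x) (hx : x ∉ tsupport u) :
    divergence nabla (u • X) x = 0 := by
  have u_eventuallyEq : u =ᶠ[nhds x] fun _ ↦ 0 := notMem_tsupport_iff_eventuallyEq.1 hx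
  rw [divergence_smul hu hX,
    mvfderiv_congr u_eventuallyEq, u_eventuallyEq.eq_of_nhds, mvfderiv_const]
  simp

variable [RiemannianBundle (fun x : M ↦ TangentSpace (𝓡 n) x)]
  [IsContMDiffRiemannianBundle (𝓡 n) ∞ (EuclideanSpace ℝ (Fin n))
    (fun x : M ↦ TangentSpace (𝓡 n) x)]

theorem IsLeviCivita.conn_coordFrame_comm (hLC : IsLeviCivita nabla)
    (hx : x ∈ (chartAt 𝔼 p).source) (i j : Fin n) :
    nabla (coordFrame p i) x (coordFrame p j x) = nabla (coordFrame p j) x (coordFrame p i x) := by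
  have smooth (i) := (contMDiffAt_coordFrame hx i).mdifferentiableAt (by simp)
  rw [← sub_eq_zero, (nabla.torsion_eq_zero_iff.1 hLC.1) (smooth j) (smooth i),
    mlieBracket_coordFrame hx]

set_option synthInstance.maxHeartbeats 200000 in
theorem IsLeviCivita.mvfderiv_inner (hLC : IsLeviCivita nabla)
    (hX : MDifferentiableAt (𝓡 n) ((𝓡 n).prod 𝓘(ℝ, 𝔼)) (T% X) x)
    (hY : MDifferentiableAt (𝓡 n) ((𝓡 n).prod 𝓘(ℝ, 𝔼)) (T% Y) x) (v : TangentSpace (𝓡 n) x) :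
    mvfderiv (𝓡 n) (fun y ↦ inner ℝ (X y) (Y y)) x v =
      inner ℝ (nabla X x v) (Y x) + inner ℝ (X x) (nabla Y x v) := by
  simpa only [FiberBundle.extend_apply_self] using!
    hLC.2.mvfderiv_inner_eq (FiberBundle.extend 𝔼 v) hX hY

theorem IsLeviCivita.mvfderiv_frameGram (hLC : IsLeviCivita nabla)
    (hx : x ∈ (chartAt 𝔼 p).source) (i j k : Fin n) :
    mvfderiv (𝓡 n) (fun y ↦ frameGram (n := n) p y i j) x (coordFrame p k x) =
      inner ℝ (coordFrame p j x) (nabla (coordFrame p k) x (coordFrame p i x)) +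
        inner ℝ (coordFrame p i x) (nabla (coordFrame p k) x (coordFrame p j x)) := by
  have smooth (i) := (contMDiffAt_coordFrame hx i).mdifferentiableAt (by simp)
  rw [real_inner_comm, hLC.conn_coordFrame_comm hx k i, hLC.conn_coordFrame_comm hx k j]
  exact hLC.mvfderiv_inner (smooth i) (smooth j) _

theorem IsLeviCivita.mvfderiv_det_frameGram (hLC : IsLeviCivita nabla)
    (hx : x ∈ (chartAt 𝔼 p).source) (k : Fin n) :
    mvfderiv (𝓡 n) (fun y ↦ (frameGram (n := n) p y).det) x (coordFrame p k x) =
      2 * (frameGram (n := n) p x).det * divergence nabla (coordFrame p k) x := by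
  have trace_eq : divergence nabla (coordFrame p k) x = ∑ i, ∑ j, (frameGram (n := n) p x)⁻¹ i j *
      inner ℝ (coordFrame p j x) (nabla (coordFrame p k) x (coordFrame p i x)) := by
    rw [divergence, trace_eq_sum_inv_gram_mul_inner (coordBasis hx),
      ← frameGram_eq_gram_coordBasis, coe_coordBasis]
    rfl
  have trace_eq' : divergence nabla (coordFrame p k) x =
      ∑ i, ∑ j, (frameGram (n := n) p x)⁻¹ i j *
        inner ℝ (coordFrame p i x) (nabla (coordFrame p k) x (coordFrame p j x)) := by
    rw [trace_eq, Finset.sum_comm]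
    exact Finset.sum_congr rfl fun i _ ↦ Finset.sum_congr rfl fun j _ ↦ by
      rw [inv_frameGram_symm]
  rw [mvfderiv_det fun i j ↦ (contMDiffAt_frameGram hx i j).mdifferentiableAt (by simp), mul_assoc,
    two_mul, ← mul_add]
  nth_rw 1 [trace_eq', trace_eq]
  simp only [hLC.mvfderiv_frameGram hx, adjugate_frameGram_apply hx, mul_assoc, ← Finset.mul_sum,
    mul_add, Finset.sum_add_distrib]

theorem IsLeviCivita.mvfderiv_volumeDensity (hLC : IsLeviCivita nabla)
    (hx : x ∈ (chartAt 𝔼 p).source) (k : Fin n) :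
    mvfderiv (𝓡 n) (volumeDensity (n := n) p) x (coordFrame p k x) =
      volumeDensity (n := n) p x * divergence nabla (coordFrame p k) x := by
  have smooth_density := (contMDiffAt_volumeDensity hx).mdifferentiableAt (by simp)
  have sq_eventuallyEq : (fun y ↦ (frameGram (n := n) p y).det) =ᶠ[nhds x]
      fun y ↦ volumeDensity (n := n) p y * volumeDensity (n := n) p y := by
    filter_upwards [(chartAt 𝔼 p).open_source.mem_nhds hx] with y hy
    exact (Real.mul_self_sqrt (det_frameGram_pos hy).le).symm
  have deriv_sq := hLC.mvfderiv_det_frameGram hx k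
  rw [mvfderiv_congr sq_eventuallyEq, mvfderiv_fun_mul smooth_density smooth_density,
    sq_eventuallyEq.eq_of_nhds] at deriv_sq
  refine mul_left_cancel₀ (mul_ne_zero two_ne_zero (volumeDensity_pos hx).ne') ?_
  simp only [add_apply, smul_apply, smul_eq_mul] at deriv_sq
  linear_combination deriv_sq

end Divergence

section TangentMap

variable {n : ℕ} {M : Type*} [TopologicalSpace M] [ChartedSpace (EuclideanSpace ℝ (Fin n)) M]
  [IsManifold (𝓡 n) ∞ M] {W : Type*} [NormedAddCommGroup W] [NormedSpace ℝ W]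

theorem contMDiffOn_mvfderiv_apply {u : M → W} {s : Set M} (hs : IsOpen s)
    (hu : ContMDiffOn (𝓡 n) 𝓘(ℝ, W) ∞ u s) {X : Π x : M, TangentSpace (𝓡 n) x}
    (hX : ContMDiffOn (𝓡 n) ((𝓡 n).prod 𝓘(ℝ, EuclideanSpace ℝ (Fin n))) ∞ (T% X) s) :
    ContMDiffOn (𝓡 n) 𝓘(ℝ, W) ∞ (fun y ↦ mvfderiv (𝓡 n) u y (X y)) s := by
  have tangentMap := (hu.contMDiffOn_tangentMapWithin le_rfl hs.uniqueMDiffOn).comp hX fun _ h ↦ h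
  refine ((contMDiff_snd_tangentBundle_modelSpace W 𝓘(ℝ, W)).comp_contMDiffOn tangentMap).congr
    fun y hy ↦ ?_
  have deriv_eq : mfderivWithin (𝓡 n) 𝓘(ℝ, W) u s y = mfderiv (𝓡 n) 𝓘(ℝ, W) u y :=
    mfderivWithin_of_isOpen hs hy
  exact (congrArg (fun L ↦ L (X y)) deriv_eq).symm

theorem contMDiffAt_mvfderiv_apply {u : M → W} (hu : ContMDiff (𝓡 n) 𝓘(ℝ, W) ∞ u)
    {X : Π x : M, TangentSpace (𝓡 n) x} {x : M}
    (hX : ContMDiffAt (𝓡 n) ((𝓡 n).prod 𝓘(ℝ, EuclideanSpace ℝ (Fin n))) ∞ (T% X) x) :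
    ContMDiffAt (𝓡 n) 𝓘(ℝ, W) ∞ (fun y ↦ mvfderiv (𝓡 n) u y (X y)) x :=
  (contMDiff_snd_tangentBundle_modelSpace W 𝓘(ℝ, W)).contMDiffAt.comp x <|
    (hu.contMDiff_tangentMap le_rfl).contMDiffAt.comp x hX

end TangentMap

section SupportInChart

variable {n : ℕ} {M : Type*} [TopologicalSpace M] [ChartedSpace (EuclideanSpace ℝ (Fin n)) M]
  {w : M → ℝ} {p : M}

local notation "𝔼" => EuclideanSpace ℝ (Fin n)

theorem integral_fderiv_eq_zero {η : 𝔼 → ℝ} (hη : ContDiff ℝ 1 η) (hc : HasCompactSupport η)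
    (v : 𝔼) : ∫ y, fderiv ℝ η y v = 0 := by
  have hcont : Continuous (fun y ↦ fderiv ℝ η y v) :=
    (hη.continuous_fderiv one_ne_zero).clm_apply continuous_const
  have h := integral_mul_fderiv_eq_neg_fderiv_mul_of_integrable (μ := (volume : Measure 𝔼))
    (f := fun _ ↦ (1 : ℝ)) (g := η) (v := v) (by simp)
    (by simpa using hcont.integrable_of_hasCompactSupport (hc.fderiv_apply ℝ v))
    (by simpa using hη.continuous.integrable_of_hasCompactSupport hc)
    (fun _ _ ↦ differentiableAt_const _)
    (fun y _ ↦ (hη.differentiable one_ne_zero) y)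
  simpa using h

/-- The function `w` in the coordinates of the preferred chart at `p`, extended by zero. -/
def extendByZero (p : M) (w : M → ℝ) : 𝔼 → ℝ :=
  (chartAt 𝔼 p).target.indicator (w ∘ (chartAt 𝔼 p).symm)

theorem tsupport_extendByZero_subset (hw : HasCompactSupport w)
    (hp : tsupport w ⊆ (chartAt 𝔼 p).source) :
    tsupport (extendByZero p w) ⊆ chartAt 𝔼 p '' tsupport w := by
  refine closure_minimal (fun y hy ↦ ?_)
    (hw.isCompact.image_of_continuousOn ((chartAt 𝔼 p).continuousOn.mono hp)).isClosed
  rw [Function.mem_support, extendByZero, Set.indicator_apply_ne_zero] at hy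
  exact ⟨_, subset_tsupport w hy.2, (chartAt 𝔼 p).right_inv hy.1⟩

theorem hasCompactSupport_extendByZero (hw : HasCompactSupport w)
    (hp : tsupport w ⊆ (chartAt 𝔼 p).source) : HasCompactSupport (extendByZero (n := n) p w) :=
  (hw.isCompact.image_of_continuousOn ((chartAt 𝔼 p).continuousOn.mono hp)).of_isClosed_subset
    (isClosed_tsupport _) (tsupport_extendByZero_subset hw hp)

theorem extendByZero_eventuallyEq_zero (hw : HasCompactSupport w)
    (hp : tsupport w ⊆ (chartAt 𝔼 p).source) {y : 𝔼} (hy : y ∉ (chartAt 𝔼 p).target) :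
    extendByZero p w =ᶠ[nhds y] fun _ ↦ 0 := by
  refine notMem_tsupport_iff_eventuallyEq.1 fun h ↦ hy ?_
  obtain ⟨x, hx, rfl⟩ := tsupport_extendByZero_subset hw hp h
  exact (chartAt 𝔼 p).map_source (hp hx)

theorem extendByZero_eventuallyEq {y : 𝔼} (hy : y ∈ (chartAt 𝔼 p).target) :
    extendByZero p w =ᶠ[nhds y] w ∘ (chartAt 𝔼 p).symm :=
  Set.eqOn_indicator.eventuallyEq_of_mem ((chartAt 𝔼 p).open_target.mem_nhds hy)

variable [IsManifold (𝓡 n) ∞ M]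

theorem contDiff_extendByZero (hw : HasCompactSupport w)
    (hp : tsupport w ⊆ (chartAt 𝔼 p).source)
    (hsmooth : ContMDiffOn (𝓡 n) 𝓘(ℝ) ∞ w (chartAt 𝔼 p).source) :
    ContDiff ℝ ∞ (extendByZero (n := n) p w) := by
  have smooth_comp : ContDiffOn ℝ ∞ (w ∘ (chartAt 𝔼 p).symm) (chartAt 𝔼 p).target :=
    (hsmooth.comp (contMDiffOn_chart_symm (I := 𝓡 n)) (chartAt 𝔼 p).mapsTo_symm).contDiffOn
  rw [contDiff_iff_contDiffAt]
  intro y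
  by_cases hy : y ∈ (chartAt 𝔼 p).target
  · exact (smooth_comp.contDiffAt ((chartAt 𝔼 p).open_target.mem_nhds hy)).congr_of_eventuallyEq
      (extendByZero_eventuallyEq hy)
  · exact contDiffAt_const.congr_of_eventuallyEq (extendByZero_eventuallyEq_zero hw hp hy)

theorem fderiv_extendByZero (hw : HasCompactSupport w)
    (hp : tsupport w ⊆ (chartAt 𝔼 p).source)
    (hsmooth : ContMDiffOn (𝓡 n) 𝓘(ℝ) ∞ w (chartAt 𝔼 p).source) (k : Fin n) :
    (fun y ↦ fderiv ℝ (extendByZero p w) y (EuclideanSpace.single k 1)) =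
      (chartAt 𝔼 p).target.indicator fun y ↦
        mvfderiv (𝓡 n) w ((chartAt 𝔼 p).symm y) (coordFrame p k ((chartAt 𝔼 p).symm y)) := by
  ext1 y
  by_cases hy : y ∈ (chartAt 𝔼 p).target
  · have mem_source := (chartAt 𝔼 p).map_target hy
    rw [Set.indicator_of_mem hy, (extendByZero_eventuallyEq hy).fderiv_eq]
    exact fderiv_comp_chart_symm hy ((hsmooth.contMDiffAt
      ((chartAt 𝔼 p).open_source.mem_nhds mem_source)).mdifferentiableAt (by simp)) k
  · rw [Set.indicator_of_notMem hy, (extendByZero_eventuallyEq_zero hw hp hy).fderiv_eq,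
      fderiv_fun_const]
    rfl

theorem integrableOn_mvfderiv_coordFrame (hw : HasCompactSupport w)
    (hp : tsupport w ⊆ (chartAt 𝔼 p).source)
    (hsmooth : ContMDiffOn (𝓡 n) 𝓘(ℝ) ∞ w (chartAt 𝔼 p).source) (k : Fin n) :
    IntegrableOn (fun y ↦ mvfderiv (𝓡 n) w ((chartAt 𝔼 p).symm y)
      (coordFrame p k ((chartAt 𝔼 p).symm y))) (chartAt 𝔼 p).target := by
  rw [← integrable_indicator_iff (chartAt 𝔼 p).open_target.measurableSet,
    ← fderiv_extendByZero hw hp hsmooth k]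
  exact (((contDiff_extendByZero hw hp hsmooth).continuous_fderiv (by simp)).clm_apply
    continuous_const).integrable_of_hasCompactSupport
      ((hasCompactSupport_extendByZero hw hp).fderiv_apply ℝ _)

theorem setIntegral_mvfderiv_coordFrame (hw : HasCompactSupport w)
    (hp : tsupport w ⊆ (chartAt 𝔼 p).source)
    (hsmooth : ContMDiffOn (𝓡 n) 𝓘(ℝ) ∞ w (chartAt 𝔼 p).source) (k : Fin n) :
    ∫ y in (chartAt 𝔼 p).target, mvfderiv (𝓡 n) w ((chartAt 𝔼 p).symm y)
      (coordFrame p k ((chartAt 𝔼 p).symm y)) = 0 := by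
  rw [← integral_indicator (chartAt 𝔼 p).open_target.measurableSet,
    ← fderiv_extendByZero hw hp hsmooth k]
  exact integral_fderiv_eq_zero ((contDiff_extendByZero hw hp hsmooth).of_le (by simp))
    (hasCompactSupport_extendByZero hw hp) _

end SupportInChart

section DivergenceTheorem

variable {n : ℕ} {M : Type*} [TopologicalSpace M] [ChartedSpace (EuclideanSpace ℝ (Fin n)) M]
  [RiemannianBundle (fun x : M ↦ TangentSpace (𝓡 n) x)]

local notation "𝔼" => EuclideanSpace ℝ (Fin n)

/-- The `k`-th component of a vector field in the preferred chart at `p`, obtained by raising the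
index of `j ↦ ⟨∂ⱼ, X⟩`. -/
def coordComponent (p : M) (X : Π x : M, TangentSpace (𝓡 n) x) (k : Fin n) (x : M) : ℝ :=
  ∑ j, (frameGram (n := n) p x)⁻¹ k j * inner ℝ (coordFrame p j x) (X x)

variable {X : Π x : M, TangentSpace (𝓡 n) x} {u : M → ℝ} {p x : M} [IsManifold (𝓡 n) ∞ M]

theorem sum_coordComponent_smul_coordFrame (X : Π x : M, TangentSpace (𝓡 n) x)
    (hx : x ∈ (chartAt 𝔼 p).source) :
    ∑ k, coordComponent p X k x • coordFrame p k x = X x := by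
  have repr_eq (k) : (coordBasis hx).repr (X x) k = coordComponent p X k x := by
    rw [repr_eq_sum_inv_gram_mul_inner, ← frameGram_eq_gram_coordBasis, coe_coordBasis]
    rfl
  simpa only [repr_eq, coe_coordBasis] using (coordBasis hx).sum_repr (X x)

variable [IsContMDiffRiemannianBundle (𝓡 n) ∞ (EuclideanSpace ℝ (Fin n))
  (fun x : M ↦ TangentSpace (𝓡 n) x)]

theorem contMDiffAt_coordComponent (hx : x ∈ (chartAt 𝔼 p).source)
    (hX : ContMDiffAt (𝓡 n) ((𝓡 n).prod 𝓘(ℝ, 𝔼)) ∞ (T% X) x) (k : Fin n) :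
    ContMDiffAt (𝓡 n) 𝓘(ℝ) ∞ (coordComponent p X k) x :=
  ContMDiffAt.sum fun j _ ↦
    (contMDiffAt_inv_apply (contMDiffAt_frameGram hx) (det_frameGram_pos hx).ne' k j).mul
      ((contMDiffAt_coordFrame hx j).inner_bundle hX)

variable {nabla : CovariantDerivative (𝓡 n) (EuclideanSpace ℝ (Fin n))
  (fun x : M ↦ TangentSpace (𝓡 n) x)}

/-- The **Voss–Weyl formula**. The Christoffel symbols enter only through their trace, which is the
logarithmic derivative of the volume density. -/
theorem IsLeviCivita.volumeDensity_mul_divergence (hLC : IsLeviCivita nabla)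
    (hx : x ∈ (chartAt 𝔼 p).source)
    (hX : ContMDiffAt (𝓡 n) ((𝓡 n).prod 𝓘(ℝ, 𝔼)) ∞ (T% X) x) :
    volumeDensity (n := n) p x * divergence nabla X x =
      ∑ k, mvfderiv (𝓡 n) (fun y ↦ volumeDensity (n := n) p y * coordComponent p X k y) x
        (coordFrame p k x) := by
  have smooth_density := (contMDiffAt_volumeDensity hx).mdifferentiableAt (by simp)
  have smooth_frame (k) := (contMDiffAt_coordFrame hx k).mdifferentiableAt (by simp)
  have smooth_component (k) := (contMDiffAt_coordComponent hx hX k).mdifferentiableAt (by simp)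
  have smooth_smul (k) : MDifferentiableAt (𝓡 n) ((𝓡 n).prod 𝓘(ℝ, 𝔼))
      (T% (coordComponent p X k • coordFrame p k)) x :=
    (smooth_component k).smul_section (smooth_frame k)
  have eventuallyEq : ∀ᶠ y in nhds x,
      X y = (∑ k, coordComponent p X k • coordFrame p k : Π x : M, TangentSpace (𝓡 n) x) y := by
    filter_upwards [(chartAt 𝔼 p).open_source.mem_nhds hx] with y hy
    rw [Finset.sum_apply]
    exact (sum_coordComponent_smul_coordFrame X hy).symm
  have smooth_sum : MDifferentiableAt (𝓡 n) ((𝓡 n).prod 𝓘(ℝ, 𝔼))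
      (T% (∑ k, coordComponent p X k • coordFrame p k)) x := by
    simpa only [Finset.sum_apply] using! MDifferentiableAt.sum_section fun k _ ↦ smooth_smul k
  rw [divergence_congr (hX.mdifferentiableAt (by simp)) smooth_sum eventuallyEq,
    divergence_sum _ fun k _ ↦ smooth_smul k, Finset.mul_sum]
  refine Finset.sum_congr rfl fun k _ ↦ ?_
  rw [divergence_smul (smooth_component k) (smooth_frame k),
    mvfderiv_fun_mul smooth_density (smooth_component k), mul_add, mul_left_comm,
    ← hLC.mvfderiv_volumeDensity hx k]
  exact add_comm _ _

theorem IsLeviCivita.contMDiff_divergence (hLC : IsLeviCivita nabla)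
    (hX : ContMDiff (𝓡 n) ((𝓡 n).prod 𝓘(ℝ, 𝔼)) ∞ (T% X)) :
    ContMDiff (𝓡 n) 𝓘(ℝ) ∞ (divergence nabla X) := by
  intro p
  have source_mem := (chartAt 𝔼 p).open_source.mem_nhds (mem_chart_source 𝔼 p)
  have smooth_sum : ContMDiffAt (𝓡 n) 𝓘(ℝ) ∞ (fun x ↦ ∑ k, mvfderiv (𝓡 n)
      (fun y ↦ volumeDensity (n := n) p y * coordComponent p X k y) x (coordFrame p k x)) p := by
    refine ContMDiffAt.sum fun k _ ↦
      (contMDiffOn_mvfderiv_apply (chartAt 𝔼 p).open_source ?_ ?_).contMDiffAt source_mem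
    · exact fun x hx ↦ ((contMDiffAt_volumeDensity hx).mul
        (contMDiffAt_coordComponent hx (hX x) k)).contMDiffWithinAt
    · exact fun x hx ↦ (contMDiffAt_coordFrame hx k).contMDiffWithinAt
  refine ((contMDiffAt_volumeDensity (mem_chart_source 𝔼 p)).inv₀
    (volumeDensity_pos (mem_chart_source 𝔼 p)).ne').mul smooth_sum |>.congr_of_eventuallyEq ?_
  filter_upwards [source_mem] with x hx
  rw [Pi.mul_apply, ← hLC.volumeDensity_mul_divergence hx (hX x),
    inv_mul_cancel_left₀ (volumeDensity_pos hx).ne']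

variable [MeasurableSpace M] [BorelSpace M]

theorem IsLeviCivita.integral_divergence_of_tsupport_subset (hLC : IsLeviCivita nabla)
    (hu : ContMDiff (𝓡 n) 𝓘(ℝ) ∞ u) (hsupp : HasCompactSupport u)
    (hp : tsupport u ⊆ (chartAt 𝔼 p).source)
    (hX : ContMDiff (𝓡 n) ((𝓡 n).prod 𝓘(ℝ, 𝔼)) ∞ (T% X)) :
    ∫ x, divergence nabla (u • X) x ∂(riemannianVolume n M) = 0 := by
  have smooth : ContMDiff (𝓡 n) ((𝓡 n).prod 𝓘(ℝ, 𝔼)) ∞ (T% (u • X)) := hu.smul_section hX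
  let w (k : Fin n) (y : M) := volumeDensity (n := n) p y * coordComponent p (u • X) k y
  have tsupport_w (k) : tsupport (w k) ⊆ tsupport u := by
    refine closure_mono fun y ↦ mt fun (hy : u y = 0) ↦ ?_
    simp [w, coordComponent, hy]
  have compact_w (k) : HasCompactSupport (w k) :=
    hsupp.of_isClosed_subset (isClosed_tsupport _) (tsupport_w k)
  have smooth_w (k) : ContMDiffOn (𝓡 n) 𝓘(ℝ) ∞ (w k) (chartAt 𝔼 p).source := fun x hx ↦
    ((contMDiffAt_volumeDensity hx).mul
      (contMDiffAt_coordComponent hx (smooth x) k)).contMDiffWithinAt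
  rw [integral_riemannianVolume_eq (p := p)
    (hLC.contMDiff_divergence smooth).continuous.measurable.aestronglyMeasurable
    fun x hx ↦ divergence_of_notMem_tsupport (hu.mdifferentiable (by simp) x)
      (hX.mdifferentiable (by simp) x) fun h ↦ hx (hp h),
    setIntegral_congr_fun (chartAt 𝔼 p).open_target.measurableSet fun y hy ↦
      hLC.volumeDensity_mul_divergence ((chartAt 𝔼 p).map_target hy) (smooth _),
    integral_finsetSum _ fun k _ ↦ integrableOn_mvfderiv_coordFrame (compact_w k)
      ((tsupport_w k).trans hp) (smooth_w k) k]
  exact Finset.sum_eq_zero fun k _ ↦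
    setIntegral_mvfderiv_coordFrame (compact_w k) ((tsupport_w k).trans hp) (smooth_w k) k

theorem IsLeviCivita.integral_divergence [CompactSpace M] [T2Space M] (hLC : IsLeviCivita nabla)
    (hX : ContMDiff (𝓡 n) ((𝓡 n).prod 𝓘(ℝ, 𝔼)) ∞ (T% X)) :
    ∫ x, divergence nabla X x ∂(riemannianVolume n M) = 0 := by
  obtain ⟨t, ht⟩ := isCompact_univ.elim_finite_subcover
    (fun p : M ↦ (chartAt 𝔼 p).source) (fun p ↦ (chartAt 𝔼 p).open_source)
    (fun x _ ↦ Set.mem_iUnion.2 ⟨x, mem_chart_source 𝔼 x⟩)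
  obtain ⟨ρ, hρ⟩ := SmoothPartitionOfUnity.exists_isSubordinate (𝓡 n) (isClosed_univ (X := M))
    (fun p : t ↦ (chartAt 𝔼 p.1).source) (fun p ↦ (chartAt 𝔼 p.1).open_source)
    (fun x hx ↦ by simpa using ht hx)
  have smooth (i) : ContMDiff (𝓡 n) ((𝓡 n).prod 𝓘(ℝ, 𝔼)) ∞ (T% (⇑(ρ i) • X)) :=
    (ρ i).contMDiff.smul_section hX
  have X_eq : X = ∑ i, ⇑(ρ i) • X := by
    ext1 x
    rw [Finset.sum_apply]
    change X x = ∑ i, ρ i x • X x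
    rw [← Finset.sum_smul, ← finsum_eq_sum_of_fintype, ρ.sum_eq_one (Set.mem_univ x), one_smul]
  have divergence_eq (x) : divergence nabla X x = ∑ i, divergence nabla (⇑(ρ i) • X) x := by
    conv_lhs => rw [X_eq]
    exact divergence_sum _ fun i _ ↦ (smooth i).mdifferentiable (by simp) x
  simp only [divergence_eq]
  rw [integral_finsetSum _ fun i _ ↦
    (hLC.contMDiff_divergence (smooth i)).continuous.integrable_of_hasCompactSupport
      (.of_compactSpace _)]
  exact Finset.sum_eq_zero fun i _ ↦ hLC.integral_divergence_of_tsupport_subset (ρ i).contMDiff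
    (.of_compactSpace _) (hρ i) hX

theorem IsLeviCivita.integral_mvfderiv_add_mul_divergence [CompactSpace M] [T2Space M]
    (hLC : IsLeviCivita nabla) (hu : ContMDiff (𝓡 n) 𝓘(ℝ) ∞ u)
    (hX : ContMDiff (𝓡 n) ((𝓡 n).prod 𝓘(ℝ, 𝔼)) ∞ (T% X)) :
    ∫ x, (mvfderiv (𝓡 n) u x (X x) + u x * divergence nabla X x) ∂(riemannianVolume n M) = 0 := by
  rw [← hLC.integral_divergence (hu.smul_section hX)]
  congr with x
  rw [divergence_smul (hu.mdifferentiable (by simp) x) (hX.mdifferentiable (by simp) x), add_comm]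

end DivergenceTheorem

theorem two_smul_sum_sum_Ioi {ι W : Type*} [Fintype ι] [LinearOrder ι] [LocallyFiniteOrderTop ι]
    [LocallyFiniteOrderBot ι] [AddCommGroup W] [Module ℝ W] {g : ι → ι → W}
    (symm : ∀ i j, g i j = g j i) (diag : ∀ i, g i i = 0) :
    (2 : ℝ) • ∑ i, ∑ j ∈ Finset.Ioi i, g i j = ∑ i, ∑ j, g i j := by
  have split_row (i : ι) :
      ∑ j, g i j = ∑ j ∈ Finset.Ioi i, g i j + ∑ j ∈ Finset.Iio i, g i j := by
    rw [← Finset.sum_union (Finset.disjoint_left.2 fun j hj hj' ↦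
      (Finset.mem_Ioi.1 hj).asymm (Finset.mem_Iio.1 hj'))]
    refine (Finset.sum_subset (Finset.subset_univ _) fun j _ hj ↦ ?_).symm
    simp only [Finset.mem_union, Finset.mem_Ioi, Finset.mem_Iio, not_or, not_lt] at hj
    rw [le_antisymm hj.1 hj.2, diag]
  have lower_eq_upper : ∑ i, ∑ j ∈ Finset.Iio i, g i j = ∑ i, ∑ j ∈ Finset.Ioi i, g i j := by
    rw [Finset.sum_comm' (t' := Finset.univ) (s' := fun j ↦ Finset.Ioi j) (by simp)]
    exact Finset.sum_congr rfl fun i _ ↦ Finset.sum_congr rfl fun j _ ↦ symm j i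
  rw [Finset.sum_congr rfl fun i _ ↦ split_row i, Finset.sum_add_distrib, lower_eq_upper, two_smul]

section ParsevalFrame

variable {ι V W : Type*} [Fintype ι] [NormedAddCommGroup V] [InnerProductSpace ℝ V]
  [AddCommGroup W] [Module ℝ W] {E : ι → V}

/-- `E` is a Parseval frame of `V`: a possibly redundant family that reproduces vectors as an
orthonormal basis does. The tangential components of the standard basis of `ℝᴺ` form one. -/
def IsParsevalFrame (E : ι → V) : Prop := ∀ v, ∑ a, inner ℝ (E a) v • E a = v

namespace IsParsevalFrame

theorem map_eq_sum (hE : IsParsevalFrame E) (L : V →ₗ[ℝ] W) (v : V) :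
    L v = ∑ a, inner ℝ (E a) v • L (E a) := by
  conv_lhs => rw [← hE v, map_sum]
  simp only [map_smul]

theorem sum_orthonormalBasis_eq {κ : Type*} [Fintype κ] (hE : IsParsevalFrame E)
    (e : OrthonormalBasis κ ℝ V) (B : V →ₗ[ℝ] V →ₗ[ℝ] W) :
    ∑ i, B (e i) (e i) = ∑ a, B (E a) (E a) := by
  calc ∑ i, B (e i) (e i) = ∑ i, ∑ a, inner ℝ (E a) (e i) • B (E a) (e i) :=
        Finset.sum_congr rfl fun i _ ↦ hE.map_eq_sum (B.flip (e i)) (e i)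
    _ = ∑ a, ∑ i, B (E a) (inner ℝ (e i) (E a) • e i) := by
        rw [Finset.sum_comm]
        simp only [map_smul, real_inner_comm]
    _ = ∑ a, B (E a) (E a) := by simp only [← map_sum, e.sum_repr']

theorem trace_eq_sum [FiniteDimensional ℝ V] (hE : IsParsevalFrame E) (A : V →ₗ[ℝ] V) :
    LinearMap.trace ℝ V A = ∑ a, inner ℝ (E a) (A (E a)) := by
  rw [LinearMap.trace_eq_sum_inner A (stdOrthonormalBasis ℝ V)]
  exact hE.sum_orthonormalBasis_eq (stdOrthonormalBasis ℝ V) ((innerₗ V).compl₂ A)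

theorem sum_norm_sq [FiniteDimensional ℝ V] (hE : IsParsevalFrame E) :
    ∑ a, ‖E a‖ ^ 2 = Module.finrank ℝ V := by
  simp only [← real_inner_self_eq_norm_sq]
  exact (hE.trace_eq_sum LinearMap.id).symm.trans (LinearMap.trace_id ℝ V)

theorem sum_apply_symmetric_comm (hE : IsParsevalFrame E) {A : V →ₗ[ℝ] V} (hA : A.IsSymmetric)
    (B : V →ₗ[ℝ] V →ₗ[ℝ] W) : ∑ a, B (A (E a)) (E a) = ∑ a, B (E a) (A (E a)) := by
  calc ∑ a, B (A (E a)) (E a) = ∑ a, ∑ b, inner ℝ (E b) (A (E a)) • B (E b) (E a) :=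
        Finset.sum_congr rfl fun a _ ↦ hE.map_eq_sum (B.flip (E a)) (A (E a))
    _ = ∑ b, ∑ a, inner ℝ (E a) (A (E b)) • B (E b) (E a) := by
        rw [Finset.sum_comm]
        exact Finset.sum_congr rfl fun b _ ↦ Finset.sum_congr rfl fun a _ ↦ by
          rw [← hA (E b) (E a), real_inner_comm]
    _ = ∑ b, B (E b) (A (E b)) :=
        Finset.sum_congr rfl fun b _ ↦ (hE.map_eq_sum (B (E b)) (A (E b))).symm

end IsParsevalFrame

/-- The second-order data of an isometric immersion `f : M → ℝᴺ` at a point: `E a` stands for the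
gradient and `H a` for the Hessian of the `a`-th component of `f`. The last condition says that
the second fundamental form, with components `⟪H a v, w⟫`, takes normal values. -/
structure IsSecondFundamentalForm (E : ι → V) (H : ι → V →ₗ[ℝ] V) : Prop where
  frame : IsParsevalFrame E
  symm : ∀ a, (H a).IsSymmetric
  normal : ∀ v w, ∑ a, inner ℝ (H a v) w • E a = 0

namespace IsSecondFundamentalForm

variable {H : ι → V →ₗ[ℝ] V}

theorem of_skew (hE : IsParsevalFrame E) (hH : ∀ a, (H a).IsSymmetric)
    (skew : ∀ v w z, ∑ a, (inner ℝ (H a v) w * inner ℝ (E a) z +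
      inner ℝ (E a) w * inner ℝ (H a v) z) = 0) : IsSecondFundamentalForm E H := by
  refine ⟨hE, hH, fun v w ↦ ext_inner_right ℝ fun z ↦ ?_⟩
  let T (v w z : V) : ℝ := ∑ a, inner ℝ (H a v) w * inner ℝ (E a) z
  have T_symm (v w z) : T v w z = T w v z :=
    Finset.sum_congr rfl fun a _ ↦ by rw [hH a v w, real_inner_comm]
  have T_skew (v w z) : T v w z = -T v z w := by
    rw [eq_neg_iff_add_eq_zero, ← skew v w z, ← Finset.sum_add_distrib]
    exact Finset.sum_congr rfl fun a _ ↦ by rw [mul_comm (inner ℝ (H a v) z)]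
  have T_eq : inner ℝ (∑ a, inner ℝ (H a v) w • E a) z = T v w z := by
    simp only [T, sum_inner, real_inner_smul_left]
  rw [T_eq, inner_zero_left]
  -- A trilinear form that is symmetric in one pair of arguments and skew in another one vanishes.
  linarith [T_symm v w z, T_skew w v z, T_symm w z v, T_skew z w v, T_symm z v w, T_skew v z w]

theorem sum_apply_apply_eq_zero (h : IsSecondFundamentalForm E H) (B : V →ₗ[ℝ] V →ₗ[ℝ] W) (v : V) :
    ∑ a, B (E a) (H a v) = 0 := by
  calc ∑ a, B (E a) (H a v) = ∑ a, ∑ b, inner ℝ (E b) (H a v) • B (E a) (E b) :=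
        Finset.sum_congr rfl fun a _ ↦ h.frame.map_eq_sum (B (E a)) (H a v)
    _ = ∑ b, B (∑ a, inner ℝ (H a v) (E b) • E a) (E b) := by
        rw [Finset.sum_comm]
        simp only [map_sum, map_smul, LinearMap.sum_apply, LinearMap.smul_apply, real_inner_comm]
    _ = 0 := by simp only [h.normal, map_zero, LinearMap.zero_apply, Finset.sum_const_zero]

theorem sum_apply_self (h : IsSecondFundamentalForm E H) : ∑ a, H a (E a) = 0 := by
  refine ext_inner_right ℝ fun w ↦ ?_
  rw [sum_inner, inner_zero_left, ← h.sum_apply_apply_eq_zero (innerₗ V) w]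
  exact Finset.sum_congr rfl fun a _ ↦ h.symm a (E a) w

theorem sum_trace_smul [FiniteDimensional ℝ V] (h : IsSecondFundamentalForm E H) :
    ∑ a, LinearMap.trace ℝ V (H a) • E a = 0 := by
  simp only [h.frame.trace_eq_sum, Finset.sum_smul]
  rw [Finset.sum_comm]
  exact Finset.sum_eq_zero fun b _ ↦ by
    simpa only [real_inner_comm] using h.normal (E b) (E b)

end IsSecondFundamentalForm

/-- `c` makes `W` a module over the Clifford algebra of the Euclidean space `V`: this is the
polarization of the Clifford relation `v · v = -|v|²`. -/
def IsCliffordAction (c : V →ₗ[ℝ] W →ₗ[ℝ] W) : Prop :=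
  ∀ v w s, c v (c w s) + c w (c v s) = (-2 * inner ℝ v w : ℝ) • s

namespace IsCliffordAction

variable {c : V →ₗ[ℝ] W →ₗ[ℝ] W}

theorem sum_clifford_symmetric [FiniteDimensional ℝ V] (hc : IsCliffordAction c)
    (hE : IsParsevalFrame E) {A : V →ₗ[ℝ] V} (hA : A.IsSymmetric) (s : W) :
    ∑ a, c (E a) (c (A (E a)) s) = -LinearMap.trace ℝ V A • s := by
  have comm : ∑ a, c (A (E a)) (c (E a) s) = ∑ a, c (E a) (c (A (E a)) s) :=
    hE.sum_apply_symmetric_comm hA (c.compl₂ (c.flip s))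
  refine smul_right_injective W (two_ne_zero (α := ℝ)) ?_
  calc (2 : ℝ) • ∑ a, c (E a) (c (A (E a)) s)
      = ∑ a, (c (E a) (c (A (E a)) s) + c (A (E a)) (c (E a) s)) := by
        rw [Finset.sum_add_distrib, comm, two_smul]
    _ = (2 : ℝ) • (-LinearMap.trace ℝ V A • s) := by
        simp only [hc _ _ _, ← Finset.sum_smul, ← Finset.mul_sum, ← hE.trace_eq_sum, smul_smul]
        ring_nf

theorem sum_sum_swap (hc : IsCliffordAction c) (hE : IsParsevalFrame E) (A : ι → V →ₗ[ℝ] W) :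
    ∑ a, ∑ b, c (E a) (c (E b) (A a (E b))) =
      -∑ a, ∑ b, c (E a) (c (E b) (A b (E a))) - (2 : ℝ) • ∑ a, A a (E a) := by
  have contract (a) : ∑ b, (2 * inner ℝ (E a) (E b)) • A a (E b) = (2 : ℝ) • A a (E a) := by
    simp only [hE.map_eq_sum (A a) (E a), Finset.smul_sum, smul_smul, real_inner_comm]
  have anticomm (a b) : c (E a) (c (E b) (A a (E b))) =
      -c (E b) (c (E a) (A a (E b))) - (2 * inner ℝ (E a) (E b)) • A a (E b) := by
    linear_combination (norm := module) hc (E a) (E b) (A a (E b))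
  simp only [anticomm, Finset.sum_sub_distrib, Finset.sum_neg_distrib, contract, Finset.smul_sum]
  rw [Finset.sum_comm]

theorem two_smul_sum_Ioi {m : ℕ} (hc : IsCliffordAction c) (hE : IsParsevalFrame E)
    (e : OrthonormalBasis (Fin m) ℝ V) {K : V →ₗ[ℝ] V →ₗ[ℝ] W} (hK : K.IsAlt) :
    (2 : ℝ) • ∑ i, ∑ j ∈ Finset.Ioi i, c (e i) (c (e j) (K (e i) (e j))) =
      ∑ a, ∑ b, c (E a) (c (E b) (K (E a) (E b))) := by
  have term_symm (i j) : c (e i) (c (e j) (K (e i) (e j))) =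
      c (e j) (c (e i) (K (e j) (e i))) := by
    rcases eq_or_ne i j with rfl | hij
    · rfl
    · have anticomm := hc (e i) (e j) (K (e i) (e j))
      rw [e.orthonormal.2 hij, mul_zero, zero_smul] at anticomm
      rw [← hK.neg (e i), map_neg, map_neg]
      exact eq_neg_of_add_eq_zero_left anticomm
  rw [two_smul_sum_sum_Ioi term_symm fun i ↦ by rw [hK, map_zero, map_zero]]
  calc ∑ i, ∑ j, c (e i) (c (e j) (K (e i) (e j)))
      = ∑ i, ∑ b, c (e i) (c (E b) (K (e i) (E b))) := Finset.sum_congr rfl fun i _ ↦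
        hE.sum_orthonormalBasis_eq e ((c.compl₂ (K (e i))).compr₂ (c (e i)))
    _ = ∑ b, ∑ a, c (E a) (c (E b) (K (E a) (E b))) := by
        rw [Finset.sum_comm]
        exact Finset.sum_congr rfl fun b _ ↦
          hE.sum_orthonormalBasis_eq e (c.compl₂ ((c (E b)).comp (K.flip (E b))))
    _ = ∑ a, ∑ b, c (E a) (c (E b) (K (E a) (E b))) := Finset.sum_comm

end IsCliffordAction

end ParsevalFrame

section Gradient

variable {n : ℕ} {M : Type*} [TopologicalSpace M] [ChartedSpace (EuclideanSpace ℝ (Fin n)) M]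

local notation "𝔼" => EuclideanSpace ℝ (Fin n)

section Hessian

variable [IsManifold (𝓡 n) ∞ M]

theorem mvfderiv_mvfderiv_coordFrame {u : M → ℝ} (hu : ContMDiff (𝓡 n) 𝓘(ℝ) ∞ u) {p x : M}
    (hx : x ∈ (chartAt 𝔼 p).source) (i j : Fin n) :
    mvfderiv (𝓡 n) (fun y ↦ mvfderiv (𝓡 n) u y (coordFrame p j y)) x (coordFrame p i x) =
      fderiv ℝ (fderiv ℝ (u ∘ (chartAt 𝔼 p).symm)) (chartAt 𝔼 p x) (EuclideanSpace.single i 1)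
        (EuclideanSpace.single j 1) := by
  set c := chartAt 𝔼 p
  have hcx : c x ∈ c.target := c.map_source hx
  have smooth_comp : ContDiffAt ℝ 2 (u ∘ c.symm) (c x) :=
    (contMDiffAt_iff_contDiffAt.1 <| hu.contMDiffAt.comp _ <|
      contMDiffOn_chart_symm.contMDiffAt (c.open_target.mem_nhds hcx)).of_le ENat.LEInfty.out
  have differentiable_fderiv : DifferentiableAt ℝ (fderiv ℝ (u ∘ c.symm)) (c x) :=
    (smooth_comp.fderiv_right (m := 1) (by norm_num)).differentiableAt one_ne_zero
  have inner_eq : (fun y ↦ mvfderiv (𝓡 n) u y (coordFrame p j y)) ∘ c.symm =ᶠ[nhds (c x)]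
      fun y ↦ fderiv ℝ (u ∘ c.symm) y (EuclideanSpace.single j 1) := by
    filter_upwards [c.open_target.mem_nhds hcx] with y hy
    exact (fderiv_comp_chart_symm hy (hu.mdifferentiable (by simp) _) j).symm
  have smooth : MDifferentiableAt (𝓡 n) 𝓘(ℝ)
      (fun y ↦ mvfderiv (𝓡 n) u y (coordFrame p j y)) (c.symm (c x)) := by
    rw [c.left_inv hx]
    exact (contMDiffAt_mvfderiv_apply hu (contMDiffAt_coordFrame hx j)).mdifferentiableAt (by simp)
  have outer_eq := fderiv_comp_chart_symm hcx smooth i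
  rw [c.left_inv hx, inner_eq.fderiv_eq] at outer_eq
  rw [← outer_eq, fderiv_clm_apply differentiable_fderiv (differentiableAt_const _)]
  simp

theorem mvfderiv_mvfderiv_coordFrame_comm {u : M → ℝ} (hu : ContMDiff (𝓡 n) 𝓘(ℝ) ∞ u) {p x : M}
    (hx : x ∈ (chartAt 𝔼 p).source) (i j : Fin n) :
    mvfderiv (𝓡 n) (fun y ↦ mvfderiv (𝓡 n) u y (coordFrame p j y)) x (coordFrame p i x) =
      mvfderiv (𝓡 n) (fun y ↦ mvfderiv (𝓡 n) u y (coordFrame p i y)) x (coordFrame p j x) := by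
  have smooth_comp : ContDiffAt ℝ ∞ (u ∘ (chartAt 𝔼 p).symm) (chartAt 𝔼 p x) :=
    contMDiffAt_iff_contDiffAt.1 <| hu.contMDiffAt.comp _ <|
      contMDiffOn_chart_symm.contMDiffAt <|
        (chartAt 𝔼 p).open_target.mem_nhds ((chartAt 𝔼 p).map_source hx)
  rw [mvfderiv_mvfderiv_coordFrame hu hx, mvfderiv_mvfderiv_coordFrame hu hx]
  exact (smooth_comp.isSymmSndFDerivAt (by simpa using ENat.LEInfty.out)).eq _ _

end Hessian

variable [RiemannianBundle (fun x : M ↦ TangentSpace (𝓡 n) x)]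

/-- The gradient of a function on a Riemannian manifold. -/
def grad (u : M → ℝ) (x : M) : TangentSpace (𝓡 n) x :=
  haveI : CompleteSpace (TangentSpace (𝓡 n) x) := FiniteDimensional.complete ℝ _
  (InnerProductSpace.toDual ℝ (TangentSpace (𝓡 n) x)).symm (mvfderiv (𝓡 n) u x)

theorem inner_grad (u : M → ℝ) (x : M) (v : TangentSpace (𝓡 n) x) :
    inner ℝ (grad u x) v = mvfderiv (𝓡 n) u x v := by
  have : CompleteSpace (TangentSpace (𝓡 n) x) := FiniteDimensional.complete ℝ _
  exact InnerProductSpace.toDual_symm_apply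

variable [IsManifold (𝓡 n) ∞ M]
  [IsContMDiffRiemannianBundle (𝓡 n) ∞ (EuclideanSpace ℝ (Fin n))
    (fun x : M ↦ TangentSpace (𝓡 n) x)]

theorem contMDiff_grad {u : M → ℝ} (hu : ContMDiff (𝓡 n) 𝓘(ℝ) ∞ u) :
    ContMDiff (𝓡 n) ((𝓡 n).prod 𝓘(ℝ, 𝔼)) ∞ (T% (grad u : Π x : M, TangentSpace (𝓡 n) x)) := by
  intro p
  have smooth_component (k) : ContMDiffAt (𝓡 n) 𝓘(ℝ) ∞
      (coordComponent p (grad (n := n) u) k) p := by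
    have hp := mem_chart_source 𝔼 p
    unfold coordComponent
    simp only [real_inner_comm (grad u _), inner_grad]
    exact ContMDiffAt.sum fun j _ ↦
      (contMDiffAt_inv_apply (contMDiffAt_frameGram hp) (det_frameGram_pos hp).ne' k j).mul
        (contMDiffAt_mvfderiv_apply hu (contMDiffAt_coordFrame hp j))
  have eventuallyEq : (T% (grad u : Π x : M, TangentSpace (𝓡 n) x)) =ᶠ[nhds p]
      T% (fun x ↦ ∑ k, coordComponent p (grad u) k x • coordFrame p k x) := by
    filter_upwards [(chartAt 𝔼 p).open_source.mem_nhds (mem_chart_source 𝔼 p)] with x hx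
    exact congrArg _ (sum_coordComponent_smul_coordFrame _ hx).symm
  exact (ContMDiffAt.sum_section fun k _ ↦ (smooth_component k).smul_section
    (contMDiffAt_coordFrame (mem_chart_source 𝔼 p) k)).congr_of_eventuallyEq eventuallyEq

variable {nabla : CovariantDerivative (𝓡 n) (EuclideanSpace ℝ (Fin n))
  (fun x : M ↦ TangentSpace (𝓡 n) x)}

theorem IsLeviCivita.isSymmetric_conn_grad (hLC : IsLeviCivita nabla) {u : M → ℝ}
    (hu : ContMDiff (𝓡 n) 𝓘(ℝ) ∞ u) (x : M) : (nabla (grad u) x).toLinearMap.IsSymmetric := by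
  have hx := mem_chart_source 𝔼 x
  have smooth_grad := (contMDiff_grad hu).mdifferentiable (by simp) x
  have hessian_eq (i j) : inner ℝ (nabla (grad u) x (coordFrame x i x)) (coordFrame x j x) =
      mvfderiv (𝓡 n) (fun y ↦ mvfderiv (𝓡 n) u y (coordFrame x j y)) x (coordFrame x i x) -
        inner ℝ (grad u x) (nabla (coordFrame x j) x (coordFrame x i x)) := by
    rw [eq_sub_iff_add_eq, ← hLC.mvfderiv_inner smooth_grad
      ((contMDiffAt_coordFrame hx j).mdifferentiableAt (by simp))]
    simp only [inner_grad]
  have bilin_eq : (innerₗ _).comp (nabla (grad u) x).toLinearMap =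
      (innerₗ _).compl₂ (nabla (grad u) x).toLinearMap :=
    LinearMap.ext_basis (coordBasis hx) (coordBasis hx) fun i j ↦ by
      rw [coe_coordBasis]
      change inner ℝ (nabla (grad u) x (coordFrame x i x)) (coordFrame x j x) =
        inner ℝ (coordFrame x i x) (nabla (grad u) x (coordFrame x j x))
      rw [real_inner_comm _ (coordFrame x i x), hessian_eq, hessian_eq,
        mvfderiv_mvfderiv_coordFrame_comm hu hx, hLC.conn_coordFrame_comm hx]
  exact fun v w ↦ congrArg (fun B ↦ B v w) bilin_eq

end Gradient

section IsometricImmersion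

variable {n N : ℕ} {M : Type*} [TopologicalSpace M] [ChartedSpace (EuclideanSpace ℝ (Fin n)) M]

local notation "𝔼" => EuclideanSpace ℝ (Fin n)

theorem mvfderiv_euclidean_apply {U : M → EuclideanSpace ℝ (Fin N)} {x : M}
    (hU : MDifferentiableAt (𝓡 n) (𝓡 N) U x) (v : TangentSpace (𝓡 n) x) (a : Fin N) :
    mvfderiv (𝓡 n) U x v a = mvfderiv (𝓡 n) (fun y ↦ U y a) x v := by
  have chain := mfderiv_comp (I := 𝓡 n) (I' := 𝓡 N) (I'' := 𝓘(ℝ)) x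
    (EuclideanSpace.proj (𝕜 := ℝ) a).mdifferentiableAt hU
  rw [ContinuousLinearMap.mfderiv_eq] at chain
  exact (congrArg (fun L ↦ L v) chain).symm

theorem mvfderiv_fun_sum {W : Type*} {ι : Type} [NormedAddCommGroup W] [NormedSpace ℝ W]
    {u : ι → M → W} {x : M} (s : Finset ι) (hu : ∀ i ∈ s, MDifferentiableAt (𝓡 n) 𝓘(ℝ, W) (u i) x) :
    mvfderiv (𝓡 n) (fun y ↦ ∑ i ∈ s, u i y) x = ∑ i ∈ s, mvfderiv (𝓡 n) (u i) x := by
  have hasDeriv : HasMFDerivAt (𝓡 n) 𝓘(ℝ, W) (∑ i ∈ s, u i) x (∑ i ∈ s, mvfderiv (𝓡 n) (u i) x) :=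
    HasMFDerivAt.sum fun i hi ↦ (hu i hi).hasMFDerivAt
  rw [Finset.sum_fn] at hasDeriv
  exact hasDeriv.mfderiv

variable [RiemannianBundle (fun x : M ↦ TangentSpace (𝓡 n) x)]

/-- `f : M → ℝᴺ` is an isometric immersion: a smooth map which pulls back the Euclidean metric to
the metric of `M`. -/
structure IsIsometricImmersion (f : M → EuclideanSpace ℝ (Fin N)) : Prop where
  contMDiff : ContMDiff (𝓡 n) (𝓡 N) ∞ f
  inner_eq : ∀ (p : M) (v w : TangentSpace (𝓡 n) p),
    inner ℝ (mvfderiv (𝓡 n) f p v) (mvfderiv (𝓡 n) f p w) = inner ℝ v w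

/-- The gradient of the `a`-th coordinate function of `f : M → ℝᴺ`. -/
def coordGrad (f : M → EuclideanSpace ℝ (Fin N)) (a : Fin N) (x : M) : TangentSpace (𝓡 n) x :=
  grad (fun y ↦ f y a) x

variable {f : M → EuclideanSpace ℝ (Fin N)}

theorem IsIsometricEmbedding.isIsometricImmersion (hf : IsIsometricEmbedding (n := n) f) :
    IsIsometricImmersion (n := n) f :=
  ⟨hf.isSmoothEmbedding.contMDiff, hf.inner_eq⟩

namespace IsIsometricImmersion

theorem contMDiff_apply (hf : IsIsometricImmersion (n := n) f) (a : Fin N) :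
    ContMDiff (𝓡 n) 𝓘(ℝ) ∞ (fun y ↦ f y a) :=
  (EuclideanSpace.proj (𝕜 := ℝ) a).contMDiff.comp hf.contMDiff

theorem mvfderiv_apply_eq_inner (hf : IsIsometricImmersion (n := n) f) (x : M)
    (v : TangentSpace (𝓡 n) x) (a : Fin N) :
    mvfderiv (𝓡 n) f x v a = inner ℝ (coordGrad f a x) v := by
  rw [mvfderiv_euclidean_apply (hf.contMDiff.mdifferentiable (by simp) x), coordGrad, inner_grad]

theorem sum_inner_mul_inner (hf : IsIsometricImmersion (n := n) f) (x : M)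
    (v w : TangentSpace (𝓡 n) x) :
    ∑ a, inner ℝ (coordGrad f a x) v * inner ℝ (coordGrad f a x) w = inner ℝ v w := by
  rw [← hf.inner_eq, PiLp.inner_apply]
  simp only [hf.mvfderiv_apply_eq_inner, RCLike.inner_apply, conj_trivial, mul_comm]

theorem isParsevalFrame (hf : IsIsometricImmersion (n := n) f) (x : M) :
    IsParsevalFrame fun a ↦ coordGrad (n := n) f a x := fun v ↦ by
  refine ext_inner_right ℝ fun w ↦ ?_
  simp only [sum_inner, real_inner_smul_left, hf.sum_inner_mul_inner]

theorem sum_norm_coordGrad_sq (hf : IsIsometricImmersion (n := n) f) (x : M) :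
    ∑ a, ‖coordGrad (n := n) f a x‖ ^ 2 = n := by
  rw [(hf.isParsevalFrame x).sum_norm_sq]
  exact congrArg Nat.cast finrank_euclideanSpace_fin

variable [IsManifold (𝓡 n) ∞ M]
  [IsContMDiffRiemannianBundle (𝓡 n) ∞ (EuclideanSpace ℝ (Fin n))
    (fun x : M ↦ TangentSpace (𝓡 n) x)]

theorem contMDiff_coordGrad (hf : IsIsometricImmersion (n := n) f) (a : Fin N) :
    ContMDiff (𝓡 n) ((𝓡 n).prod 𝓘(ℝ, 𝔼)) ∞
      (T% (coordGrad f a : Π x : M, TangentSpace (𝓡 n) x)) :=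
  contMDiff_grad (hf.contMDiff_apply a)

theorem mdifferentiableAt_coordGrad (hf : IsIsometricImmersion (n := n) f) (a : Fin N) (x : M) :
    MDifferentiableAt (𝓡 n) ((𝓡 n).prod 𝓘(ℝ, 𝔼))
      (T% (coordGrad f a : Π x : M, TangentSpace (𝓡 n) x)) x :=
  (hf.contMDiff_coordGrad a).mdifferentiable (by simp) x

end IsIsometricImmersion

namespace IsLeviCivita

variable [IsManifold (𝓡 n) ∞ M]
  [IsContMDiffRiemannianBundle (𝓡 n) ∞ (EuclideanSpace ℝ (Fin n))
    (fun x : M ↦ TangentSpace (𝓡 n) x)]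
  {nabla : CovariantDerivative (𝓡 n) (EuclideanSpace ℝ (Fin n))
    (fun x : M ↦ TangentSpace (𝓡 n) x)}

set_option synthInstance.maxHeartbeats 200000 in
theorem sum_inner_conn_coordGrad_skew (hLC : IsLeviCivita nabla)
    (hf : IsIsometricImmersion (n := n) f) {x : M} (v w z : TangentSpace (𝓡 n) x) :
    ∑ a, (inner ℝ (nabla (coordGrad f a) x v) w * inner ℝ (coordGrad f a x) z +
      inner ℝ (coordGrad f a x) w * inner ℝ (nabla (coordGrad f a) x v) z) = 0 := by
  let X (w : TangentSpace (𝓡 n) x) : Π x : M, TangentSpace (𝓡 n) x := FiberBundle.extend 𝔼 w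
  have X_self (w) : X w x = w := FiberBundle.extend_apply_self ..
  have smooth_X (w) : MDifferentiableAt (𝓡 n) ((𝓡 n).prod 𝓘(ℝ, 𝔼)) (T% (X w)) x :=
    (FiberBundle.contMDiffAt_extend ..).mdifferentiableAt (n := ∞) (by simp)
  have smooth_E (a) := hf.mdifferentiableAt_coordGrad a x
  have smooth_inner (a w) : MDifferentiableAt (𝓡 n) 𝓘(ℝ)
      (fun y ↦ inner ℝ (coordGrad (n := n) f a y) (X w y)) x :=
    (smooth_E a).inner_bundle (smooth_X w)
  have deriv_inner (a w) : mvfderiv (𝓡 n)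
      (fun y ↦ inner ℝ (coordGrad (n := n) f a y) (X w y)) x v =
        inner ℝ (nabla (coordGrad f a) x v) w + inner ℝ (coordGrad f a x) (nabla (X w) x v) := by
    rw [hLC.mvfderiv_inner (smooth_E a) (smooth_X w), X_self]
  have deriv_eq := congrArg (fun u : M → ℝ ↦ mvfderiv (𝓡 n) u x v)
    (funext fun y ↦ hf.sum_inner_mul_inner y (X w y) (X z y))
  rw [mvfderiv_fun_sum (u := fun a y ↦ inner ℝ (coordGrad (n := n) f a y) (X w y) *
      inner ℝ (coordGrad (n := n) f a y) (X z y)) _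
      fun a _ ↦ (smooth_inner a w).mul (smooth_inner a z), sum_apply,
    hLC.mvfderiv_inner (smooth_X w) (smooth_X z), X_self, X_self,
    ← hf.sum_inner_mul_inner x (nabla (X w) x v), ← hf.sum_inner_mul_inner x _ (nabla (X z) x v),
    ← Finset.sum_add_distrib, ← sub_eq_zero, ← Finset.sum_sub_distrib] at deriv_eq
  rw [← deriv_eq]
  refine Finset.sum_congr rfl fun a _ ↦ ?_
  rw [mvfderiv_fun_mul (smooth_inner a w) (smooth_inner a z)]
  simp only [add_apply, smul_apply, smul_eq_mul, deriv_inner, X_self]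
  ring

theorem isSecondFundamentalForm (hLC : IsLeviCivita nabla) (hf : IsIsometricImmersion (n := n) f)
    (x : M) : IsSecondFundamentalForm (fun a ↦ coordGrad (n := n) f a x)
      (fun a ↦ (nabla (coordGrad f a) x).toLinearMap) :=
  .of_skew (hf.isParsevalFrame x) (fun a ↦ hLC.isSymmetric_conn_grad (hf.contMDiff_apply a) x)
    fun v w z ↦ hLC.sum_inner_conn_coordGrad_skew hf v w z

set_option synthInstance.maxHeartbeats 200000 in
theorem mvfderiv_mvfderiv_eq (hLC : IsLeviCivita nabla) (hf : IsIsometricImmersion (n := n) f)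
    {x : M} {W : Π x : M, TangentSpace (𝓡 n) x}
    (hW : ContMDiffAt (𝓡 n) ((𝓡 n).prod 𝓘(ℝ, 𝔼)) ∞ (T% W) x) (v : TangentSpace (𝓡 n) x) :
    mvfderiv (𝓡 n) (fun q ↦ mvfderiv (𝓡 n) f q (W q)) x v =
      WithLp.toLp 2 (fun a ↦ inner ℝ (nabla (coordGrad f a) x v) (W x)) +
        mvfderiv (𝓡 n) f x (nabla W x v) := by
  have smooth : MDifferentiableAt (𝓡 n) (𝓡 N) (fun q ↦ mvfderiv (𝓡 n) f q (W q)) x :=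
    (contMDiffAt_mvfderiv_apply hf.contMDiff hW).mdifferentiableAt (by simp)
  refine PiLp.ext fun a ↦ ?_
  rw [PiLp.add_apply, hf.mvfderiv_apply_eq_inner, mvfderiv_euclidean_apply smooth]
  simp only [hf.mvfderiv_apply_eq_inner]
  exact hLC.mvfderiv_inner (hf.mdifferentiableAt_coordGrad a x) (hW.mdifferentiableAt (by simp)) v

theorem secondFundamentalForm_eq (hLC : IsLeviCivita nabla) (hf : IsIsometricImmersion (n := n) f)
    (x : M) (v w : TangentSpace (𝓡 n) x) :
    secondFundamentalForm f x v w =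
      WithLp.toLp 2 fun a ↦ inner ℝ (nabla (coordGrad f a) x v) w := by
  have tangent (u) : mvfderiv (𝓡 n) f x u ∈
      (LinearMap.range (mvfderiv (𝓡 n) f x).toLinearMap)ᗮᗮ :=
    Submodule.le_orthogonal_orthogonal _ ⟨_, rfl⟩
  have normal : WithLp.toLp 2 (fun a ↦ inner ℝ (nabla (coordGrad f a) x v) w) ∈
      (LinearMap.range (mvfderiv (𝓡 n) f x).toLinearMap)ᗮ := by
    rw [Submodule.mem_orthogonal]
    rintro _ ⟨u, rfl⟩
    have inner_eq_zero := congrArg (inner ℝ · u) ((hLC.isSecondFundamentalForm hf x).normal v w)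
    simp only [sum_inner, real_inner_smul_left, inner_zero_left] at inner_eq_zero
    rw [PiLp.inner_apply, ← inner_eq_zero]
    refine Finset.sum_congr rfl fun a _ ↦ ?_
    simp [hf.mvfderiv_apply_eq_inner]
  rw [secondFundamentalForm, hLC.mvfderiv_mvfderiv_eq hf (FiberBundle.contMDiffAt_extend ..),
    map_add, FiberBundle.extend_apply_self, Submodule.starProjection_eq_self_iff.2 normal,
    (Submodule.starProjection_apply_eq_zero_iff _).2 (tangent _), add_zero]

theorem meanCurvatureVector_eq (hLC : IsLeviCivita nabla) (hf : IsIsometricImmersion (n := n) f)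
    (x : M) : meanCurvatureVector (n := n) f x =
      WithLp.toLp 2 fun a ↦ divergence nabla (coordGrad (n := n) f a) x := by
  refine PiLp.ext fun a ↦ ?_
  rw [meanCurvatureVector, WithLp.ofLp_sum, Finset.sum_apply]
  simp only [hLC.secondFundamentalForm_eq hf, divergence, real_inner_comm]
  exact (LinearMap.trace_eq_sum_inner _ (stdOrthonormalBasis ℝ (TangentSpace (𝓡 n) x))).symm

theorem sq_mul_meanCurvature_sq (hLC : IsLeviCivita nabla) (hf : IsIsometricImmersion (n := n) f)
    (hn : n ≠ 0) (x : M) : (n : ℝ) ^ 2 * meanCurvature (n := n) f x ^ 2 =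
      ∑ a, divergence nabla (coordGrad (n := n) f a) x ^ 2 := by
  rw [meanCurvature, hLC.meanCurvatureVector_eq hf, div_pow,
    mul_div_cancel₀ _ (pow_ne_zero 2 (Nat.cast_ne_zero.2 hn)), EuclideanSpace.real_norm_sq_eq]

theorem contMDiff_divergence_coordGrad (hLC : IsLeviCivita nabla)
    (hf : IsIsometricImmersion (n := n) f) (a : Fin N) :
    ContMDiff (𝓡 n) 𝓘(ℝ) ∞ (divergence nabla (coordGrad (n := n) f a)) :=
  hLC.contMDiff_divergence (hf.contMDiff_coordGrad a)

theorem contMDiff_meanCurvature_sq (hLC : IsLeviCivita nabla)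
    (hf : IsIsometricImmersion (n := n) f) (hn : n ≠ 0) :
    ContMDiff (𝓡 n) 𝓘(ℝ) ∞ fun x : M ↦ meanCurvature (n := n) f x ^ 2 := by
  have eq_sum_divergence_sq (x : M) : meanCurvature (n := n) f x ^ 2 =
      ((n : ℝ) ^ 2)⁻¹ * ∑ a, divergence nabla (coordGrad (n := n) f a) x ^ 2 := by
    rw [← hLC.sq_mul_meanCurvature_sq hf hn, inv_mul_cancel_left₀ (by positivity)]
  simp only [eq_sum_divergence_sq]
  exact contMDiff_const.mul
    (contMDiff_finsetSum fun a _ ↦ (hLC.contMDiff_divergence_coordGrad hf a).pow 2)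

end IsLeviCivita

end IsometricImmersion

section Compatibility

variable {𝕜 E : Type*} [RCLike 𝕜] [NormedAddCommGroup E] [InnerProductSpace ℝ E]
  [InnerProductSpace 𝕜 E]

theorem ofReal_smul_eq (r : ℝ) (s : E) : (r : 𝕜) • s = r • s := by
  let g : ℝ →+ E :=
    { toFun := fun r ↦ (r : 𝕜) • s
      map_zero' := by rw [RCLike.ofReal_zero, zero_smul]
      map_add' := fun a b ↦ by rw [RCLike.ofReal_add, add_smul] }
  have g_continuous : Continuous g := (RCLike.continuous_ofReal (K := 𝕜)).smul continuous_const
  calc (r : 𝕜) • s = g (r • 1) := by rw [smul_eq_mul, mul_one]; rfl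
    _ = r • g 1 := map_real_smul g g_continuous r 1
    _ = r • s := congrArg (r • ·) ((congrArg (· • s) RCLike.ofReal_one).trans (one_smul 𝕜 s))

variable (𝕜) in
theorem real_inner_eq_re (s t : E) : inner ℝ s t = RCLike.re (inner 𝕜 s t) := by
  rw [real_inner_eq_norm_add_mul_self_sub_norm_mul_self_sub_norm_mul_self_div_two,
    re_inner_eq_norm_add_mul_self_sub_norm_mul_self_sub_norm_mul_self_div_two]

theorem inner_real_smul_left (r : ℝ) (s t : E) :
    inner 𝕜 (r • s) t = (r : 𝕜) * inner 𝕜 s t := by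
  rw [← ofReal_smul_eq (𝕜 := 𝕜), inner_smul_left, RCLike.conj_ofReal]

theorem inner_real_smul_right (r : ℝ) (s t : E) :
    inner 𝕜 s (r • t) = (r : 𝕜) * inner 𝕜 s t := by
  rw [← ofReal_smul_eq (𝕜 := 𝕜), inner_smul_right]

theorem inner_eq_real_inner_add (s t : E) :
    inner 𝕜 s t = (inner ℝ s t : ℝ) + (inner ℝ ((RCLike.I : 𝕜) • s) t : ℝ) * RCLike.I := by
  rw [real_inner_eq_re 𝕜, real_inner_eq_re 𝕜, inner_smul_left, RCLike.conj_I, neg_mul, map_neg,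
    RCLike.I_mul_re, neg_neg, RCLike.re_add_im]

end Compatibility

section Pairing

variable {𝕜 : Type*} [RCLike 𝕜]
  {n : ℕ} {M : Type*} [TopologicalSpace M] [ChartedSpace (EuclideanSpace ℝ (Fin n)) M]
  [RiemannianBundle (fun x : M ↦ TangentSpace (𝓡 n) x)] [MeasurableSpace M]
  {V : M → Type*} [∀ x, NormedAddCommGroup (V x)] [∀ x, InnerProductSpace 𝕜 (V x)]

theorem l2Inner_eq_pairing_add (σ τ : Π x : M, V x) :
    l2Inner 𝕜 n σ τ = (pairing 𝕜 n σ τ : 𝕜) +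
      (pairing 𝕜 n (fun x ↦ (RCLike.I : 𝕜) • σ x) τ : 𝕜) * RCLike.I := by
  have l2Inner_I_smul : l2Inner 𝕜 n (fun x ↦ (RCLike.I : 𝕜) • σ x) τ =
      -RCLike.I * l2Inner 𝕜 n σ τ := by
    simp only [l2Inner, inner_smul_left, RCLike.conj_I, integral_const_mul]
  rw [pairing, pairing, l2Inner_I_smul, neg_mul, map_neg, RCLike.I_mul_re, neg_neg,
    RCLike.re_add_im]

end Pairing

section Smooth

variable {n : ℕ} {M : Type*} [TopologicalSpace M] [ChartedSpace (EuclideanSpace ℝ (Fin n)) M]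
  {F : Type*} [NormedAddCommGroup F] [NormedSpace ℝ F] {V : M → Type*}
  [TopologicalSpace (TotalSpace F V)] [∀ x, TopologicalSpace (V x)] [FiberBundle F V]

variable (n F) in
/-- Smoothness of a section of the bundle `V`, whose model fibre is `F`. -/
abbrev SmoothSection (σ : Π x : M, V x) : Prop :=
  ContMDiff (𝓡 n) ((𝓡 n).prod 𝓘(ℝ, F)) ∞ (T% σ)

end Smooth

section Integrability

variable {n : ℕ} {M : Type*} [TopologicalSpace M] [ChartedSpace (EuclideanSpace ℝ (Fin n)) M]
  [IsManifold (𝓡 n) ∞ M]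
  [RiemannianBundle (fun x : M ↦ TangentSpace (𝓡 n) x)]
  [IsContMDiffRiemannianBundle (𝓡 n) ∞ (EuclideanSpace ℝ (Fin n))
    (fun x : M ↦ TangentSpace (𝓡 n) x)]
  [CompactSpace M] [MeasurableSpace M] [BorelSpace M]

theorem integrable_of_continuous {W : Type*} [NormedAddCommGroup W] {u : M → W}
    (hu : Continuous u) : Integrable u (riemannianVolume n M) :=
  hu.integrable_of_hasCompactSupport (.of_compactSpace u)

theorem SmoothSection.integrable_inner {F : Type*} [NormedAddCommGroup F] [NormedSpace ℝ F]
    {V : M → Type*} [TopologicalSpace (TotalSpace F V)] [∀ x, NormedAddCommGroup (V x)]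
    [∀ x, InnerProductSpace ℝ (V x)] [FiberBundle F V] [VectorBundle ℝ F V]
    [IsContMDiffRiemannianBundle (𝓡 n) ∞ F V]
    {σ τ : Π x : M, V x} (hσ : SmoothSection n F σ)
    (hτ : SmoothSection n F τ) :
    Integrable (fun x ↦ inner ℝ (σ x) (τ x)) (riemannianVolume n M) :=
  integrable_of_continuous (hσ.inner_bundle hτ).continuous

end Integrability

section Dirac

variable {𝕜 : Type*} [RCLike 𝕜]
  {n : ℕ} {M : Type*} [TopologicalSpace M] [ChartedSpace (EuclideanSpace ℝ (Fin n)) M]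
  [IsManifold (𝓡 n) ∞ M]
  [RiemannianBundle (fun x : M ↦ TangentSpace (𝓡 n) x)]
  [IsContMDiffRiemannianBundle (𝓡 n) ∞ (EuclideanSpace ℝ (Fin n))
    (fun x : M ↦ TangentSpace (𝓡 n) x)]
  {F : Type*} [NormedAddCommGroup F] [NormedSpace ℝ F] [FiniteDimensional ℝ F]
  {V : M → Type*} [TopologicalSpace (TotalSpace F V)]
  [∀ x, NormedAddCommGroup (V x)] [∀ x, InnerProductSpace ℝ (V x)]
  [∀ x, InnerProductSpace 𝕜 (V x)]
  [FiberBundle F V] [VectorBundle ℝ F V] [ContMDiffVectorBundle ∞ F V (𝓡 n)]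
  [IsContMDiffRiemannianBundle (𝓡 n) ∞ F V]
  {N : ℕ} {f : M → EuclideanSpace ℝ (Fin N)}

local notation "𝔼" => EuclideanSpace ℝ (Fin n)

namespace DiracBundle

variable (S : DiracBundle 𝕜 n F V) {X : Π x : M, TangentSpace (𝓡 n) x} {σ τ : Π x : M, V x}

/-- Clifford multiplication by tangent vectors, bundled as a bilinear map. -/
def cmulₗ (x : M) : TangentSpace (𝓡 n) x →ₗ[ℝ] V x →ₗ[ℝ] V x :=
  (S.cliffordModule x).toLinearMap.comp (CliffordAlgebra.ι (cliffordForm (n := n) x))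

theorem isCliffordAction_cmulₗ (x : M) : IsCliffordAction (S.cmulₗ x) := by
  intro v w s
  have polar_eq : QuadraticMap.polar (cliffordForm (n := n) x) v w = -2 * inner ℝ v w := by
    simp only [QuadraticMap.polar, cliffordForm, neg_apply,
      LinearMap.BilinMap.toQuadraticMap_apply, innerₗ_apply_apply, inner_add_left, inner_add_right,
      real_inner_comm v w]
    ring
  have action_eq := congrArg (fun z ↦ S.cliffordModule x z s)
    (CliffordAlgebra.ι_mul_ι_add_swap (Q := cliffordForm (n := n) x) v w)
  rw [polar_eq, map_add, map_mul, map_mul, AlgHom.commutes, Module.algebraMap_end_eq_smul_id]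
    at action_eq
  exact action_eq

theorem real_inner_cmulₗ (x : M) (v : TangentSpace (𝓡 n) x) (s t : V x) :
    inner ℝ (S.cmulₗ x v s) t = -inner ℝ s (S.cmulₗ x v t) := by
  have re_eq_zero := congrArg RCLike.re (S.clifford_skew x v s t)
  rw [map_add, ← real_inner_eq_re, ← real_inner_eq_re, map_zero] at re_eq_zero
  exact eq_neg_of_add_eq_zero_left re_eq_zero

theorem smooth_cmulₗ (hX : SmoothSection n 𝔼 X) (hσ : SmoothSection n F σ) :
    SmoothSection n F (fun x ↦ S.cmulₗ x (X x) (σ x)) :=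
  S.contMDiff_clifford ⟨X, hX⟩ ⟨σ, hσ⟩

theorem smooth_smul (S : DiracBundle 𝕜 n F V) (a : 𝕜) (hσ : SmoothSection n F σ) :
    SmoothSection n F (fun x ↦ a • σ x) :=
  S.contMDiff_smul a ⟨σ, hσ⟩

theorem contMDiff_conn_hom (hσ : SmoothSection n F σ) :
    ContMDiff (𝓡 n) ((𝓡 n).prod 𝓘(ℝ, 𝔼 →L[ℝ] F)) ∞
      (fun x ↦ TotalSpace.mk' (𝔼 →L[ℝ] F)
        (E := fun x : M ↦ TangentSpace (𝓡 n) x →L[ℝ] V x) x (S.conn σ x)) :=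
  contMDiffOn_univ.1 <|
    S.contMDiff_conn.contMDiff.contMDiff (σ := σ) (by simpa using! hσ.contMDiffOn)

theorem smooth_conn (hX : SmoothSection n 𝔼 X) (hσ : SmoothSection n F σ) :
    SmoothSection n F (fun x ↦ S.conn σ x (X x)) :=
  (S.contMDiff_conn_hom hσ).clm_bundle_apply hX

/-- A Levi-Civita connection for which Clifford multiplication satisfies the Leibniz rule. -/
def leviCivita : CovariantDerivative (𝓡 n) 𝔼 (fun x : M ↦ TangentSpace (𝓡 n) x) :=
  S.conn_clifford.choose

theorem isLeviCivita_leviCivita : IsLeviCivita S.leviCivita :=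
  S.conn_clifford.choose_spec.1

theorem conn_cmulₗ (hX : SmoothSection n 𝔼 X) (hσ : SmoothSection n F σ) (x : M)
    (v : TangentSpace (𝓡 n) x) :
    S.conn (fun y ↦ S.cmulₗ y (X y) (σ y)) x v =
      S.cmulₗ x (S.leviCivita X x v) (σ x) + S.cmulₗ x (X x) (S.conn σ x v) :=
  S.conn_clifford.choose_spec.2 ⟨X, hX⟩ ⟨σ, hσ⟩ x v

theorem conn_smul_apply {u : M → ℝ} (hu : ContMDiff (𝓡 n) 𝓘(ℝ) ∞ u) (hσ : SmoothSection n F σ)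
    (x : M) (v : TangentSpace (𝓡 n) x) :
    S.conn (fun y ↦ u y • σ y) x v = u x • S.conn σ x v + mvfderiv (𝓡 n) u x v • σ x :=
  congrArg (fun L ↦ L v) (S.conn.isCovariantDerivativeOnUniv.leibniz
    (hσ.mdifferentiable (by simp) x) (hu.mdifferentiable (by simp) x))

theorem conn_add (hσ : SmoothSection n F σ) (hτ : SmoothSection n F τ) (x : M)
    (v : TangentSpace (𝓡 n) x) :
    S.conn (fun y ↦ σ y + τ y) x v = S.conn σ x v + S.conn τ x v :=
  congrArg (fun L ↦ L v) (S.conn.isCovariantDerivativeOnUniv.add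
    (hσ.mdifferentiable (by simp) x) (hτ.mdifferentiable (by simp) x))

theorem mvfderiv_inner (hσ : SmoothSection n F σ) (hτ : SmoothSection n F τ) (x : M)
    (v : TangentSpace (𝓡 n) x) :
    mvfderiv (𝓡 n) (fun y ↦ inner ℝ (σ y) (τ y)) x v =
      inner ℝ (S.conn σ x v) (τ x) + inner ℝ (σ x) (S.conn τ x v) := by
  have compatible := S.conn_metric.mvfderiv_inner_eq (FiberBundle.extend 𝔼 v)
    (hσ.mdifferentiable (by simp) x) (hτ.mdifferentiable (by simp) x)
  simpa only [FiberBundle.extend_apply_self] using compatible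

theorem dirac_eq_sum (hf : IsIsometricImmersion (n := n) f) (σ : Π x : M, V x) (x : M) :
    S.dirac σ x = ∑ a, S.cmulₗ x (coordGrad f a x) (S.conn σ x (coordGrad f a x)) :=
  (hf.isParsevalFrame x).sum_orthonormalBasis_eq (stdOrthonormalBasis ℝ (TangentSpace (𝓡 n) x))
    ((S.cmulₗ x).compl₂ (S.conn σ x).toLinearMap)

theorem smooth_dirac (hf : IsIsometricImmersion (n := n) f) (hσ : SmoothSection n F σ) :
    SmoothSection n F (S.dirac σ) := by
  rw [funext (S.dirac_eq_sum hf σ)]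
  exact ContMDiff.sum_section fun a _ ↦
    S.smooth_cmulₗ (hf.contMDiff_coordGrad a) (S.smooth_conn (hf.contMDiff_coordGrad a) hσ)

theorem dirac_add (hσ : SmoothSection n F σ) (hτ : SmoothSection n F τ) (x : M) :
    S.dirac (fun y ↦ σ y + τ y) x = S.dirac σ x + S.dirac τ x := by
  simp only [dirac, S.conn_add hσ hτ, ← Finset.sum_add_distrib]
  exact Finset.sum_congr rfl fun i _ ↦ map_add (S.cmulₗ x _) _ _

theorem dirac_smul (a : 𝕜) (hσ : SmoothSection n F σ) (x : M) :
    S.dirac (fun y ↦ a • σ y) x = a • S.dirac σ x := by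
  simp only [dirac, Finset.smul_sum]
  exact Finset.sum_congr rfl fun i _ ↦
    (congrArg (S.cmul x _) (S.conn_smul a ⟨σ, hσ⟩ x _)).trans (S.clifford_smul ..)

theorem dirac_smul_fun {u : M → ℝ} (hu : ContMDiff (𝓡 n) 𝓘(ℝ) ∞ u) (hσ : SmoothSection n F σ)
    (x : M) :
    S.dirac (fun y ↦ u y • σ y) x = u x • S.dirac σ x + S.cmulₗ x (grad u x) (σ x) := by
  let e := stdOrthonormalBasis ℝ (TangentSpace (𝓡 n) x)
  have isParsevalFrame : IsParsevalFrame e := e.sum_repr'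
  have cmul_grad : S.cmulₗ x (grad u x) (σ x) =
      ∑ i, mvfderiv (𝓡 n) u x (e i) • S.cmulₗ x (e i) (σ x) := by
    simpa only [real_inner_comm, inner_grad] using!
      isParsevalFrame.map_eq_sum ((S.cmulₗ x).flip (σ x)) (grad u x)
  rw [cmul_grad]
  simp only [dirac, S.conn_smul_apply hu hσ, Finset.smul_sum, ← Finset.sum_add_distrib]
  exact Finset.sum_congr rfl fun i _ ↦ by
    change S.cmulₗ x _ _ = _ • S.cmulₗ x _ _ + _
    rw [map_add, map_smul, map_smul]

section Commutator

variable (f) in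
/-- The covariant derivative of `σ` along the gradient of the `a`-th coordinate function. -/
def coordConn (a : Fin N) (σ : Π x : M, V x) (x : M) : V x :=
  S.conn σ x (coordGrad f a x)

theorem smooth_coordConn (hf : IsIsometricImmersion (n := n) f) (a : Fin N)
    (hσ : SmoothSection n F σ) : SmoothSection n F (S.coordConn f a σ) :=
  S.smooth_conn (hf.contMDiff_coordGrad a) hσ

variable (f) in
/-- The commutator `[D², fₐ]σ = -2∇_{grad fₐ}σ - (Δfₐ)σ`, see `dirac_dirac_coord_smul`. -/
def coordCommutator (a : Fin N) (σ : Π x : M, V x) (x : M) : V x :=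
  -((2 : ℝ) • S.coordConn f a σ x + divergence S.leviCivita (coordGrad f a) x • σ x)

theorem isSecondFundamentalForm (hf : IsIsometricImmersion (n := n) f) (x : M) :
    IsSecondFundamentalForm (fun a ↦ coordGrad (n := n) f a x)
      (fun a ↦ (S.leviCivita (coordGrad f a) x).toLinearMap) :=
  S.isLeviCivita_leviCivita.isSecondFundamentalForm hf x

theorem smooth_coordCommutator (hf : IsIsometricImmersion (n := n) f) (a : Fin N)
    (hσ : SmoothSection n F σ) : SmoothSection n F (S.coordCommutator f a σ) :=
  ((S.smooth_coordConn hf a hσ).const_smul_section.add_section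
    ((S.isLeviCivita_leviCivita.contMDiff_divergence_coordGrad hf a).smul_section hσ)).neg_section

theorem dirac_cmulₗ_coordGrad (hf : IsIsometricImmersion (n := n) f) (hσ : SmoothSection n F σ)
    (a : Fin N) (x : M) :
    S.dirac (fun y ↦ S.cmulₗ y (coordGrad f a y) (σ y)) x =
      S.coordCommutator f a σ x - S.cmulₗ x (coordGrad f a x) (S.dirac σ x) := by
  let E (b : Fin N) : TangentSpace (𝓡 n) x := coordGrad f b x
  have hessian_term :
      ∑ b, S.cmulₗ x (E b) (S.cmulₗ x (S.leviCivita (coordGrad f a) x (E b)) (σ x)) =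
      -divergence S.leviCivita (coordGrad f a) x • σ x :=
    (S.isCliffordAction_cmulₗ x).sum_clifford_symmetric (hf.isParsevalFrame x)
      ((S.isSecondFundamentalForm hf x).symm a) (σ x)
  have anticomm (b) : S.cmulₗ x (E b) (S.cmulₗ x (E a) (S.conn σ x (E b))) =
      -S.cmulₗ x (E a) (S.cmulₗ x (E b) (S.conn σ x (E b))) -
        (2 : ℝ) • inner ℝ (E b) (E a) • S.conn σ x (E b) := by
    linear_combination (norm := module) S.isCliffordAction_cmulₗ x (E b) (E a) (S.conn σ x (E b))
  have contract : ∑ b, inner ℝ (E b) (E a) • S.conn σ x (E b) = S.coordConn f a σ x :=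
    ((hf.isParsevalFrame x).map_eq_sum (S.conn σ x).toLinearMap (E a)).symm
  calc S.dirac (fun y ↦ S.cmulₗ y (coordGrad f a y) (σ y)) x
      = ∑ b, (S.cmulₗ x (E b) (S.cmulₗ x (S.leviCivita (coordGrad f a) x (E b)) (σ x)) +
          S.cmulₗ x (E b) (S.cmulₗ x (E a) (S.conn σ x (E b)))) := by
        simp only [S.dirac_eq_sum hf, S.conn_cmulₗ (hf.contMDiff_coordGrad a) hσ, map_add, E]
    _ = -divergence S.leviCivita (coordGrad f a) x • σ x -
          S.cmulₗ x (E a) (S.dirac σ x) - (2 : ℝ) • S.coordConn f a σ x := by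
        simp only [Finset.sum_add_distrib, hessian_term, anticomm, Finset.sum_sub_distrib,
          Finset.sum_neg_distrib, ← Finset.smul_sum, contract, ← map_sum, S.dirac_eq_sum hf, E]
        abel
    _ = S.coordCommutator f a σ x - S.cmulₗ x (E a) (S.dirac σ x) := by
        rw [coordCommutator]
        module

theorem dirac_dirac_coord_smul (hf : IsIsometricImmersion (n := n) f)
    (hσ : SmoothSection n F σ) (a : Fin N) (x : M) :
    S.dirac (S.dirac (fun y ↦ f y a • σ y)) x =
      f x a • S.dirac (S.dirac σ) x + S.coordCommutator f a σ x := by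
  have hfa := hf.contMDiff_apply a
  have hD := S.smooth_dirac hf hσ
  calc S.dirac (S.dirac (fun y ↦ f y a • σ y)) x
      = S.dirac (fun y ↦ f y a • S.dirac σ y + S.cmulₗ y (coordGrad f a y) (σ y)) x := by
        rw [funext (S.dirac_smul_fun hfa hσ)]
        rfl
    _ = f x a • S.dirac (S.dirac σ) x + S.cmulₗ x (coordGrad f a x) (S.dirac σ x) +
          (S.coordCommutator f a σ x - S.cmulₗ x (coordGrad f a x) (S.dirac σ x)) := by
        rw [S.dirac_add (σ := fun y ↦ f y a • S.dirac σ y) (hfa.smul_section hD)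
            (S.smooth_cmulₗ (hf.contMDiff_coordGrad a) hσ),
          S.dirac_smul_fun hfa hD, S.dirac_cmulₗ_coordGrad hf hσ]
        rfl
    _ = f x a • S.dirac (S.dirac σ) x + S.coordCommutator f a σ x := by abel

theorem sum_norm_coordCommutator_sq (hf : IsIsometricImmersion (n := n) f) (σ : Π x : M, V x)
    (x : M) :
    ∑ a, ‖S.coordCommutator f a σ x‖ ^ 2 = 4 * ∑ a, ‖S.coordConn f a σ x‖ ^ 2 +
      (∑ a, divergence S.leviCivita (coordGrad (n := n) f a) x ^ 2) * ‖σ x‖ ^ 2 := by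
  let Δ (a : Fin N) : ℝ := divergence S.leviCivita (coordGrad f a) x
  have cross_terms : ∑ a, Δ a * inner ℝ (S.coordConn f a σ x) (σ x) = 0 := by
    have mean_curvature_normal : ∑ a, Δ a • coordGrad (n := n) f a x = 0 :=
      (S.isSecondFundamentalForm hf x).sum_trace_smul
    simp only [coordConn, ← real_inner_smul_left, ← map_smul, ← sum_inner, ← map_sum,
      mean_curvature_normal, map_zero, inner_zero_left]
  have norm_sq (a) : ‖S.coordCommutator f a σ x‖ ^ 2 = 4 * ‖S.coordConn f a σ x‖ ^ 2 +
      Δ a ^ 2 * ‖σ x‖ ^ 2 + 4 * (Δ a * inner ℝ (S.coordConn f a σ x) (σ x)) := by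
    rw [coordCommutator, norm_neg, norm_add_sq_real, norm_smul, norm_smul, mul_pow, mul_pow,
      real_inner_smul_left, real_inner_smul_right, Real.norm_eq_abs, Real.norm_eq_abs, sq_abs,
      sq_abs]
    ring
  simp only [norm_sq, Finset.sum_add_distrib, ← Finset.mul_sum, cross_terms, mul_zero, add_zero,
    Finset.sum_mul, Δ]

end Commutator

section Curvature

theorem mdifferentiableAt_conn (hσ : SmoothSection n F σ) {X : Π x : M, TangentSpace (𝓡 n) x}
    {x : M} (hX : MDifferentiableAt (𝓡 n) ((𝓡 n).prod 𝓘(ℝ, 𝔼)) (T% X) x) :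
    MDifferentiableAt (𝓡 n) ((𝓡 n).prod 𝓘(ℝ, F)) (T% (fun y ↦ S.conn σ y (X y))) x :=
  ((S.contMDiff_conn_hom hσ).mdifferentiable (by simp) x).clm_bundle_apply hX

theorem curvature_swap (X Y : Π x : M, TangentSpace (𝓡 n) x) (x : M) :
    S.curvature X Y σ x = -S.curvature Y X σ x := by
  rw [curvature, curvature, VectorField.mlieBracket_swap, Pi.neg_apply, map_neg]
  abel

theorem tensorialAt_curvature_right (hσ : SmoothSection n F σ)
    (X : Π x : M, TangentSpace (𝓡 n) x) (x : M) :
    TensorialAt (𝓡 n) 𝔼 (fun Y ↦ S.curvature X Y σ x) x where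
  smul {u Y} hu hY := by
    have leibniz : S.conn (fun y ↦ S.conn σ y ((u • Y) y)) x (X x) =
        u x • S.conn (fun y ↦ S.conn σ y (Y y)) x (X x) +
          mvfderiv (𝓡 n) u x (X x) • S.conn σ x (Y x) := by
      simp only [Pi.smul_apply', map_smul]
      exact congrArg (fun L ↦ L (X x)) <|
        S.conn.isCovariantDerivativeOnUniv.leibniz (S.mdifferentiableAt_conn hσ hY) hu
    simp only [curvature]
    rw [leibniz, VectorField.mlieBracket_smul_right hu hY, map_add, map_smul, map_smul,
      Pi.smul_apply', map_smul]
    module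
  add {Y Y'} hY hY' := by
    have additive : S.conn (fun y ↦ S.conn σ y ((Y + Y') y)) x (X x) =
        S.conn (fun y ↦ S.conn σ y (Y y)) x (X x) +
          S.conn (fun y ↦ S.conn σ y (Y' y)) x (X x) := by
      simp only [Pi.add_apply, map_add]
      exact congrArg (fun L ↦ L (X x)) <| S.conn.isCovariantDerivativeOnUniv.add
        (S.mdifferentiableAt_conn hσ hY) (S.mdifferentiableAt_conn hσ hY')
    simp only [curvature]
    rw [additive, VectorField.mlieBracket_add_right hY hY', map_add, Pi.add_apply, map_add]
    abel

theorem tensorialAt_curvature_left (hσ : SmoothSection n F σ)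
    (Y : Π x : M, TangentSpace (𝓡 n) x) (x : M) :
    TensorialAt (𝓡 n) 𝔼 (fun X ↦ S.curvature X Y σ x) x where
  smul {u X} hu hX := by
    rw [S.curvature_swap, (S.tensorialAt_curvature_right hσ Y x).smul hu hX, S.curvature_swap X,
      smul_neg]
  add {X X'} hX hX' := by
    rw [S.curvature_swap, (S.tensorialAt_curvature_right hσ Y x).add hX hX', S.curvature_swap X,
      S.curvature_swap X', neg_add]

/-- The curvature `(v, w) ↦ R(v, w)σ` at `x`, as a bilinear map on the tangent space. -/
def curvatureTensor (hσ : SmoothSection n F σ) (x : M) :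
    TangentSpace (𝓡 n) x →ₗ[ℝ] TangentSpace (𝓡 n) x →ₗ[ℝ] V x :=
  (ContinuousLinearMap.coeLM ℝ).comp (TensorialAt.mkHom₂ (fun X Y ↦ S.curvature X Y σ x) x
    (fun Y _ ↦ S.tensorialAt_curvature_left hσ Y x)
    (fun X _ ↦ S.tensorialAt_curvature_right hσ X x)).toLinearMap

theorem curvatureTensor_apply (hσ : SmoothSection n F σ) {X Y : Π x : M, TangentSpace (𝓡 n) x}
    {x : M} (hX : MDifferentiableAt (𝓡 n) ((𝓡 n).prod 𝓘(ℝ, 𝔼)) (T% X) x)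
    (hY : MDifferentiableAt (𝓡 n) ((𝓡 n).prod 𝓘(ℝ, 𝔼)) (T% Y) x) :
    S.curvatureTensor hσ x (X x) (Y x) = S.curvature X Y σ x :=
  TensorialAt.mkHom₂_apply (fun Y _ ↦ S.tensorialAt_curvature_left hσ Y x)
    (fun X _ ↦ S.tensorialAt_curvature_right hσ X x) hX hY

theorem curvatureTensor_eq_extend (hσ : SmoothSection n F σ) (x : M)
    (v w : TangentSpace (𝓡 n) x) :
    S.curvatureTensor hσ x v w =
      S.curvature (FiberBundle.extend 𝔼 v) (FiberBundle.extend 𝔼 w) σ x := by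
  rw [← S.curvatureTensor_apply hσ (FiberBundle.mdifferentiableAt_extend (𝓡 n) 𝔼 v)
    (FiberBundle.mdifferentiableAt_extend (𝓡 n) 𝔼 w), FiberBundle.extend_apply_self,
    FiberBundle.extend_apply_self]

theorem isAlt_curvatureTensor (hσ : SmoothSection n F σ) (x : M) :
    (S.curvatureTensor hσ x).IsAlt := fun v ↦ by
  rw [curvatureTensor_eq_extend, curvature, VectorField.mlieBracket_self, Pi.zero_apply, map_zero,
    sub_self, sub_zero]

end Curvature

section Bochner

variable (f) in
/-- The connection Laplacian `-∇*∇σ`. As `∑ₐ ∇_{Eₐ}Eₐ = 0` for the coordinate gradients `Eₐ`, it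
has no first order term in this frame. -/
def connLap (σ : Π x : M, V x) (x : M) : V x :=
  ∑ a, S.coordConn f a (S.coordConn f a σ) x

theorem smooth_connLap (hf : IsIsometricImmersion (n := n) f) (hσ : SmoothSection n F σ) :
    SmoothSection n F (S.connLap f σ) :=
  ContMDiff.sum_section fun a _ ↦ S.smooth_coordConn hf a (S.smooth_coordConn hf a hσ)

theorem two_smul_bochnerCurvature (hf : IsIsometricImmersion (n := n) f)
    (hσ : SmoothSection n F σ) (x : M) :
    (2 : ℝ) • S.bochnerCurvature σ x = ∑ a, ∑ b, S.cmulₗ x (coordGrad f a x)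
      (S.cmulₗ x (coordGrad f b x)
        (S.curvatureTensor hσ x (coordGrad f a x) (coordGrad f b x))) := by
  let e := stdOrthonormalBasis ℝ (TangentSpace (𝓡 n) x)
  have bochner_eq : S.bochnerCurvature σ x = ∑ i, ∑ j ∈ Finset.Ioi i,
      S.cmulₗ x (e i) (S.cmulₗ x (e j) (S.curvatureTensor hσ x (e i) (e j))) := by
    simp only [curvatureTensor_eq_extend]
    rfl
  rw [bochner_eq]
  exact (S.isCliffordAction_cmulₗ x).two_smul_sum_Ioi (hf.isParsevalFrame x)
    e (S.isAlt_curvatureTensor hσ x)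

theorem coordConn_coordConn_sub (hf : IsIsometricImmersion (n := n) f) (hσ : SmoothSection n F σ)
    (a b : Fin N) (x : M) :
    S.coordConn f a (S.coordConn f b σ) x - S.coordConn f b (S.coordConn f a σ) x =
      S.curvatureTensor hσ x (coordGrad f a x) (coordGrad f b x) +
        (S.conn σ x (S.leviCivita (coordGrad f b) x (coordGrad f a x)) -
          S.conn σ x (S.leviCivita (coordGrad f a) x (coordGrad f b x))) := by
  have hd (a) := hf.mdifferentiableAt_coordGrad a x
  have torsion_free :=
    S.leviCivita.torsion_eq_zero_iff.1 S.isLeviCivita_leviCivita.1 (hd a) (hd b)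
  rw [S.curvatureTensor_apply hσ (hd a) (hd b), curvature, ← map_sub, torsion_free, sub_add_cancel]
  rfl

theorem dirac_dirac_eq_sum_sum (hf : IsIsometricImmersion (n := n) f) (hσ : SmoothSection n F σ)
    (x : M) :
    S.dirac (S.dirac σ) x = ∑ a, ∑ b, S.cmulₗ x (coordGrad f a x)
      (S.cmulₗ x (coordGrad f b x) (S.coordConn f a (S.coordConn f b σ) x)) := by
  let E (a : Fin N) : TangentSpace (𝓡 n) x := coordGrad f a x
  have hessian_terms : ∑ a, ∑ b, S.cmulₗ x (E a)
      (S.cmulₗ x (S.leviCivita (coordGrad f b) x (E a)) (S.coordConn f b σ x)) = 0 := by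
    have mean_curvature_normal :
        ∑ b, divergence S.leviCivita (coordGrad (n := n) f b) x • coordGrad (n := n) f b x = 0 :=
      (S.isSecondFundamentalForm hf x).sum_trace_smul
    rw [Finset.sum_comm]
    refine (Finset.sum_congr rfl fun b _ ↦
      (S.isCliffordAction_cmulₗ x).sum_clifford_symmetric (hf.isParsevalFrame x)
        ((S.isSecondFundamentalForm hf x).symm b) (S.coordConn f b σ x)).trans ?_
    change ∑ b, -divergence S.leviCivita (coordGrad f b) x • S.conn σ x (coordGrad f b x) = 0
    simp only [neg_smul, Finset.sum_neg_distrib, ← map_smul, ← map_sum, mean_curvature_normal,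
      map_zero, neg_zero]
  have smooth_term (b) : SmoothSection n F (fun y ↦
      S.cmulₗ y (coordGrad f b y) (S.coordConn f b σ y)) :=
    S.smooth_cmulₗ (hf.contMDiff_coordGrad b) (S.smooth_coordConn hf b hσ)
  calc S.dirac (S.dirac σ) x
      = ∑ a, S.cmulₗ x (E a) (∑ b, S.conn (fun y ↦ S.cmulₗ y (coordGrad f b y)
          (S.coordConn f b σ y)) x (E a)) := by
        have dirac_eq : S.dirac σ = ∑ b, fun y ↦ S.cmulₗ y (coordGrad f b y)
            (S.coordConn f b σ y) := by
          rw [Finset.sum_fn, funext (S.dirac_eq_sum hf σ)]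
          rfl
        rw [S.dirac_eq_sum hf, dirac_eq, conn_sum _ _ fun b _ ↦
          (smooth_term b).mdifferentiable (by simp) x]
        simp only [_root_.sum_apply, E]
    _ = _ := by
        simp only [S.conn_cmulₗ (hf.contMDiff_coordGrad _) (S.smooth_coordConn hf _ hσ), map_sum,
          map_add, Finset.sum_add_distrib]
        rw [hessian_terms, zero_add]
        rfl

theorem two_smul_bochnerCurvature_eq_sub (hf : IsIsometricImmersion (n := n) f)
    (hσ : SmoothSection n F σ) (x : M) :
    (2 : ℝ) • S.bochnerCurvature σ x = S.dirac (S.dirac σ) x -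
      ∑ a, ∑ b, S.cmulₗ x (coordGrad f a x)
        (S.cmulₗ x (coordGrad f b x) (S.coordConn f b (S.coordConn f a σ) x)) := by
  let E (a : Fin N) : TangentSpace (𝓡 n) x := coordGrad f a x
  let H (a : Fin N) := (S.leviCivita (coordGrad f a) x).toLinearMap
  let T := (S.conn σ x).toLinearMap
  have second_form : IsSecondFundamentalForm E H := S.isSecondFundamentalForm hf x
  have first_order : ∑ a, ∑ b, S.cmulₗ x (E a) (S.cmulₗ x (E b) (T (H b (E a)))) = 0 :=
    Finset.sum_eq_zero fun a _ ↦ by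
      have inner_sum : ∑ b, S.cmulₗ x (E b) (T (H b (E a))) = 0 :=
        second_form.sum_apply_apply_eq_zero ((S.cmulₗ x).compl₂ T) (E a)
      rw [← map_sum, inner_sum, map_zero]
  have first_order_swap : ∑ a, ∑ b, S.cmulₗ x (E a) (S.cmulₗ x (E b) (T (H a (E b)))) = 0 := by
    have swap := (S.isCliffordAction_cmulₗ x).sum_sum_swap second_form.frame fun a ↦ T.comp (H a)
    simp only [LinearMap.comp_apply] at swap
    rw [swap, first_order, ← map_sum, second_form.sum_apply_self, map_zero, smul_zero, neg_zero,
      sub_zero]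
  have commutator (a b) : S.curvatureTensor hσ x (E a) (E b) =
      S.coordConn f a (S.coordConn f b σ) x - S.coordConn f b (S.coordConn f a σ) x -
        (T (H b (E a)) - T (H a (E b))) :=
    eq_sub_of_add_eq (S.coordConn_coordConn_sub hf hσ a b x).symm
  rw [S.two_smul_bochnerCurvature hf hσ, S.dirac_dirac_eq_sum_sum hf hσ]
  simp only [E] at commutator first_order first_order_swap
  simp only [commutator, map_sub, Finset.sum_sub_distrib, first_order, first_order_swap, sub_zero]

theorem dirac_dirac_eq_bochnerCurvature_sub_connLap (hf : IsIsometricImmersion (n := n) f)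
    (hσ : SmoothSection n F σ) (x : M) :
    S.dirac (S.dirac σ) x = S.bochnerCurvature σ x - S.connLap f σ x := by
  have swap : ∑ a, ∑ b, S.cmulₗ x (coordGrad f a x)
        (S.cmulₗ x (coordGrad f b x) (S.coordConn f b (S.coordConn f a σ) x)) =
      -S.dirac (S.dirac σ) x - (2 : ℝ) • S.connLap f σ x := by
    rw [S.dirac_dirac_eq_sum_sum hf hσ]
    exact (S.isCliffordAction_cmulₗ x).sum_sum_swap (hf.isParsevalFrame x)
      fun a ↦ (S.conn (S.coordConn f a σ) x).toLinearMap
  have twice := S.two_smul_bochnerCurvature_eq_sub hf hσ x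
  refine smul_right_injective _ (two_ne_zero (α := ℝ)) ?_
  simp only
  rw [smul_sub, twice, swap]
  module

theorem smooth_bochnerCurvature (hf : IsIsometricImmersion (n := n) f)
    (hσ : SmoothSection n F σ) : SmoothSection n F (S.bochnerCurvature σ) := by
  have eq_add : S.bochnerCurvature σ = S.dirac (S.dirac σ) + S.connLap f σ := by
    ext1 x
    rw [Pi.add_apply, S.dirac_dirac_eq_bochnerCurvature_sub_connLap hf hσ, sub_add_cancel]
  rw [eq_add]
  exact (S.smooth_dirac hf (S.smooth_dirac hf hσ)).add_section (S.smooth_connLap hf hσ)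

end Bochner

theorem sum_mul_divergence_eq_zero (hf : IsIsometricImmersion (n := n) f) (x : M)
    (L : TangentSpace (𝓡 n) x →ₗ[ℝ] ℝ) :
    ∑ a, L (coordGrad f a x) * divergence S.leviCivita (coordGrad (n := n) f a) x = 0 := by
  have mean_curvature_normal :
      ∑ a, divergence S.leviCivita (coordGrad (n := n) f a) x • coordGrad (n := n) f a x = 0 :=
    (S.isSecondFundamentalForm hf x).sum_trace_smul
  simpa only [map_sum, map_smul, smul_eq_mul, mul_comm, map_zero] using
    congrArg L mean_curvature_normal

theorem sum_mvfderiv_inner_cmulₗ (hf : IsIsometricImmersion (n := n) f)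
    (hσ : SmoothSection n F σ) (hτ : SmoothSection n F τ) (x : M) :
    ∑ a, mvfderiv (𝓡 n) (fun y ↦ inner ℝ (σ y) (S.cmulₗ y (coordGrad f a y) (τ y))) x
        (coordGrad f a x) = inner ℝ (σ x) (S.dirac τ x) - inner ℝ (S.dirac σ x) (τ x) := by
  have frame_geodesic : ∑ a, S.leviCivita (coordGrad f a) x (coordGrad f a x) = 0 :=
    (S.isSecondFundamentalForm hf x).sum_apply_self
  have derivative_term :
      ∑ a, S.cmulₗ x (S.leviCivita (coordGrad f a) x (coordGrad f a x)) (τ x) = 0 := by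
    rw [← LinearMap.sum_apply, ← map_sum, frame_geodesic, map_zero, LinearMap.zero_apply]
  simp only [S.mvfderiv_inner hσ (S.smooth_cmulₗ (hf.contMDiff_coordGrad _) hτ),
    S.conn_cmulₗ (hf.contMDiff_coordGrad _) hτ, inner_add_right, Finset.sum_add_distrib,
    ← inner_sum, derivative_term, inner_zero_right, S.dirac_eq_sum hf, sum_inner,
    S.real_inner_cmulₗ, Finset.sum_neg_distrib]
  ring

/-- The `𝕜`-vector space of smooth sections, a pre-Hilbert space for the `L²` inner product. Scalar
multiplication by `𝕜` preserves smoothness because of the structure `S`, on which the type therefore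
depends. -/
def SmoothSections (_S : DiracBundle 𝕜 n F V) : Type _ := Cₛ^∞⟮𝓡 n; F, V⟯

/-- A smooth section as an element of the pre-Hilbert space `S.SmoothSections`. -/
def ofSection (σ : Cₛ^∞⟮𝓡 n; F, V⟯) : S.SmoothSections := σ

namespace SmoothSections

variable {S}

instance : AddCommGroup S.SmoothSections := inferInstanceAs (AddCommGroup Cₛ^∞⟮𝓡 n; F, V⟯)

instance : CoeFun S.SmoothSections fun _ ↦ Π x : M, V x := ⟨ContMDiffSection.toFun⟩

theorem smooth (σ : S.SmoothSections) : SmoothSection n F σ := ContMDiffSection.contMDiff σ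

instance : SMul 𝕜 S.SmoothSections := ⟨fun c σ ↦ ⟨fun x ↦ c • σ x, S.smooth_smul c σ.smooth⟩⟩

instance : Module 𝕜 S.SmoothSections :=
  Function.Injective.module 𝕜 (ContMDiffSection.coeAddHom (𝓡 n) F ∞ V)
    ContMDiffSection.coe_injective fun _ _ ↦ rfl

@[ext]
theorem ext {σ τ : S.SmoothSections} (h : ∀ x, σ x = τ x) : σ = τ := ContMDiffSection.ext h

end SmoothSections

/-- The Dirac operator on smooth sections. -/
def diracₗ (hf : IsIsometricImmersion (n := n) f) : S.SmoothSections →ₗ[𝕜] S.SmoothSections where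
  toFun σ := ⟨S.dirac σ, S.smooth_dirac hf σ.smooth⟩
  map_add' σ τ := SmoothSections.ext (S.dirac_add σ.smooth τ.smooth)
  map_smul' a σ := SmoothSections.ext (S.dirac_smul a σ.smooth)

/-- Multiplication of smooth sections by the `a`-th coordinate function. -/
def coordMul (hf : IsIsometricImmersion (n := n) f) (a : Fin N) :
    S.SmoothSections →ₗ[𝕜] S.SmoothSections where
  toFun σ := ⟨fun x ↦ f x a • σ x, (hf.contMDiff_apply a).smul_section σ.smooth⟩
  map_add' σ τ := SmoothSections.ext fun x ↦ smul_add (f x a) (σ x) (τ x)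
  map_smul' c σ := SmoothSections.ext fun x ↦ smul_comm (f x a) c (σ x)

theorem lie_diracₗ_sq_coordMul_apply (hf : IsIsometricImmersion (n := n) f) (a : Fin N)
    (σ : S.SmoothSections) (x : M) :
    ⁅S.diracₗ hf ^ 2, S.coordMul hf a⁆ σ x = S.coordCommutator f a σ x :=
  sub_eq_of_eq_add' (S.dirac_dirac_coord_smul hf σ.smooth a x)

theorem smooth_meanCurvature_sq_smul (S : DiracBundle 𝕜 n F V)
    (hf : IsIsometricImmersion (n := n) f) (hn : n ≠ 0)
    {σ : Π x : M, V x} (hσ : SmoothSection n F σ) :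
    SmoothSection n F fun x ↦ meanCurvature (n := n) f x ^ 2 • σ x :=
  (S.isLeviCivita_leviCivita.contMDiff_meanCurvature_sq hf hn).smul_section hσ

end DiracBundle

variable [MeasurableSpace M]

theorem IsSpectralResolution.pairing_self {S : DiracBundle 𝕜 n F V} {lam : ℕ → ℝ}
    {φ : ℕ → Cₛ^∞⟮𝓡 n; F, V⟯} (hφ : IsSpectralResolution S lam φ) (i : ℕ) :
    pairing 𝕜 n (φ i) (φ i) = 1 := by
  rw [pairing, hφ.orthonormal, if_pos rfl, RCLike.one_re]

theorem IsSpectralResolution.pairing_dirac_dirac {S : DiracBundle 𝕜 n F V} {lam : ℕ → ℝ}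
    {φ : ℕ → Cₛ^∞⟮𝓡 n; F, V⟯} (hφ : IsSpectralResolution S lam φ) (i : ℕ) :
    pairing 𝕜 n (S.dirac (S.dirac (φ i))) (φ i) = lam i := by
  have l2Inner_dirac_dirac : l2Inner 𝕜 n (S.dirac (S.dirac (φ i))) (φ i) =
      (lam i : 𝕜) * l2Inner 𝕜 n (φ i) (φ i) := by
    rw [funext (hφ.eigen i), l2Inner, l2Inner, ← integral_const_mul]
    simp only [inner_real_smul_left]
  rw [pairing, l2Inner_dirac_dirac, RCLike.re_ofReal_mul, ← pairing, hφ.pairing_self, mul_one]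

variable [CompactSpace M] [BorelSpace M] {S : DiracBundle 𝕜 n F V}

namespace DiracBundle

variable {σ τ : Π x : M, V x}

theorem integrable_inner (S : DiracBundle 𝕜 n F V) (hσ : SmoothSection n F σ)
    (hτ : SmoothSection n F τ) :
    Integrable (fun x ↦ inner 𝕜 (σ x) (τ x)) (riemannianVolume n M) := by
  simp only [inner_eq_real_inner_add (𝕜 := 𝕜)]
  exact (SmoothSection.integrable_inner hσ hτ).ofReal.add
    ((SmoothSection.integrable_inner (S.smooth_smul _ hσ) hτ).ofReal.mul_const _)

theorem pairing_eq_integral (S : DiracBundle 𝕜 n F V) (hσ : SmoothSection n F σ)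
    (hτ : SmoothSection n F τ) :
    pairing 𝕜 n σ τ = ∫ x, inner ℝ (σ x) (τ x) ∂(riemannianVolume n M) := by
  rw [pairing, l2Inner, ← integral_re (S.integrable_inner hσ hτ)]
  simp only [real_inner_eq_re 𝕜]

theorem sum_pairing_eq_integral (S : DiracBundle 𝕜 n F V) {ι : Type*} (s : Finset ι)
    {σ τ : ι → Π x : M, V x}
    (hσ : ∀ i, SmoothSection n F (σ i)) (hτ : ∀ i, SmoothSection n F (τ i)) :
    ∑ i ∈ s, pairing 𝕜 n (σ i) (τ i) =
      ∫ x, ∑ i ∈ s, inner ℝ (σ i x) (τ i x) ∂(riemannianVolume n M) := by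
  rw [integral_finsetSum _ fun i _ ↦ SmoothSection.integrable_inner (hσ i) (hτ i)]
  exact Finset.sum_congr rfl fun i _ ↦ S.pairing_eq_integral (hσ i) (hτ i)

end DiracBundle

namespace DiracBundle.SmoothSections

instance : PreInnerProductSpace.Core 𝕜 S.SmoothSections where
  inner σ τ := l2Inner 𝕜 n σ τ
  conj_inner_symm σ τ := by
    rw [l2Inner, l2Inner, ← integral_conj]
    simp only [inner_conj_symm]
  re_inner_nonneg σ := by
    rw [l2Inner, ← integral_re (S.integrable_inner σ.smooth σ.smooth)]
    exact integral_nonneg fun x ↦ inner_self_nonneg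
  add_left σ τ ρ := by
    rw [l2Inner, l2Inner, l2Inner, ← integral_add (S.integrable_inner σ.smooth ρ.smooth)
      (S.integrable_inner τ.smooth ρ.smooth)]
    exact integral_congr_ae (.of_forall fun x ↦ inner_add_left _ _ _)
  smul_left σ τ c := by
    rw [l2Inner, l2Inner, ← integral_const_mul]
    exact integral_congr_ae (.of_forall fun x ↦ inner_smul_left _ _ _)

instance : SeminormedAddCommGroup S.SmoothSections :=
  InnerProductSpace.Core.toSeminormedAddCommGroup (𝕜 := 𝕜)

instance : InnerProductSpace 𝕜 S.SmoothSections :=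
  InnerProductSpace.ofCore inferInstance

theorem norm_sq_eq_pairing (σ : S.SmoothSections) : ‖σ‖ ^ 2 = pairing 𝕜 n σ σ :=
  (inner_self_eq_norm_sq (𝕜 := 𝕜) σ).symm

end DiracBundle.SmoothSections

theorem IsSpectralResolution.dense_span {lam : ℕ → ℝ} {φ : ℕ → Cₛ^∞⟮𝓡 n; F, V⟯}
    (hφ : IsSpectralResolution S lam φ) :
    Dense (Submodule.span 𝕜 (Set.range fun i ↦ S.ofSection (φ i)) : Set S.SmoothSections) := by
  refine Metric.dense_iff.2 fun σ r hr ↦ ?_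
  obtain ⟨s, b, hb⟩ := hφ.complete σ (r ^ 2) (by positivity)
  refine ⟨∑ j ∈ s, b j • S.ofSection (φ j), ?_, Submodule.sum_mem _ fun j _ ↦
    Submodule.smul_mem _ _ (Submodule.subset_span ⟨j, rfl⟩)⟩
  have sub_sum_apply (x : M) :
      (σ - ∑ j ∈ s, b j • S.ofSection (φ j)) x = σ x - ∑ j ∈ s, b j • φ j x := by
    let eval : S.SmoothSections →ₗ[𝕜] V x :=
      { toFun := fun τ ↦ τ x, map_add' := fun _ _ ↦ rfl, map_smul' := fun _ _ ↦ rfl }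
    exact (map_sub eval _ _).trans
      (congrArg (σ x - ·) ((map_sum eval _ s).trans (Finset.sum_congr rfl fun _ _ ↦ rfl)))
  rw [Metric.mem_ball, dist_comm, dist_eq_norm]
  refine lt_of_pow_lt_pow_left₀ 2 hr.le ?_
  rw [DiracBundle.SmoothSections.norm_sq_eq_pairing, S.pairing_eq_integral
    (DiracBundle.SmoothSections.smooth _) (DiracBundle.SmoothSections.smooth _)]
  simp only [sub_sum_apply, real_inner_self_eq_norm_sq]
  exact hb

namespace DiracBundle

variable (S) {σ τ : Π x : M, V x}

theorem isSymmetric_coordMul (hf : IsIsometricImmersion (n := n) f) (a : Fin N) :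
    (S.coordMul hf a).IsSymmetric := fun σ τ ↦
  integral_congr_ae <| .of_forall fun x ↦
    (inner_real_smul_left (f x a) (σ x) (τ x)).trans (inner_real_smul_right ..).symm

theorem sum_pairing_norm_coordGrad_sq (S : DiracBundle 𝕜 n F V)
    (hf : IsIsometricImmersion (n := n) f) {σ : Π x : M, V x} (hσ : SmoothSection n F σ) :
    ∑ a, pairing 𝕜 n (fun x ↦ ‖coordGrad (n := n) f a x‖ ^ 2 • σ x) σ = n * pairing 𝕜 n σ σ := by
  have smooth_norm_sq_smul (a : Fin N) :
      SmoothSection n F fun x ↦ ‖coordGrad (n := n) f a x‖ ^ 2 • σ x := by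
    simp only [← real_inner_self_eq_norm_sq]
    exact ((hf.contMDiff_coordGrad a).inner_bundle (hf.contMDiff_coordGrad a)).smul_section hσ
  rw [S.sum_pairing_eq_integral _ smooth_norm_sq_smul fun _ ↦ hσ, S.pairing_eq_integral hσ hσ,
    ← integral_const_mul]
  simp only [real_inner_smul_left, ← Finset.sum_mul, hf.sum_norm_coordGrad_sq]

theorem pairing_meanCurvature_sq_smul_le (S : DiracBundle 𝕜 n F V)
    (hf : IsIsometricImmersion (n := n) f) (hn : n ≠ 0)
    {σ : Π x : M, V x} (hσ : SmoothSection n F σ) :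
    pairing 𝕜 n (fun x ↦ meanCurvature (n := n) f x ^ 2 • σ x) σ ≤
      (⨆ x : M, meanCurvature (n := n) f x ^ 2) * pairing 𝕜 n σ σ := by
  have bddAbove : BddAbove (Set.range fun x : M ↦ meanCurvature (n := n) f x ^ 2) :=
    (isCompact_range
      (S.isLeviCivita_leviCivita.contMDiff_meanCurvature_sq hf hn).continuous).bddAbove
  have hHσ := S.smooth_meanCurvature_sq_smul hf hn hσ
  rw [S.pairing_eq_integral hσ hσ, S.pairing_eq_integral hHσ hσ, ← integral_const_mul]
  refine integral_mono (SmoothSection.integrable_inner hHσ hσ)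
    ((SmoothSection.integrable_inner hσ hσ).const_mul _) fun x ↦ ?_
  simp only [real_inner_smul_left]
  exact mul_le_mul_of_nonneg_right (le_ciSup bddAbove x) real_inner_self_nonneg

variable [T2Space M]

theorem integral_sum_mvfderiv_coordGrad_eq_zero (hf : IsIsometricImmersion (n := n) f)
    {u : Fin N → M → ℝ} (hu : ∀ a, ContMDiff (𝓡 n) 𝓘(ℝ) ∞ (u a))
    (hu_tangential : ∀ x, ∑ a, u a x * divergence S.leviCivita (coordGrad (n := n) f a) x = 0) :
    ∫ x, ∑ a, mvfderiv (𝓡 n) (u a) x (coordGrad f a x) ∂(riemannianVolume n M) = 0 := by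
  have hLC := S.isLeviCivita_leviCivita
  have integrable_derivative (a) : Integrable
      (fun x ↦ mvfderiv (𝓡 n) (u a) x (coordGrad f a x)) (riemannianVolume n M) := by
    simp only [← inner_grad]
    exact SmoothSection.integrable_inner (contMDiff_grad (hu a)) (hf.contMDiff_coordGrad a)
  have integrable_divergence (a) : Integrable
      (fun x ↦ u a x * divergence S.leviCivita (coordGrad f a) x) (riemannianVolume n M) :=
    integrable_of_continuous
      ((hu a).continuous.mul (hLC.contMDiff_divergence_coordGrad hf a).continuous)
  calc ∫ x, ∑ a, mvfderiv (𝓡 n) (u a) x (coordGrad f a x) ∂(riemannianVolume n M)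
      = ∫ x, ∑ a, (mvfderiv (𝓡 n) (u a) x (coordGrad f a x) +
          u a x * divergence S.leviCivita (coordGrad f a) x) ∂(riemannianVolume n M) := by
        simp only [Finset.sum_add_distrib, hu_tangential, add_zero]
    _ = 0 := by
        refine (integral_finsetSum _ fun a _ ↦
          (integrable_derivative a).add (integrable_divergence a)).trans ?_
        exact Finset.sum_eq_zero fun a _ ↦
          hLC.integral_mvfderiv_add_mul_divergence (hu a) (hf.contMDiff_coordGrad a)

theorem pairing_dirac (hf : IsIsometricImmersion (n := n) f) (hσ : SmoothSection n F σ)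
    (hτ : SmoothSection n F τ) :
    pairing 𝕜 n (S.dirac σ) τ = pairing 𝕜 n σ (S.dirac τ) := by
  have hDσ := S.smooth_dirac hf hσ
  have hDτ := S.smooth_dirac hf hτ
  rw [S.pairing_eq_integral hDσ hτ, S.pairing_eq_integral hσ hDτ, eq_comm, ← sub_eq_zero,
    ← integral_sub (SmoothSection.integrable_inner hσ hDτ) (SmoothSection.integrable_inner hDσ hτ)]
  simp only [← S.sum_mvfderiv_inner_cmulₗ hf hσ hτ]
  exact S.integral_sum_mvfderiv_coordGrad_eq_zero hf
    (fun a ↦ hσ.inner_bundle (S.smooth_cmulₗ (hf.contMDiff_coordGrad a) hτ))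
    fun x ↦ S.sum_mul_divergence_eq_zero hf x ((innerₗ (V x) (σ x)).comp ((S.cmulₗ x).flip (τ x)))

theorem l2Inner_dirac (hf : IsIsometricImmersion (n := n) f) (hσ : SmoothSection n F σ)
    (hτ : SmoothSection n F τ) :
    l2Inner 𝕜 n (S.dirac σ) τ = l2Inner 𝕜 n σ (S.dirac τ) := by
  rw [l2Inner_eq_pairing_add, l2Inner_eq_pairing_add, S.pairing_dirac hf hσ hτ,
    ← S.pairing_dirac hf (S.smooth_smul _ hσ) hτ]
  simp only [funext (S.dirac_smul _ hσ)]

theorem sum_pairing_coordConn_eq_neg (hf : IsIsometricImmersion (n := n) f)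
    (hσ : SmoothSection n F σ) :
    ∑ a, pairing 𝕜 n (S.coordConn f a σ) (S.coordConn f a σ) =
      -pairing 𝕜 n (S.connLap f σ) σ := by
  have hc (a) := S.smooth_coordConn hf a hσ
  have hL := S.smooth_connLap hf hσ
  have product_rule (x : M) :
      ∑ a, mvfderiv (𝓡 n) (fun y ↦ inner ℝ (S.coordConn f a σ y) (σ y)) x (coordGrad f a x) =
        ∑ a, inner ℝ (S.coordConn f a σ x) (S.coordConn f a σ x) +
          inner ℝ (S.connLap f σ x) (σ x) := by
    simp only [S.mvfderiv_inner (hc _) hσ, Finset.sum_add_distrib, connLap, sum_inner]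
    exact add_comm _ _
  rw [S.sum_pairing_eq_integral _ hc hc, S.pairing_eq_integral hL hσ, eq_neg_iff_add_eq_zero,
    ← integral_add (integrable_finsetSum _ fun a _ ↦
      SmoothSection.integrable_inner (hc a) (hc a)) (SmoothSection.integrable_inner hL hσ)]
  simp only [← product_rule]
  exact S.integral_sum_mvfderiv_coordGrad_eq_zero hf (fun a ↦ (hc a).inner_bundle hσ)
    fun x ↦ S.sum_mul_divergence_eq_zero hf x
      (((innerₗ (V x)).flip (σ x)).comp (S.conn σ x).toLinearMap)

theorem sum_pairing_coordConn (hf : IsIsometricImmersion (n := n) f) (hσ : SmoothSection n F σ) :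
    ∑ a, pairing 𝕜 n (S.coordConn f a σ) (S.coordConn f a σ) =
      pairing 𝕜 n (S.dirac (S.dirac σ)) σ - pairing 𝕜 n (S.bochnerCurvature σ) σ := by
  have hD := S.smooth_dirac hf (S.smooth_dirac hf hσ)
  have hR := S.smooth_bochnerCurvature hf hσ
  have hL := S.smooth_connLap hf hσ
  have bochner : pairing 𝕜 n (S.dirac (S.dirac σ)) σ =
      pairing 𝕜 n (S.bochnerCurvature σ) σ - pairing 𝕜 n (S.connLap f σ) σ := by
    rw [S.pairing_eq_integral hD hσ, S.pairing_eq_integral hR hσ, S.pairing_eq_integral hL hσ,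
      ← integral_sub (SmoothSection.integrable_inner hR hσ) (SmoothSection.integrable_inner hL hσ)]
    simp only [S.dirac_dirac_eq_bochnerCurvature_sub_connLap hf hσ, inner_sub_left]
  linarith [S.sum_pairing_coordConn_eq_neg hf hσ]

theorem pairing_coordCommutator_coord_smul (hf : IsIsometricImmersion (n := n) f) (a : Fin N)
    (hσ : SmoothSection n F σ) :
    pairing 𝕜 n (S.coordCommutator f a σ) (fun x ↦ f x a • σ x) =
      pairing 𝕜 n (fun x ↦ ‖coordGrad (n := n) f a x‖ ^ 2 • σ x) σ := by
  have hE := hf.contMDiff_coordGrad a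
  have hC := S.smooth_coordCommutator hf a hσ
  have hfσ : SmoothSection n F fun x ↦ f x a • σ x := (hf.contMDiff_apply a).smul_section hσ
  have hEσ : SmoothSection n F fun x ↦ ‖coordGrad (n := n) f a x‖ ^ 2 • σ x := by
    simp only [← real_inner_self_eq_norm_sq]
    exact (hE.inner_bundle hE).smul_section hσ
  have hu : ContMDiff (𝓡 n) 𝓘(ℝ) ∞ fun x ↦ f x a * inner ℝ (σ x) (σ x) :=
    (hf.contMDiff_apply a).mul (hσ.inner_bundle hσ)
  have product_rule (x : M) :
      mvfderiv (𝓡 n) (fun y ↦ f y a * inner ℝ (σ y) (σ y)) x (coordGrad f a x) +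
          f x a * inner ℝ (σ x) (σ x) * divergence S.leviCivita (coordGrad f a) x =
        inner ℝ (‖coordGrad (n := n) f a x‖ ^ 2 • σ x) (σ x) -
          inner ℝ (S.coordCommutator f a σ x) (f x a • σ x) := by
    have derivative :
        mvfderiv (𝓡 n) (fun y ↦ f y a * inner ℝ (σ y) (σ y)) x (coordGrad f a x) =
          f x a * (inner ℝ (S.conn σ x (coordGrad f a x)) (σ x) +
            inner ℝ (σ x) (S.conn σ x (coordGrad f a x))) +
          inner ℝ (σ x) (σ x) * inner ℝ (coordGrad (n := n) f a x) (coordGrad f a x) := by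
      rw [mvfderiv_fun_mul ((hf.contMDiff_apply a).mdifferentiable (by simp) x)
        ((hσ.inner_bundle hσ).mdifferentiable (by simp) x)]
      simp only [add_apply, smul_apply, smul_eq_mul, S.mvfderiv_inner hσ hσ, ← inner_grad,
        ← coordGrad.eq_1 f a x]
    rw [derivative]
    simp only [coordCommutator, coordConn, inner_neg_left, inner_add_left,
      real_inner_smul_left, real_inner_smul_right, real_inner_self_eq_norm_sq,
      real_inner_comm (S.conn σ x (coordGrad f a x)) (σ x)]
    ring
  rw [S.pairing_eq_integral hC hfσ, S.pairing_eq_integral hEσ hσ, eq_comm, ← sub_eq_zero,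
    ← integral_sub (SmoothSection.integrable_inner hEσ hσ)
      (SmoothSection.integrable_inner hC hfσ)]
  simp only [← product_rule]
  exact S.isLeviCivita_leviCivita.integral_mvfderiv_add_mul_divergence hu hE

theorem isSymmetric_diracₗ (hf : IsIsometricImmersion (n := n) f) :
    (S.diracₗ hf).IsSymmetric :=
  fun σ τ ↦ S.l2Inner_dirac hf σ.smooth τ.smooth

theorem yang_inequality_coord (hf : IsIsometricImmersion (n := n) f) {lam : ℕ → ℝ}
    {φ : ℕ → Cₛ^∞⟮𝓡 n; F, V⟯} (hφ : IsSpectralResolution S lam φ) (a : Fin N) (k : ℕ) :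
    ∑ i ∈ Finset.range k, (lam k - lam i) ^ 2 *
        pairing 𝕜 n (fun x ↦ ‖coordGrad (n := n) f a x‖ ^ 2 • φ i x) (φ i) ≤
      ∑ i ∈ Finset.range k, (lam k - lam i) *
        pairing 𝕜 n (S.coordCommutator f a (φ i)) (S.coordCommutator f a (φ i)) := by
  let Φ (i : ℕ) : S.SmoothSections := S.ofSection (φ i)
  have orthonormal : Orthonormal 𝕜 Φ := orthonormal_iff_ite.2 hφ.orthonormal
  have eigen (i : ℕ) : (S.diracₗ hf ^ 2) (Φ i) = (lam i : 𝕜) • Φ i :=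
    SmoothSections.ext fun x ↦ (hφ.eigen i x).trans (ofReal_smul_eq ..).symm
  have lie_apply (i : ℕ) : ⇑(⁅S.diracₗ hf ^ 2, S.coordMul hf a⁆ (Φ i)) =
      S.coordCommutator f a (φ i) :=
    funext (S.lie_diracₗ_sq_coordMul_apply hf a (Φ i))
  have yang := sum_sq_mul_re_inner_lie_le ((S.isSymmetric_diracₗ hf).pow 2)
    (S.isSymmetric_coordMul hf a) orthonormal hφ.dense_span eigen
    (Λ := lam k) (s := Finset.range k)
    (fun i hi ↦ hφ.monotone (Finset.mem_range.1 hi).le)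
    (fun j hj ↦ hφ.monotone (not_lt.1 (mt Finset.mem_range.2 hj)))
  have re_inner_eq (i : ℕ) :
      RCLike.re (inner 𝕜 (⁅S.diracₗ hf ^ 2, S.coordMul hf a⁆ (Φ i)) (S.coordMul hf a (Φ i))) =
        pairing 𝕜 n (fun x ↦ ‖coordGrad (n := n) f a x‖ ^ 2 • φ i x) (φ i) := by
    rw [← S.pairing_coordCommutator_coord_smul hf a (φ i).contMDiff, ← lie_apply]
    rfl
  simpa only [SmoothSections.norm_sq_eq_pairing, lie_apply, re_inner_eq] using yang

theorem sum_pairing_coordCommutator (hf : IsIsometricImmersion (n := n) f) (hn : n ≠ 0)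
    {σ : Π x : M, V x} (hσ : SmoothSection n F σ) :
    ∑ a, pairing 𝕜 n (S.coordCommutator f a σ) (S.coordCommutator f a σ) =
      4 * (pairing 𝕜 n (S.dirac (S.dirac σ)) σ - pairing 𝕜 n (S.bochnerCurvature σ) σ) +
        (n : ℝ) ^ 2 * pairing 𝕜 n (fun x ↦ meanCurvature (n := n) f x ^ 2 • σ x) σ := by
  have hC (a) := S.smooth_coordCommutator hf a hσ
  have hc (a) := S.smooth_coordConn hf a hσ
  have hHσ := S.smooth_meanCurvature_sq_smul hf hn hσ
  rw [← S.sum_pairing_coordConn hf hσ, S.sum_pairing_eq_integral _ hC hC,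
    S.sum_pairing_eq_integral _ hc hc, S.pairing_eq_integral hHσ hσ, ← integral_const_mul,
    ← integral_const_mul, ← integral_add ((integrable_finsetSum _ fun a _ ↦
      SmoothSection.integrable_inner (hc a) (hc a)).const_mul _)
      ((SmoothSection.integrable_inner hHσ hσ).const_mul _)]
  simp only [real_inner_smul_left, real_inner_self_eq_norm_sq, S.sum_norm_coordCommutator_sq hf,
    ← mul_assoc, S.isLeviCivita_leviCivita.sq_mul_meanCurvature_sq hf hn]

theorem yang_inequality (hf : IsIsometricImmersion (n := n) f) (hn : n ≠ 0) {lam : ℕ → ℝ}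
    {φ : ℕ → Cₛ^∞⟮𝓡 n; F, V⟯} (hφ : IsSpectralResolution S lam φ) (k : ℕ) :
    ∑ i ∈ Finset.range k, (lam k - lam i) ^ 2 ≤
      4 / (n : ℝ) * ∑ i ∈ Finset.range k, (lam k - lam i) * (lam i + 1 / 4 *
        ((n : ℝ) ^ 2 * pairing 𝕜 n (fun x ↦ meanCurvature (n := n) f x ^ 2 • φ i x) (φ i) -
          4 * pairing 𝕜 n (S.bochnerCurvature (φ i)) (φ i))) := by
  let μ (i : ℕ) : ℝ := lam i + 1 / 4 *
    ((n : ℝ) ^ 2 * pairing 𝕜 n (fun x ↦ meanCurvature (n := n) f x ^ 2 • φ i x) (φ i) -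
      4 * pairing 𝕜 n (S.bochnerCurvature (φ i)) (φ i))
  have smooth (i : ℕ) : SmoothSection n F (φ i) := (φ i).contMDiff
  have sum_norm_sq (i : ℕ) :
      ∑ a, pairing 𝕜 n (fun x ↦ ‖coordGrad (n := n) f a x‖ ^ 2 • φ i x) (φ i) = n := by
    rw [S.sum_pairing_norm_coordGrad_sq hf (smooth i), hφ.pairing_self, mul_one]
  have sum_commutator_sq (i : ℕ) :
      ∑ a, pairing 𝕜 n (S.coordCommutator f a (φ i)) (S.coordCommutator f a (φ i)) =
        4 * μ i := by
    rw [S.sum_pairing_coordCommutator hf hn (smooth i), hφ.pairing_dirac_dirac]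
    simp only [μ]
    ring
  have sum_yang_inequality : (n : ℝ) * ∑ i ∈ Finset.range k, (lam k - lam i) ^ 2 ≤
      4 * ∑ i ∈ Finset.range k, (lam k - lam i) * μ i := by
    have := Finset.sum_le_sum fun a (_ : a ∈ Finset.univ) ↦ S.yang_inequality_coord hf hφ a k
    rw [Finset.sum_comm, Finset.sum_comm (s := Finset.univ)] at this
    simpa only [← Finset.mul_sum, sum_norm_sq, sum_commutator_sq, ← Finset.sum_mul,
      mul_comm (n : ℝ), mul_left_comm _ (4 : ℝ)] using this
  rw [div_mul_eq_mul_div, le_div_iff₀' (by positivity)]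
  exact sum_yang_inequality

end DiracBundle

end Dirac

end DiracYang

end

theorem theorem3p1_general {𝕜 : Type*} [RCLike 𝕜] {n N : ℕ} (hn : 0 < n)
    {M : Type*} [TopologicalSpace M] [CompactSpace M] [T2Space M]
    [MeasurableSpace M] [BorelSpace M]
    [ChartedSpace (EuclideanSpace ℝ (Fin n)) M] [IsManifold (𝓡 n) ∞ M]
    [RiemannianBundle (fun x : M ↦ TangentSpace (𝓡 n) x)]
    [IsContMDiffRiemannianBundle (𝓡 n) ∞ (EuclideanSpace ℝ (Fin n))
      (fun x : M ↦ TangentSpace (𝓡 n) x)]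
    (f : M → EuclideanSpace ℝ (Fin N)) (hf : DiracYang.IsIsometricImmersion (n := n) f)
    {F : Type*} [NormedAddCommGroup F] [NormedSpace ℝ F] [FiniteDimensional ℝ F]
    {V : M → Type*} [TopologicalSpace (TotalSpace F V)]
    [∀ x, NormedAddCommGroup (V x)] [∀ x, InnerProductSpace ℝ (V x)]
    [∀ x, InnerProductSpace 𝕜 (V x)]
    [FiberBundle F V] [VectorBundle ℝ F V] [ContMDiffVectorBundle ∞ F V (𝓡 n)]
    [IsContMDiffRiemannianBundle (𝓡 n) ∞ F V]
    (S : DiracYang.DiracBundle 𝕜 n F V) (lam : ℕ → ℝ) (φ : ℕ → Cₛ^∞⟮𝓡 n; F, V⟯)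
    (hφ : DiracYang.IsSpectralResolution S lam φ) :
    (∀ k : ℕ,
      ∑ i ∈ Finset.range k, (lam k - lam i) ^ 2 ≤
        4 / (n : ℝ) * ∑ i ∈ Finset.range k, (lam k - lam i) *
          (lam i + 1 / 4 *
            ((n : ℝ) ^ 2 *
                DiracYang.pairing 𝕜 n
                  (fun x ↦ DiracYang.meanCurvature (n := n) f x ^ 2 • φ i x) (φ i) -
              4 * DiracYang.pairing 𝕜 n (S.bochnerCurvature (φ i)) (φ i)))) ∧
    (∀ (k : ℕ) (R : ℝ),
      (∀ i < k, R ≤ DiracYang.pairing 𝕜 n (S.bochnerCurvature (φ i)) (φ i)) →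
      ∀ η : ℕ → ℝ,
        (∀ i, η i = lam i +
          1 / 4 * (n : ℝ) ^ 2 * (⨆ x : M, DiracYang.meanCurvature (n := n) f x ^ 2) - R) →
        ∑ i ∈ Finset.range k, (η k - η i) * (η k - (1 + 4 / (n : ℝ)) * η i) ≤ 0) := by
  refine ⟨S.yang_inequality hf hn.ne' hφ, fun k R hR η hη ↦ ?_⟩
  have sub_eq (i : ℕ) : lam k - lam i = η k - η i := by rw [hη, hη]; ring
  have curvature_bound (i : ℕ) (hi : i ∈ Finset.range k) :
      lam i + 1 / 4 * ((n : ℝ) ^ 2 * DiracYang.pairing 𝕜 n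
          (fun x ↦ DiracYang.meanCurvature (n := n) f x ^ 2 • φ i x) (φ i) -
        4 * DiracYang.pairing 𝕜 n (S.bochnerCurvature (φ i)) (φ i)) ≤ η i := by
    have meanCurvature_le := S.pairing_meanCurvature_sq_smul_le hf hn.ne' (φ i).contMDiff
    rw [hφ.pairing_self, mul_one] at meanCurvature_le
    have := mul_le_mul_of_nonneg_left meanCurvature_le (sq_nonneg (n : ℝ))
    linarith [hη i, hR i (Finset.mem_range.1 hi)]
  have sum_sq_le : ∑ i ∈ Finset.range k, (lam k - lam i) ^ 2 ≤
      4 / (n : ℝ) * ∑ i ∈ Finset.range k, (lam k - lam i) * η i :=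
    (S.yang_inequality hf hn.ne' hφ k).trans <| by
      gcongr with i hi
      exacts [sub_nonneg.2 (hφ.monotone (Finset.mem_range.1 hi).le), curvature_bound i hi]
  rw [Finset.mul_sum, ← sub_nonpos, ← Finset.sum_sub_distrib] at sum_sq_le
  refine le_of_eq_of_le (Finset.sum_congr rfl fun i _ ↦ ?_) sum_sq_le
  rw [sub_eq]
  ring

theorem theorem3p1 {𝕜 : Type*} [RCLike 𝕜] {n N : ℕ} (hn : 0 < n)
    {M : Type*} [TopologicalSpace M] [CompactSpace M] [T2Space M]
    [MeasurableSpace M] [BorelSpace M]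
    [ChartedSpace (EuclideanSpace ℝ (Fin n)) M] [IsManifold (𝓡 n) ∞ M]
    [RiemannianBundle (fun x : M ↦ TangentSpace (𝓡 n) x)]
    [IsContMDiffRiemannianBundle (𝓡 n) ∞ (EuclideanSpace ℝ (Fin n))
      (fun x : M ↦ TangentSpace (𝓡 n) x)]
    (f : M → EuclideanSpace ℝ (Fin N)) (hf : DiracYang.IsIsometricEmbedding (n := n) f)
    {F : Type*} [NormedAddCommGroup F] [NormedSpace ℝ F] [FiniteDimensional ℝ F]
    {V : M → Type*} [TopologicalSpace (TotalSpace F V)]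
    [∀ x, NormedAddCommGroup (V x)] [∀ x, InnerProductSpace ℝ (V x)]
    [∀ x, InnerProductSpace 𝕜 (V x)]
    [FiberBundle F V] [VectorBundle ℝ F V] [ContMDiffVectorBundle ∞ F V (𝓡 n)]
    [IsContMDiffRiemannianBundle (𝓡 n) ∞ F V]
    (S : DiracYang.DiracBundle 𝕜 n F V) (lam : ℕ → ℝ) (φ : ℕ → Cₛ^∞⟮𝓡 n; F, V⟯)
    (hφ : DiracYang.IsSpectralResolution S lam φ) :
    (∀ k : ℕ,
      ∑ i ∈ Finset.range k, (lam k - lam i) ^ 2 ≤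
        4 / (n : ℝ) * ∑ i ∈ Finset.range k, (lam k - lam i) *
          (lam i + 1 / 4 *
            ((n : ℝ) ^ 2 *
                DiracYang.pairing 𝕜 n (fun x ↦ DiracYang.meanCurvature (n := n) f x ^ 2 • φ i x) (φ i) -
              4 * DiracYang.pairing 𝕜 n (S.bochnerCurvature (φ i)) (φ i)))) ∧
    (∀ (k : ℕ) (R : ℝ),
      (∀ i < k, R ≤ DiracYang.pairing 𝕜 n (S.bochnerCurvature (φ i)) (φ i)) →
      ∀ η : ℕ → ℝ,
        (∀ i, η i = lam i + 1 / 4 * (n : ℝ) ^ 2 * (⨆ x : M, DiracYang.meanCurvature (n := n) f x ^ 2) - R) →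
        ∑ i ∈ Finset.range k, (η k - η i) * (η k - (1 + 4 / (n : ℝ)) * η i) ≤ 0) :=
  theorem3p1_general hn f hf.isIsometricImmersion S lam φ hφ
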